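/- Let $\Omega\subset\mathbb R^3$ be a bounded open set with $C^2$ boundary $\partial\Omega=\overline{\Gamma_0}\cup\overline{\Gamma_1}$, where $\Gamma_0,\Gamma_1$ are nonempty and disjoint, and $\Gamma_0$ is flat: it is (identified with) a planar open set, with $C^2$ boundary $\partial\Gamma_0$. Let $0\le\gamma\le1$, $\alpha>0$, $0<\mu<1$, $\lambda\ge0$. All spaces are complex, $(\cdot,\cdot)_S$ and $\|\cdot\|_S$ are the inner product and norm of $L^2(S)$, $\nu$ is the outer unit normal and $\gamma_0$ the trace on $\partial\Gamma_0$. Put $H^1_{0,\gamma}(\Gamma_0)=H^1_0(\Gamma_0)$ if $\gamma>0$ and $L^2(\Gamma_0)$ if $\gamma=0$, with dual $H^{-1}_{0,\gamma}(\Gamma_0)$, and $$a(\phi,\psi)=\int_{\Gamma_0}\big[\phi_{xx}\overline{\psi}_{xx}+\phi_{yy}\overline{\psi}_{yy}+\mu(\phi_{xx}\overline{\psi}_{yy}+\phi_{yy}\overline{\psi}_{xx})+2(1-\mu)\phi_{xy}\overline{\psi}_{xy}\big]\,d\Gamma_0 .$$ Let $\mathbf H=H^1(\Omega)\times L^2(\Omega)\times[H^2(\Gamma_0)\cap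 H^1_0(\Gamma_0)]\times H^1_{0,\gamma}(\Gamma_0)\times L^2(\Gamma_0)$ with $$([z_1,z_2,w_1,w_2,\theta],[\tilde z_1,\tilde z_2,\tilde w_1,\tilde w_2,\tilde\theta])_{\mathbf H}=(\nabla z_1,\nabla\tilde z_1)_\Omega+(z_1,\tilde z_1)_\Omega+(z_2,\tilde z_2)_\Omega+a(w_1,\tilde w_1)+(w_2,\tilde w_2)_{\Gamma_0}+\gamma(\nabla w_2,\nabla\tilde w_2)_{\Gamma_0}+(\theta,\tilde\theta)_{\Gamma_0}.$$ Operators: * $A_N=I-\Delta$ on $D(A_N)=\{z\in H^2(\Omega):\partial z/\partial\nu=0\text{ on }\partial\Omega\}$; * $N:L^2(\Gamma_0)\to L^2(\Omega)$, where $h=Ng$ is the weak solution of $(I-\Delta)h=0$ in $\Omega$, $\partial h/\partial\nu=g$ on $\Gamma_0$, $\partial h/\partial\nu=0$ on $\Gamma_1$; * $A_D=-\Delta$ on $H^2(\Gamma_0)\cap H^1_0(\Gamma_0)$, and $P_\gamma=I+\gamma A_D:H^1_{0,\gamma}(\Gamma_0)\to H^{-1}_{0,\gamma}(\Gamma_0)$;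 * $\mathring A$, the operator $H^2(\Gamma_0)\cap H^1_0(\Gamma_0)=D(\mathring A^{1/2})\to[D(\mathring A^{1/2})]'$ given by $\langle\mathring Aw,\varpi\rangle=a(w,\varpi)$, that is, $\Delta^2$ under the boundary conditions $w=0$, $\Delta w+(1-\mu)B_1w=0$ on $\partial\Gamma_0$, where $B_1w=2\nu_1\nu_2w_{xy}-\nu_1^2w_{yy}-\nu_2^2w_{xx}$; * $D:L^2(\partial\Gamma_0)\to L^2(\Gamma_0)$, where $v=Dh$ solves $\Delta v=0$ in $\Gamma_0$, $v=h$ on $\partial\Gamma_0$; * $G:L^2(\partial\Gamma_0)\to L^2(\Gamma_0)$, where $v=Gh$ is the weak solution of $\Delta^2v=0$ in $\Gamma_0$, $v=0$ and $\Delta v+(1-\mu)B_1v=h$ on $\partial\Gamma_0$, i.e. $v\in H^2(\Gamma_0)\cap H^1_0(\Gamma_0)$ and $a(v,\varpi)=(h,\partial\varpi/\partial\nu)_{\partial\Gamma_0}$ for all $\varpi\in H^2(\Gamma_0)\cap H^1_0(\Gamma_0)$. Let $D(\mathbf A)$ be the set of all $\Phi=[z_1,z_2,w_1,w_2,\theta]\in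 H^1(\Omega)\times H^1(\Omega)\times D(\mathring A^{1/2})\times D(\mathring A^{1/2})\times H^2(\Gamma_0)$ with $z_1-Nw_2\in D(A_N)$, $\mathring Aw_1+\alpha\mathring AG\gamma_0\theta\in H^{-1}_{0,\gamma}(\Gamma_0)$ and $\partial\theta/\partial\nu+\lambda\theta=0$ on $\partial\Gamma_0$, and for such $\Phi$ let $$\mathbf A\Phi=\begin{bmatrix} z_2\\ -A_N(z_1-Nw_2)\\ w_2\\ P_\gamma^{-1}\big(-z_2|_{\Gamma_0}-[\mathring Aw_1+\alpha\mathring AG\gamma_0\theta]+\alpha A_D(I-D\gamma_0)\theta\big)\\ -\alpha A_Dw_2-A_D(I-D\gamma_0)\theta-\theta\end{bmatrix}.$$ Then for every $\Phi=[z_1,z_2,w_1,w_2,\theta]\in D(\mathbf A)$ one has $\mathbf A\Phi\in\mathbf H$ and $$\operatorname{Re}(\mathbf A\Phi,\Phi)_{\mathbf H}=-\|\nabla\theta\|_{\Gamma_0}^2-\|\theta\|_{\Gamma_0}^2-\lambda\|\theta\|_{\partial\Gamma_0}^2 .$$ -/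

import Mathlib

open MeasureTheory Filter Topology Set
open scoped ContDiff ComplexConjugate ENNReal

noncomputable section

namespace StructuralAcoustics

/-- The Euclidean space `ℝ^d`. -/
abbrev E (d : ℕ) := EuclideanSpace ℝ (Fin d)

open Classical in
/-- The object with property `P`, when there is one; `0` otherwise. Below it is only used for
properties that determine the object uniquely. -/
def theObj {X : Type*} [Zero X] (P : X → Prop) : X :=
  if h : ∃ a, P a then h.choose else 0

/-! ### Domains of class `C²`, outer normal, surface measure -/

/-- `U` has a `C²` boundary: near each boundary point, `U` is the strict hypograph, in the direction
of some unit vector `e`, of a `C²` function of the variables orthogonal to `e`. -/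
def HasC2Boundary {d : ℕ} (U : Set (E d)) : Prop :=
  ∀ x ∈ frontier U, ∃ (V : Set (E d)) (e : E d) (g : E d → ℝ),
    IsOpen V ∧ x ∈ V ∧ ‖e‖ = 1 ∧ ContDiff ℝ 2 g ∧
    (∀ (y : E d) (s : ℝ), g (y + s • e) = g y) ∧
    ∀ y ∈ V, (y ∈ U ↔ inner ℝ y e < g y)

/-- `ν` is the outer unit normal of `U` at the boundary point `x`: seen from `x`, the set `U` is to
first order the half-space `{y | ⟪y - x, ν⟫ < 0}`. -/
def IsOuterNormal {d : ℕ} (U : Set (E d)) (x ν : E d) : Prop :=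
  ‖ν‖ = 1 ∧ ∀ ε : ℝ, 0 < ε → ∃ δ : ℝ, 0 < δ ∧ ∀ y : E d, ‖y - x‖ < δ →
    (inner ℝ (y - x) ν < -(ε * ‖y - x‖) → y ∈ U) ∧
    (ε * ‖y - x‖ < inner ℝ (y - x) ν → y ∉ U)

/-- The outer unit normal field on the boundary of `U`. -/
def outerNormal {d : ℕ} (U : Set (E d)) (x : E d) : E d := theObj (IsOuterNormal U x)

/-- The surface measure on the boundary of `U ⊆ ℝ^d`: the `(d-1)`-dimensional Hausdorff measure,
normalised so as to agree with Lebesgue measure on `(d-1)`-dimensional subspaces. -/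
def surfaceMeasure {d : ℕ} (U : Set (E d)) : Measure (E d) := μHE[d - 1].restrict (frontier U)

/-! ### Lebesgue and Sobolev spaces -/

/-- Complex `L²(U)`. -/
abbrev L2 {d : ℕ} (U : Set (E d)) := Lp ℂ 2 (volume.restrict U)

/-- Complex `L²(∂U)`. -/
abbrev L2Bdry {d : ℕ} (U : Set (E d)) := Lp ℂ 2 (surfaceMeasure U)

/-- The inner product `(f, g) = ∫_U f ḡ`, linear in the first argument. -/
def ip {d : ℕ} {U : Set (E d)} (f g : L2 U) : ℂ := inner ℂ g f

/-- The classical `i`-th partial derivative. -/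
def pd {d : ℕ} {F : Type*} [NormedAddCommGroup F] [NormedSpace ℝ F] (i : Fin d) (φ : E d → F)
    (x : E d) : F :=
  fderiv ℝ φ x (EuclideanSpace.single i 1)

/-- `φ ∈ C_c^∞(U)`. -/
def IsTest {d : ℕ} {F : Type*} [NormedAddCommGroup F] [NormedSpace ℝ F] (U : Set (E d))
    (φ : E d → F) : Prop :=
  ContDiff ℝ ∞ φ ∧ HasCompactSupport φ ∧ tsupport φ ⊆ U

/-- `g` is the weak `i`-th partial derivative of `f` in `U`. -/
def HasWeakPartial {d : ℕ} {U : Set (E d)} (i : Fin d) (f g : L2 U) : Prop :=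
  ∀ φ : E d → ℝ, IsTest U φ → ∫ x in U, pd i φ x • f x = -∫ x in U, φ x • g x

/-- The weak `i`-th partial derivative. -/
def weakPartial {d : ℕ} {U : Set (E d)} (i : Fin d) (f : L2 U) : L2 U := theObj (HasWeakPartial i f)

/-- `g` is the distributional Laplacian of `f` in `U`. -/
def HasLaplacian {d : ℕ} {U : Set (E d)} (f g : L2 U) : Prop :=
  ∀ φ : E d → ℝ, IsTest U φ →
    ∫ x in U, (∑ i, pd i (pd i φ) x) • f x = ∫ x in U, φ x • g x

/-- The distributional Laplacian, for functions whose Laplacian is in `L²(U)`. -/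
def laplacian {d : ℕ} {U : Set (E d)} (f : L2 U) : L2 U := theObj (HasLaplacian f)

/-- `H¹(U)`. -/
def H1 {d : ℕ} (U : Set (E d)) : Set (L2 U) := {f | ∀ i, ∃ g, HasWeakPartial i f g}

/-- `H²(U)`. -/
def H2 {d : ℕ} (U : Set (E d)) : Set (L2 U) := {f | f ∈ H1 U ∧ ∀ i, weakPartial i f ∈ H1 U}

/-- `(∇f, ∇g) = ∑_i ∫_U ∂_i f conj(∂_i g)`. -/
def gradIp {d : ℕ} {U : Set (E d)} (f g : L2 U) : ℂ := ∑ i, ip (weakPartial i f) (weakPartial i g)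

/-- `‖∇f‖²`. -/
def gradNormSq {d : ℕ} {U : Set (E d)} (f : L2 U) : ℝ := ∑ i, ‖weakPartial i f‖ ^ 2

/-- The smooth functions `φ n` converge to `f` in the norm of `H¹(U)`. -/
def TendstoH1 {d : ℕ} {U : Set (E d)} (φ : ℕ → E d → ℂ) (f : L2 U) : Prop :=
  Tendsto (fun n => eLpNorm (fun x => φ n x - f x) 2 (volume.restrict U)) atTop (𝓝 0) ∧
  ∀ i, Tendsto (fun n => eLpNorm (fun x => pd i (φ n) x - weakPartial i f x) 2 (volume.restrict U))
    atTop (𝓝 0)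

/-- `H¹₀(U)`: the closure of `C_c^∞(U)` in `H¹(U)`. -/
def H10 {d : ℕ} (U : Set (E d)) : Set (L2 U) :=
  {f | f ∈ H1 U ∧ ∃ φ : ℕ → E d → ℂ, (∀ n, IsTest U (φ n)) ∧ TendstoH1 φ f}

/-- `t` is the boundary trace of `f ∈ H¹(U)`: the value at `f` of the continuous extension to
`H¹(U)` of the map `φ ↦ φ|_∂U` on functions that are smooth up to the boundary. -/
def IsTrace {d : ℕ} {U : Set (E d)} (f : L2 U) (t : L2Bdry U) : Prop :=
  f ∈ H1 U ∧ ∃ φ : ℕ → E d → ℂ, (∀ n, ContDiff ℝ ∞ (φ n) ∧ HasCompactSupport (φ n)) ∧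
    TendstoH1 φ f ∧
    Tendsto (fun n => eLpNorm (fun x => φ n x - t x) 2 (surfaceMeasure U)) atTop (𝓝 0)

/-- The Sobolev trace map `γ₀ : H¹(U) → L²(∂U)`. -/
def trace {d : ℕ} {U : Set (E d)} (f : L2 U) : L2Bdry U := theObj (IsTrace f)

/-- The normal derivative `∂f/∂ν = ν · γ₀(∇f)` of `f ∈ H²(U)` on the boundary of `U`. -/
def normalDeriv {d : ℕ} {U : Set (E d)} (f : L2 U) (x : E d) : ℂ :=
  ∑ i, ((outerNormal U x i : ℝ) : ℂ) * trace (weakPartial i f) x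

/-! ### The acoustic chamber -/

/-- An acoustic chamber: a bounded open set `Ω ⊆ ℝ³` with `C²` boundary
`∂Ω = closure Γ₀ ∪ closure Γ₁`, where `Γ₀` and `Γ₁` are nonempty and disjoint and `Γ₀` is flat. The
flat part is given as the image of a planar open set `G` with `C²` boundary under an isometric
affine embedding `ι` of the plane. Functions on `Γ₀` are regarded as functions on `G`. -/
structure Chamber where
  Ω : Set (E 3)
  isOpen_Ω : IsOpen Ω
  isBounded_Ω : Bornology.IsBounded Ω
  c2_Ω : HasC2Boundary Ω
  G : Set (E 2)
  isOpen_G : IsOpen G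
  nonempty_G : G.Nonempty
  c2_G : HasC2Boundary G
  ι : E 2 →ᵃⁱ[ℝ] E 3
  Γ₁ : Set (E 3)
  nonempty_Γ₁ : Γ₁.Nonempty
  frontier_Ω : frontier Ω = closure (ι '' G) ∪ closure Γ₁
  disjoint_Γ : Disjoint (ι '' G) Γ₁

variable (C : Chamber)

/-- The restriction `f|_Γ₀` of the trace of `f ∈ H¹(Ω)`, as a function on the planar set `G`. -/
def Chamber.traceΓ₀ (f : L2 C.Ω) (y : E 2) : ℂ := trace f (C.ι y)

/-! ### The operators on the chamber `Ω` -/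

/-- `D(A_N) = {z ∈ H²(Ω) : ∂z/∂ν = 0 on ∂Ω}`. -/
def Chamber.domAN : Set (L2 C.Ω) :=
  {z | z ∈ H2 C.Ω ∧ ∀ᵐ x ∂surfaceMeasure C.Ω, normalDeriv z x = 0}

/-- `A_N = I - Δ`. -/
def Chamber.opAN (z : L2 C.Ω) : L2 C.Ω := z - laplacian z

/-- `h` is the weak solution of `(I - Δ) h = 0` in `Ω`, `∂h/∂ν = g` on `Γ₀`, `∂h/∂ν = 0` on `Γ₁`,
where `g ∈ L²(Γ₀)`. -/
def Chamber.IsNeumannExt (g : L2 C.G) (h : L2 C.Ω) : Prop :=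
  h ∈ H1 C.Ω ∧ ∀ ψ ∈ H1 C.Ω,
    gradIp h ψ + ip h ψ = ∫ y in C.G, g y * conj (C.traceΓ₀ ψ y)

/-- The Neumann map `N : L²(Γ₀) → L²(Ω)`. -/
def Chamber.opN (g : L2 C.G) : L2 C.Ω := theObj (C.IsNeumannExt g)

/-! ### The operators on the flat wall, seen as a planar set `G` -/

section Plate

variable {G : Set (E 2)}

/-- The plate bilinear form
`a(φ,ψ) = ∫ φ_xx ψ̄_xx + φ_yy ψ̄_yy + μ (φ_xx ψ̄_yy + φ_yy ψ̄_xx) + 2 (1 - μ) φ_xy ψ̄_xy`. -/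
def plateForm (μ : ℝ) (φ ψ : L2 G) : ℂ :=
  let dxx (f : L2 G) := weakPartial 0 (weakPartial 0 f)
  let dyy (f : L2 G) := weakPartial 1 (weakPartial 1 f)
  let dxy (f : L2 G) := weakPartial 0 (weakPartial 1 f)
  ip (dxx φ) (dxx ψ) + ip (dyy φ) (dyy ψ)
    + (μ : ℂ) * (ip (dxx φ) (dyy ψ) + ip (dyy φ) (dxx ψ))
    + 2 * (1 - (μ : ℂ)) * ip (dxy φ) (dxy ψ)

variable (G) in
/-- `H²(Γ₀) ∩ H¹₀(Γ₀)`. It is both `D(A_D)` and `D(Å^{1/2})`, where `Å` is the self-adjoint operator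
of the form `a`, i.e. `Δ²` under the conditions `w = 0`, `Δw + (1-μ) B₁ w = 0` on `∂Γ₀`.
As an operator from `D(Å^{1/2})` to its dual, `Å w` is the functional `ϖ ↦ a(w, ϖ)`. -/
def H2H10 : Set (L2 G) := H2 G ∩ H10 G

/-- `A_D = -Δ`. -/
def opAD (f : L2 G) : L2 G := -laplacian f

/-- `v ∈ L²(Γ₀)` is the solution of `Δv = 0` in `Γ₀`, `v = h` on `∂Γ₀`, with `h ∈ L²(∂Γ₀)`, in the
sense of transposition. -/
def IsDirichletExt (h : L2Bdry G) (v : L2 G) : Prop :=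
  ∀ φ ∈ H2H10 G, ip v (laplacian φ) = ∫ x, h x * conj (normalDeriv φ x) ∂surfaceMeasure G

/-- The Dirichlet map `D : L²(∂Γ₀) → L²(Γ₀)`. -/
def opD (h : L2Bdry G) : L2 G := theObj (IsDirichletExt h)

/-- `v` is the weak solution of `Δ²v = 0` in `Γ₀`, `v = 0` and `Δv + (1-μ) B₁ v = h` on `∂Γ₀`, with
`h ∈ L²(∂Γ₀)`. -/
def IsGreenExt (μ : ℝ) (h : L2Bdry G) (v : L2 G) : Prop :=
  v ∈ H2H10 G ∧ ∀ ϖ ∈ H2H10 G,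
    plateForm μ v ϖ = ∫ x, h x * conj (normalDeriv ϖ x) ∂surfaceMeasure G

/-- The Green map `G : L²(∂Γ₀) → L²(Γ₀)`. -/
def opG (μ : ℝ) (h : L2Bdry G) : L2 G := theObj (IsGreenExt μ h)

open Classical in
variable (G) in
/-- `H¹_{0,γ}(Γ₀)`: it is `H¹₀(Γ₀)` if `γ > 0` and `L²(Γ₀)` if `γ = 0`. -/
def H10γ (γ : ℝ) : Set (L2 G) := if 0 < γ then H10 G else univ

/-- `‖f‖² + γ ‖∇f‖²`, the squared norm of `H¹_{0,γ}(Γ₀)`. -/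
def normSqγ (γ : ℝ) (f : L2 G) : ℝ := ‖f‖ ^ 2 + γ * gradNormSq f

/-- A functional `ℓ` given on the dense subspace `H² ∩ H¹₀` of `H¹_{0,γ}` belongs to the dual
`H⁻¹_{0,γ}`: it is bounded in the norm of `H¹_{0,γ}`. -/
def MemDualγ (γ : ℝ) (ℓ : L2 G → ℂ) : Prop :=
  ∃ K : ℝ, ∀ ϖ ∈ H2H10 G, ‖ℓ ϖ‖ ≤ K * Real.sqrt (normSqγ γ ϖ)

/-- `P_γ⁻¹ ℓ` for `ℓ ∈ H⁻¹_{0,γ}`, where `P_γ = I + γ A_D : H¹_{0,γ} → H⁻¹_{0,γ}`: the element `p` of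
`H¹_{0,γ}` with `(p, ϖ) + γ (∇p, ∇ϖ) = ℓ(ϖ)` for all `ϖ` (in the dense subspace `H² ∩ H¹₀`). -/
def opPinv (γ : ℝ) (ℓ : L2 G → ℂ) : L2 G :=
  theObj fun p => p ∈ H10γ G γ ∧ ∀ ϖ ∈ H2H10 G, ip p ϖ + (γ : ℂ) * gradIp p ϖ = ℓ ϖ

/-- The functional `Å w + α Å G γ₀ θ` on `D(Å^{1/2}) = H² ∩ H¹₀`. -/
def plateFunctional (α μ : ℝ) (w θ ϖ : L2 G) : ℂ :=
  plateForm μ w ϖ + (α : ℂ) * plateForm μ (opG μ (trace θ)) ϖ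

/-- `A_D (I - D γ₀) θ`. -/
def opADD (θ : L2 G) : L2 G := opAD (θ - opD (trace θ))

end Plate

/-! ### The energy space and the structural acoustic operator -/

/-- A quintuple `[z₁, z₂, w₁, w₂, θ]` in `L²(Ω)² × L²(Γ₀)³`. -/
structure State where
  z₁ : L2 C.Ω
  z₂ : L2 C.Ω
  w₁ : L2 C.G
  w₂ : L2 C.G
  θ : L2 C.G

/-- The energy space `𝐇 = H¹(Ω) × L²(Ω) × (H²(Γ₀) ∩ H¹₀(Γ₀)) × H¹_{0,γ}(Γ₀) × L²(Γ₀)`. -/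
def energySpace (γ : ℝ) : Set (State C) :=
  {Φ | Φ.z₁ ∈ H1 C.Ω ∧ Φ.w₁ ∈ H2H10 C.G ∧ Φ.w₂ ∈ H10γ C.G γ}

variable {C}

/-- The inner product of `𝐇`. -/
def energyIp (γ μ : ℝ) (Φ Ψ : State C) : ℂ :=
  gradIp Φ.z₁ Ψ.z₁ + ip Φ.z₁ Ψ.z₁ + ip Φ.z₂ Ψ.z₂ + plateForm μ Φ.w₁ Ψ.w₁
    + ip Φ.w₂ Ψ.w₂ + (γ : ℂ) * gradIp Φ.w₂ Ψ.w₂ + ip Φ.θ Ψ.θ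

variable (C) in
/-- The domain `D(𝐀)`. -/
def domA (γ α μ lam : ℝ) : Set (State C) :=
  {Φ | Φ.z₁ ∈ H1 C.Ω ∧ Φ.z₂ ∈ H1 C.Ω ∧ Φ.w₁ ∈ H2H10 C.G ∧ Φ.w₂ ∈ H2H10 C.G ∧ Φ.θ ∈ H2 C.G ∧
    Φ.z₁ - C.opN Φ.w₂ ∈ C.domAN ∧
    MemDualγ γ (plateFunctional α μ Φ.w₁ Φ.θ) ∧
    ∀ᵐ x ∂surfaceMeasure C.G, normalDeriv Φ.θ x + (lam : ℂ) * trace Φ.θ x = 0}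

/-- The operator `𝐀`, for arguments in `D(𝐀)`. Its rows are
`z₂`, `-A_N (z₁ - N w₂)`, `w₂`,
`P_γ⁻¹ (-z₂|_Γ₀ - (Å w₁ + α Å G γ₀ θ) + α A_D (I - D γ₀) θ)`,
`-α A_D w₂ - A_D (I - D γ₀) θ - θ`. -/
def opA (γ α μ : ℝ) (Φ : State C) : State C where
  z₁ := Φ.z₂
  z₂ := -C.opAN (Φ.z₁ - C.opN Φ.w₂)
  w₁ := Φ.w₂
  w₂ := opPinv γ fun ϖ =>
    -(∫ y in C.G, C.traceΓ₀ Φ.z₂ y * conj (ϖ y)) - plateFunctional α μ Φ.w₁ Φ.θ ϖ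
      + (α : ℂ) * ip (opADD Φ.θ) ϖ
  θ := -((α : ℂ) • opAD Φ.w₂) - opADD Φ.θ - Φ.θ

end StructuralAcoustics

end

/-! The operator is a skew-symmetric coupling of wave, plate and heat equations plus the dissipative
part `Δθ - θ`. In `(𝐀Φ, Φ)` every coupling enters twice, in two rows, as a number and minus its
conjugate. The pairs are the wave energy `(∇z₂, ∇z₁) + (z₂, z₁)`, the pressure term `(w₂, z₂|_Γ₀)`,
the plate energy `a(w₂, w₁)`, and the thermal coupling. Real parts of such pairs vanish, and what is
left is `(Δθ - θ, θ)`. By Green's formula and the Robin condition this equals minus `‖∇θ‖² + λ‖γ₀θ‖²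
+ ‖θ‖²`.

Three points make the pairing exact. Since `z₁ - N w₂` has zero normal derivative, Green's formula
leaves no boundary term for it, and the weak equation of `N w₂` supplies `(w₂, z₂|_Γ₀)`
(`Chamber.ip_opAN`). Since `w₂` vanishes on `∂Γ₀`, pairing `Δθ` with `w₂` leaves no boundary term,
while pairing `Δw₂` with `θ` leaves `(∂w₂/∂ν, γ₀θ)`; the latter is matched by `a(Gγ₀θ, w₂) = (γ₀θ,
∂w₂/∂ν)`, which is the weak equation of `G` (`isGreenExt_opG`). Finally `A_D(I - Dγ₀)θ = -Δθ`,
because `Dγ₀θ` is harmonic (`opADD_eq`). Membership in the energy space rests on the fourth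
component: its functional is bounded on `H¹_{0,γ}`, so `P_γ⁻¹` yields an element of that space
(`opA_w₂_spec`).

Most of the file supplies the analysis behind these identities. Green's formula for `H²` functions
(`ip_laplacian_add`) needs a divergence theorem with respect to Hausdorff measure, a trace map, and
density of smooth functions in `H¹`. The first comes from an area formula for graphs and a partition
of unity. The trace bound applies the divergence theorem to `χ|φ|²` in a direction transverse to the
boundary. Density comes from mollifying with kernels shifted into the domain. The weak solutions
defining `N`, `G` and `P_γ⁻¹` all come from one form of the Riesz theorem (`exists_riesz`);
boundedness and closed range follow from the trace and Poincaré inequalities. -/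

noncomputable section

namespace StructuralAcoustics

/-! ### Area formula for injective immersions, in terms of Hausdorff measure -/

section AreaFormula

open Measure

/-- Two set functions given by measures that agree locally up to factors close to one coincide. -/
lemma Measure.le_of_locally_le {X : Type*} [TopologicalSpace X] [SecondCountableTopology X]
    [MeasurableSpace X] [OpensMeasurableSpace X] {m₁ m₂ : Measure X}
    (h : ∀ x, ∃ N ∈ 𝓝 x, ∀ s ⊆ N, m₁ s ≤ m₂ s) : m₁ ≤ m₂ := by
  choose N hN hle using h
  obtain ⟨t, htc, ht⟩ := TopologicalSpace.countable_cover_nhds (fun x => interior_mem_nhds.2 (hN x))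
  rcases t.eq_empty_or_nonempty with rfl | hne
  · intro s
    have : s = ∅ := by
      rw [eq_empty_iff_forall_notMem]; intro x
      have := mem_univ x
      rw [← ht] at this; simp at this
    simp [this]
  obtain ⟨f, rfl⟩ := htc.exists_eq_range hne
  refine Measure.le_iff.2 fun s hs => ?_
  let D : ℕ → Set X := disjointed fun n => interior (N (f n))
  have hD : ⋃ n, D n = univ := by
    rw [iUnion_disjointed]; simpa using ht
  have hDm : ∀ n, MeasurableSet (D n) := fun n =>
    MeasurableSet.disjointed (fun n => isOpen_interior.measurableSet) n
  have key : ∀ m : Measure X, m s = ∑' n, m (s ∩ D n) := fun m => by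
    rw [← measure_iUnion (fun i j hij => ((disjoint_disjointed _ hij).mono
      inter_subset_right inter_subset_right)) (fun n => hs.inter (hDm n)), ← inter_iUnion, hD,
      inter_univ]
  rw [key m₁, key m₂]
  exact ENNReal.tsum_le_tsum fun n => hle (f n) _
    (inter_subset_right.trans ((disjointed_subset _ n).trans interior_subset))

/-- The hypothesis makes `f` factor through `g` on `s`: points with equal `g`-values have equal
`f`-values, and the induced map `g '' s → f '' s` is `C`-Lipschitz. It lets `Γ` and its
linearisation be compared in both directions without inverting either. -/
lemma euclideanHausdorffMeasure_image_le_of_edist_le {X Y Z : Type*} [EMetricSpace X]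
    [EMetricSpace Y] [MeasurableSpace X] [BorelSpace X] [MeasurableSpace Y] [BorelSpace Y]
    {f : Z → X} {g : Z → Y} {s : Set Z} {C : NNReal} (n : ℕ)
    (h : ∀ x ∈ s, ∀ y ∈ s, edist (f x) (f y) ≤ C * edist (g x) (g y)) :
    μHE[n] (f '' s) ≤ (C : ℝ≥0∞) ^ n * μHE[n] (g '' s) := by
  classical
  rcases s.eq_empty_or_nonempty with rfl | ⟨z, hz⟩
  · simp
  have : Nonempty Z := ⟨z⟩
  have hF : f '' s = (fun y => f (Function.invFunOn g s y)) '' (g '' s) := by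
    rw [image_image]
    refine image_congr fun x hx => ?_
    have h1 := Function.invFunOn_mem (f := g) (s := s) ⟨x, hx, rfl⟩
    have h2 := Function.invFunOn_eq (f := g) (s := s) ⟨x, hx, rfl⟩
    have h3 := h x hx _ h1
    rw [h2, edist_self, mul_zero] at h3
    exact edist_le_zero.1 h3
  have hL : LipschitzOnWith C (fun y => f (Function.invFunOn g s y)) (g '' s) := by
    rintro _ ⟨x, hx, rfl⟩ _ ⟨y, hy, rfl⟩
    have h2 := Function.invFunOn_eq (f := g) (s := s) ⟨x, hx, rfl⟩
    have h3 := Function.invFunOn_eq (f := g) (s := s) ⟨y, hy, rfl⟩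
    refine (h _ (Function.invFunOn_mem ⟨x, hx, rfl⟩) _ (Function.invFunOn_mem ⟨y, hy, rfl⟩)).trans ?_
    rw [h2, h3]
  have := hL.hausdorffMeasure_image_le (d := n) (by positivity)
  rw [← hF, ENNReal.rpow_natCast] at this
  simp only [euclideanHausdorffMeasure_def, Measure.smul_apply, ENNReal.smul_def, smul_eq_mul]
  calc _ ≤ _ := mul_le_mul_right this _
    _ = _ := by ring

variable {K H : Type*} [NormedAddCommGroup K] [InnerProductSpace ℝ K] [FiniteDimensional ℝ K]
  [MeasurableSpace K] [BorelSpace K] [NormedAddCommGroup H] [InnerProductSpace ℝ H]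
  [MeasurableSpace H] [BorelSpace H]

/-- An injective `L` is bounded below, so the error of strict differentiability can be measured by
`‖L y - L z‖` itself. Near `x` the distances under `Γ` and under `L` then agree up to a factor `q`,
hence the image measures agree up to `q ^ n ≤ r`; the linear image has measure `normDet` times
volume. -/
lemma HasStrictFDerivAt.exists_nhds_measure_image {Γ : K → H} {L : K →L[ℝ] H} {x : K}
    (h : HasStrictFDerivAt Γ L x) (hL : Function.Injective L) {r : NNReal} (hr : 1 < r) :
    ∃ N ∈ 𝓝 x, ∀ s ⊆ N,
      μHE[Module.finrank ℝ K] (Γ '' s) ≤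
        (r : ℝ≥0∞) * (ENNReal.ofReal (L : K →ₗ[ℝ] H).normDet * volume s) ∧
      ENNReal.ofReal (L : K →ₗ[ℝ] H).normDet * volume s ≤
        (r : ℝ≥0∞) * μHE[Module.finrank ℝ K] (Γ '' s) := by
  set n := Module.finrank ℝ K
  -- choose `q > 1` with `q ^ n ≤ r`
  obtain ⟨q, hq1, hqr⟩ : ∃ q : NNReal, 1 < q ∧ q ^ n ≤ r := by
    have : Tendsto (fun q : NNReal => q ^ n) (𝓝 1) (𝓝 1) := by
      have : Continuous (fun q : NNReal => q ^ n) := by fun_prop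
      simpa using this.tendsto 1
    have h1 : ∀ᶠ q in 𝓝[>] (1 : NNReal), q ^ n < r :=
      (this.eventually (gt_mem_nhds hr)).filter_mono nhdsWithin_le_nhds
    obtain ⟨q, hq, hq'⟩ := (h1.and self_mem_nhdsWithin).exists
    exact ⟨q, hq', hq.le⟩
  obtain ⟨c, hc, hLc⟩ := (L : K →ₗ[ℝ] H).exists_antilipschitzWith (LinearMap.ker_eq_bot.2 hL)
  -- `η` with `1 + η ≤ q`, `1 ≤ q (1 - η)`
  have hq0 : (0 : ℝ) < q := by positivity
  have hq1' : (1 : ℝ) < q := by exact_mod_cast hq1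
  set η : ℝ := (q - 1) / q with hη
  have hη0 : 0 < η := div_pos (by linarith) hq0
  have hη1 : q * (1 - η) = 1 := by rw [hη]; field_simp; ring
  have hη2 : 1 + η ≤ q := by
    rw [hη, ← sub_nonneg];
    have : (q : ℝ) - (1 + (q - 1) / q) = (q - 1) ^ 2 / q := by field_simp; ring
    rw [this]; positivity
  -- Dividing by the antilipschitz constant `c` turns the error `(η / c)‖y - z‖` into at most `η‖L y
  -- - L z‖`.
  obtain ⟨N, hN, hA⟩ := h.approximates_deriv_on_nhds (c := ⟨η / c, by positivity⟩)
    (Or.inr (by exact_mod_cast (div_pos hη0 (by exact_mod_cast hc))))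
  have hA' : ∀ y ∈ N, ∀ z ∈ N, ‖Γ y - Γ z - (L y - L z)‖ ≤ η * ‖L y - L z‖ := by
    intro y hy z hz
    have h1 := hA y hy z hz
    have h2 := hLc.le_mul_dist y z
    rw [dist_eq_norm, dist_eq_norm] at h2
    rw [map_sub] at h1
    refine h1.trans ?_
    change η / c * _ ≤ _
    have hc' : (0 : ℝ) < c := hc
    calc η / c * ‖y - z‖ ≤ η / c * (c * ‖L y - L z‖) := by gcongr; exact h2
      _ = _ := by field_simp
  have hlin : ∀ s, μHE[n] (L '' s) = ENNReal.ofReal (L : K →ₗ[ℝ] H).normDet * volume s := fun s =>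
    LinearMap.euclideanHausdorffMeasure_image_eq_normDet_mul_volume (L : K →ₗ[ℝ] H) s
  have hed : ∀ a b c d : H, ‖a - b‖ ≤ q * ‖c - d‖ → edist a b ≤ (q : ℝ≥0∞) * edist c d := by
    intro a b c d h
    rw [edist_eq_enorm_sub, edist_eq_enorm_sub]
    have : ‖a - b‖₊ ≤ q * ‖c - d‖₊ := h
    simp only [enorm_eq_nnnorm]
    exact_mod_cast this
  have hqr' : (q : ℝ≥0∞) ^ n ≤ r := by exact_mod_cast hqr
  refine ⟨N, hN, fun s hs => ?_⟩
  rw [← hlin]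
  constructor
  · refine (euclideanHausdorffMeasure_image_le_of_edist_le (C := q) n
      fun y hy z hz => hed _ _ _ _ ?_).trans (mul_le_mul_left hqr' _)
    have := hA' y (hs hy) z (hs hz)
    have h3 := norm_le_norm_add_norm_sub' (Γ y - Γ z) (L y - L z)
    nlinarith [norm_nonneg (L y - L z)]
  · refine (euclideanHausdorffMeasure_image_le_of_edist_le (C := q) n
      fun y hy z hz => hed _ _ _ _ ?_).trans (mul_le_mul_left hqr' _)
    have := hA' y (hs hy) z (hs hz)
    have h3 := norm_le_norm_add_norm_sub (Γ y - Γ z) (L y - L z)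
    have h4 : (1 - η) * ‖L y - L z‖ ≤ ‖Γ y - Γ z‖ := by linarith
    calc _ = q * ((1 - η) * ‖L y - L z‖) := by rw [← mul_assoc, hη1, one_mul]
      _ ≤ _ := by gcongr

/-- The area formula for injective `C¹` immersions. -/
theorem comap_euclideanHausdorffMeasure {Γ : K → H} {L : K → K →L[ℝ] H}
    (hΓ : ∀ x, HasStrictFDerivAt Γ (L x) x) (hL : ∀ x, Function.Injective (L x))
    (hinj : Function.Injective Γ) {J : K → ℝ} (hJ : Continuous J) (hJ0 : ∀ x, 0 < J x)
    (hJL : ∀ x, (L x : K →ₗ[ℝ] H).normDet = J x) :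
    (μHE[Module.finrank ℝ K]).comap Γ = volume.withDensity fun x => ENNReal.ofReal (J x) := by
  have hcont : Continuous Γ := continuous_iff_continuousAt.2 fun x => (hΓ x).continuousAt
  have hemb : MeasurableEmbedding Γ := hcont.measurableEmbedding hinj
  set m₁ := (μHE[Module.finrank ℝ K] : Measure H).comap Γ
  set m₂ := (volume : Measure K).withDensity fun x => ENNReal.ofReal (J x)
  have hJm : Measurable fun x => ENNReal.ofReal (J x) := by fun_prop
  -- One factor `r` pays for replacing `Γ` by its derivative at `x`, the other for freezing the
  -- density `J` at `x`.
  have main : ∀ r : NNReal, 1 < r → ∀ x, ∃ N ∈ 𝓝 x, ∀ s ⊆ N,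
      m₁ s ≤ (r ^ 2 : NNReal) • m₂ s ∧ m₂ s ≤ (r ^ 2 : NNReal) • m₁ s := by
    intro r hr x
    obtain ⟨N, hN, hNs⟩ := HasStrictFDerivAt.exists_nhds_measure_image (hΓ x) (hL x) hr
    have hr1 : (1 : ℝ) < r := by exact_mod_cast hr
    have hx := hJ0 x
    have hnear : ∀ᶠ y in 𝓝 x, J x < r * J y ∧ J y < r * J x := by
      refine Filter.Eventually.and ?_ ?_
      · refine (hJ.tendsto x |>.const_mul (r : ℝ)).eventually (lt_mem_nhds ?_)
        nlinarith
      · refine (hJ.tendsto x).eventually (gt_mem_nhds ?_)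
        nlinarith
    have hlow : ∀ s ⊆ N ∩ {y | J x < r * J y ∧ J y < r * J x},
        ENNReal.ofReal (J x) * volume s ≤ r * m₂ s ∧
        m₂ s ≤ r * (ENNReal.ofReal (J x) * volume s) := by
      intro s hs
      have e : m₂ s = ∫⁻ y in s, ENNReal.ofReal (J y) := withDensity_apply' _ s
      have hsub : s ⊆ {y | J x < r * J y ∧ J y < r * J x} := hs.trans inter_subset_right
      have hmeas : MeasurableSet {y | J x < r * J y ∧ J y < r * J x} :=
        ((isOpen_lt continuous_const (continuous_const.mul hJ)).inter
          (isOpen_lt hJ continuous_const)).measurableSet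
      have hae : ∀ᵐ y ∂volume.restrict s, J x < r * J y ∧ J y < r * J x :=
        ae_mono (Measure.restrict_mono hsub le_rfl) (ae_restrict_mem hmeas)
      have hrr : ∀ a, (r : ℝ≥0∞) * ENNReal.ofReal a = ENNReal.ofReal (r * a) := fun a => by
        rw [ENNReal.ofReal_mul (by positivity), ENNReal.ofReal_coe_nnreal]
      constructor
      · rw [e, ← lintegral_const_mul _ hJm, ← setLIntegral_const]
        refine lintegral_mono_ae (hae.mono fun y hy => ?_)
        rw [hrr]; exact ENNReal.ofReal_le_ofReal hy.1.le
      · rw [e, ← mul_assoc, ← setLIntegral_const]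
        refine lintegral_mono_ae (hae.mono fun y hy => ?_)
        rw [hrr]; exact ENNReal.ofReal_le_ofReal hy.2.le
    refine ⟨N ∩ {y | J x < r * J y ∧ J y < r * J x}, inter_mem hN hnear, fun s hs => ?_⟩
    obtain ⟨h1, h2⟩ := hNs s (hs.trans inter_subset_left)
    obtain ⟨h3, h4⟩ := hlow s hs
    rw [hJL] at h1 h2
    have e1 : m₁ s = μHE[Module.finrank ℝ K] (Γ '' s) := hemb.comap_apply _ _
    rw [← e1] at h1 h2
    simp only [ENNReal.smul_def, smul_eq_mul, sq, ENNReal.coe_mul, mul_assoc]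
    exact ⟨h1.trans (mul_le_mul_right h3 _), h4.trans (mul_le_mul_right h2 _)⟩
  -- Letting `r` decrease to `1` removes the factor.
  have hle : ∀ {a b : Measure K}, (∀ r : NNReal, 1 < r → a ≤ (r ^ 2 : NNReal) • b) → a ≤ b := by
    intro a b h s
    have ht : Tendsto (fun r : NNReal => ((r ^ 2 : NNReal) : ℝ≥0∞) * b s) (𝓝[>] 1)
        (𝓝 (((1 ^ 2 : NNReal) : ℝ≥0∞) * b s)) := by
      refine ENNReal.Tendsto.mul_const ?_ (Or.inl (by simp))
      have : Continuous fun r : NNReal => ((r ^ 2 : NNReal) : ℝ≥0∞) := by fun_prop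
      exact (this.tendsto 1).mono_left nhdsWithin_le_nhds
    simp only [one_pow, ENNReal.coe_one, one_mul] at ht
    exact ge_of_tendsto ht (eventually_mem_nhdsWithin.mono fun r hr => h r hr s)
  apply le_antisymm
  · refine hle fun r hr => Measure.le_of_locally_le fun x => ?_
    obtain ⟨N, hN, h⟩ := main r hr x
    exact ⟨N, hN, fun s hs => (h s hs).1⟩
  · refine hle fun r hr => Measure.le_of_locally_le fun x => ?_
    obtain ⟨N, hN, h⟩ := main r hr x
    exact ⟨N, hN, fun s hs => (h s hs).2⟩

end AreaFormula

/-! ### Surface measure and divergence theorem for a graph -/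

section Graph

variable {d : ℕ}

/-- `e` is a unit vector and `g` a `C¹` function that is constant in the direction `e`. -/
structure IsGraphFun (e : E d) (g : E d → ℝ) : Prop where
  norm_eq : ‖e‖ = 1
  contDiff : ContDiff ℝ 1 g
  invariant : ∀ (y : E d) (s : ℝ), g (y + s • e) = g y

/-- The graph of `g` in the direction `e`, parametrised by the hyperplane orthogonal to `e`. -/
def graphMap (e : E d) (g : E d → ℝ) (y : (ℝ ∙ e)ᗮ) : E d := y + g y • e

/-- The shear that straightens the graph of `g`. -/
def shearMap (e : E d) (g : E d → ℝ) (p : (ℝ ∙ e)ᗮ × ℝ) : E d := p.1 + (g p.1 + p.2) • e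

/-- The density of the surface measure of the graph of `g`. -/
def graphDensity (g : E d → ℝ) (y : E d) : ℝ := √(1 + ‖gradient g y‖ ^ 2)

namespace IsGraphFun

variable {e : E d} {g : E d → ℝ} (h : IsGraphFun e g)
include h

lemma inner_self : inner ℝ e e = 1 := by simp [h.norm_eq]

omit h in
lemma inner_coe (y : (ℝ ∙ e)ᗮ) : inner ℝ (y : E d) e = 0 :=
  Submodule.mem_orthogonal_singleton_iff_inner_left.1 y.2

lemma fderiv_apply_self (y : E d) : fderiv ℝ g y e = 0 := by
  have h1 : HasDerivAt (fun s : ℝ => g (y + s • e)) (fderiv ℝ g y e) 0 := by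
    have hl : HasDerivAt (fun s : ℝ => y + s • e) e 0 := by
      simpa using ((hasDerivAt_id (0 : ℝ)).smul_const e).const_add y
    have h2 : HasFDerivAt g (fderiv ℝ g y) (y + (0 : ℝ) • e) := by
      simpa using (h.contDiff.differentiable one_ne_zero y).hasFDerivAt
    exact h2.comp_hasDerivAt (0 : ℝ) hl
  have h2 : (fun s : ℝ => g (y + s • e)) = fun _ => g y := funext fun s => h.invariant y s
  rw [h2] at h1
  exact h1.unique (hasDerivAt_const _ _)

lemma inner_gradient_self (y : E d) : inner ℝ (gradient g y) e = 0 := by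
  rw [inner_gradient_left, h.fderiv_apply_self]

lemma continuous_gradient : Continuous (gradient g) :=
  (InnerProductSpace.toDual ℝ (E d)).symm.continuous.comp (h.contDiff.continuous_fderiv one_ne_zero)

lemma continuous_graphDensity : Continuous (graphDensity g) := by
  have := h.continuous_gradient
  unfold graphDensity
  fun_prop

omit h in
lemma graphDensity_pos (y : E d) : 0 < graphDensity g y := by
  unfold graphDensity; positivity

lemma finrank_orthogonal : Module.finrank ℝ (ℝ ∙ e)ᗮ = d - 1 := by
  have he : e ≠ 0 := by rintro rfl; simpa using h.norm_eq
  have := (ℝ ∙ e).finrank_add_finrank_orthogonal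
  rw [finrank_span_singleton he, finrank_euclideanSpace_fin] at this
  omega

/-- The straightening shear as a homeomorphism. -/
def shearHomeo : (ℝ ∙ e)ᗮ × ℝ ≃ₜ E d where
  toFun := shearMap e g
  invFun x := ((ℝ ∙ e)ᗮ.orthogonalProjectionOnto x, inner ℝ x e - g x)
  left_inv p := by
    have h1 : (ℝ ∙ e)ᗮ.orthogonalProjectionOnto (shearMap e g p) = p.1 := by
      have h2 : (ℝ ∙ e)ᗮ.orthogonalProjectionOnto e = 0 := by
        rw [Submodule.orthogonalProjectionOnto_eq_zero_iff]
        exact Submodule.le_orthogonal_orthogonal _ (Submodule.mem_span_singleton_self e)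
      simp [shearMap, h2]
    refine Prod.ext h1 ?_
    simp only [shearMap, h.invariant, inner_add_left, inner_smul_left, inner_coe, h.inner_self]
    simp
  right_inv x := by
    have h1 : ((ℝ ∙ e)ᗮ.orthogonalProjectionOnto x : E d) = x - (inner ℝ x e) • e := by
      have h2 := Submodule.starProjection_unit_singleton ℝ h.norm_eq x
      have h3 := Submodule.starProjection_orthogonal_val (K := ℝ ∙ e) x
      rw [h2, real_inner_comm] at h3
      exact h3
    have h2 : g ((ℝ ∙ e)ᗮ.orthogonalProjectionOnto x : E d) = g x := by
      rw [h1, sub_eq_add_neg, ← neg_smul, h.invariant]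
    simp only [shearMap, h2]
    rw [h1]; simp
  continuous_toFun := by
    have := h.contDiff.continuous
    unfold shearMap; fun_prop
  continuous_invFun := by
    have := h.contDiff.continuous
    fun_prop

lemma hasStrictFDerivAt_graphMap (y : (ℝ ∙ e)ᗮ) :
    HasStrictFDerivAt (graphMap e g) ((ℝ ∙ e)ᗮ.subtypeL +
      ((fderiv ℝ g y).comp (ℝ ∙ e)ᗮ.subtypeL).smulRight e) y := by
  have h1 : HasStrictFDerivAt g (fderiv ℝ g y) ((ℝ ∙ e)ᗮ.subtypeL y) :=
    (h.contDiff.contDiffAt).hasStrictFDerivAt one_ne_zero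
  exact (ℝ ∙ e)ᗮ.subtypeL.hasStrictFDerivAt.add
    ((h1.comp y (ℝ ∙ e)ᗮ.subtypeL.hasStrictFDerivAt).smul_const e)

lemma graphMap_injective : Function.Injective (graphMap e g) := fun y z hyz => by
  have : shearMap e g (y, 0) = shearMap e g (z, 0) := by simpa [shearMap, graphMap] using hyz
  simpa using h.shearHomeo.injective this

lemma continuous_graphMap : Continuous (graphMap e g) :=
  continuous_iff_continuousAt.2 fun y => (h.hasStrictFDerivAt_graphMap y).continuousAt

lemma deriv_graphMap_injective (y : (ℝ ∙ e)ᗮ) : Function.Injective ((ℝ ∙ e)ᗮ.subtypeL +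
      ((fderiv ℝ g y).comp (ℝ ∙ e)ᗮ.subtypeL).smulRight e) := by
  rw [injective_iff_map_eq_zero]
  intro z hz
  have h1 : (z : E d) + fderiv ℝ g y z • e = 0 := by simpa using hz
  have h2 : inner ℝ ((z : E d) + fderiv ℝ g y z • e) e = 0 := by rw [h1, inner_zero_left]
  rw [inner_add_left, inner_smul_left, inner_coe, h.inner_self] at h2
  have h3 : fderiv ℝ g y z = 0 := by simpa using h2
  rw [h3, zero_smul, add_zero] at h1
  exact_mod_cast h1

/-- In an orthonormal basis of the hyperplane the Gram matrix is `1 + a aᵀ`, where `a` lists the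
derivatives of `g` along the basis; its determinant is `1 + |a|²`. As `g` is constant along `e`, its
gradient lies in the hyperplane and `|a|` is its full norm. -/
lemma normDet_deriv_graphMap (y : (ℝ ∙ e)ᗮ) :
    (((ℝ ∙ e)ᗮ.subtypeL + ((fderiv ℝ g y).comp (ℝ ∙ e)ᗮ.subtypeL).smulRight e :
      (ℝ ∙ e)ᗮ →L[ℝ] E d) : (ℝ ∙ e)ᗮ →ₗ[ℝ] E d).normDet = graphDensity g y := by
  classical
  have hmem : gradient g y ∈ (ℝ ∙ e)ᗮ :=
    Submodule.mem_orthogonal_singleton_iff_inner_left.2 (h.inner_gradient_self _)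
  set b := stdOrthonormalBasis ℝ (ℝ ∙ e)ᗮ
  set a : Fin (Module.finrank ℝ (ℝ ∙ e)ᗮ) → ℝ := fun i => fderiv ℝ g y (b i)
  rw [graphDensity, eq_comm, Real.sqrt_eq_iff_eq_sq (by positivity) (LinearMap.normDet_nonneg _)]
  have key := LinearMap.normDet_sq_eq_det_gram (((ℝ ∙ e)ᗮ.subtypeL +
    ((fderiv ℝ g y).comp (ℝ ∙ e)ᗮ.subtypeL).smulRight e : (ℝ ∙ e)ᗮ →L[ℝ] E d) :
      (ℝ ∙ e)ᗮ →ₗ[ℝ] E d) b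
  refine Eq.trans ?_ (Eq.trans key.symm rfl)
  have hG : (Matrix.gram ℝ fun i => (((ℝ ∙ e)ᗮ.subtypeL +
      ((fderiv ℝ g y).comp (ℝ ∙ e)ᗮ.subtypeL).smulRight e : (ℝ ∙ e)ᗮ →L[ℝ] E d) :
      (ℝ ∙ e)ᗮ →ₗ[ℝ] E d) (b i)) =
      1 + Matrix.replicateCol Unit a * Matrix.replicateRow Unit a := by
    ext i j
    have hb := (orthonormal_iff_ite.1 b.orthonormal) i j
    have h1 := inner_coe (b i)
    have h2 := inner_coe (b j)
    rw [real_inner_comm] at h2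
    have h3 : inner ℝ ((b i : E d) + fderiv ℝ g y (b i) • e) ((b j : E d) + fderiv ℝ g y (b j) • e)
        = (if i = j then 1 else 0) + a i * a j := by
      rw [inner_add_left, inner_add_right, inner_add_right, inner_smul_left, inner_smul_right,
        inner_smul_left, inner_smul_right, h1, h2, h.inner_self, ← hb]
      simp [a]
    rw [Matrix.gram_apply, Matrix.add_apply, Matrix.one_apply, Matrix.mul_apply]
    simpa using h3
  rw [hG, Matrix.det_one_add_replicateCol_mul_replicateRow]
  congr 1
  have := b.sum_sq_norm_inner_right ⟨gradient g y, hmem⟩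
  have hn : ‖(⟨gradient g y, hmem⟩ : (ℝ ∙ e)ᗮ)‖ = ‖gradient g y‖ := rfl
  rw [← hn, ← this]
  refine Finset.sum_congr rfl fun i _ => ?_
  have : inner ℝ (b i) (⟨gradient g y, hmem⟩ : (ℝ ∙ e)ᗮ) = a i := by
    rw [Submodule.coe_inner, real_inner_comm, inner_gradient_left]
  rw [this, Real.norm_eq_abs, sq_abs, sq]

lemma range_graphMap : range (graphMap e g) = {y | inner ℝ y e = g y} := by
  ext x
  constructor
  · rintro ⟨y, rfl⟩
    simp [graphMap, inner_add_left, inner_coe, h.invariant, inner_smul_left, h.norm_eq]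
  · intro hx
    obtain ⟨⟨y, t⟩, rfl⟩ := h.shearHomeo.surjective x
    refine ⟨y, ?_⟩
    have : t = 0 := by
      have hx' : inner ℝ (shearMap e g (y, t)) e = g (shearMap e g (y, t)) := hx
      simpa [shearMap, inner_add_left, inner_coe, h.invariant, inner_smul_left, h.norm_eq]
        using hx'
    subst this
    change _ = shearMap e g (y, 0)
    simp [graphMap, shearMap]

lemma measurableEmbedding_graphMap : MeasurableEmbedding (graphMap e g) :=
  h.continuous_graphMap.measurableEmbedding h.graphMap_injective

lemma map_graphMap : ((volume : Measure (ℝ ∙ e)ᗮ).withDensity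
      fun y => ENNReal.ofReal (graphDensity g y)).map (graphMap e g) =
    μHE[d - 1].restrict {y | inner ℝ y e = g y} := by
  rw [← h.range_graphMap, ← h.measurableEmbedding_graphMap.map_comap, ← h.finrank_orthogonal,
    comap_euclideanHausdorffMeasure h.hasStrictFDerivAt_graphMap h.deriv_graphMap_injective
      h.graphMap_injective (J := fun y => graphDensity g y)
      (h.continuous_graphDensity.comp continuous_subtype_val)
      (fun y => graphDensity_pos _) h.normDet_deriv_graphMap]

lemma setIntegral_graph (F : E d → ℂ) :
    ∫ x in {y | inner ℝ y e = g y}, F x ∂μHE[d - 1] =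
      ∫ y : (ℝ ∙ e)ᗮ, graphDensity g y • F (graphMap e g y) := by
  have hm : Measurable fun y : (ℝ ∙ e)ᗮ => ENNReal.ofReal (graphDensity g y) := by
    have := h.continuous_graphDensity
    fun_prop
  rw [← h.map_graphMap, h.measurableEmbedding_graphMap.integral_map,
    integral_withDensity_eq_integral_toReal_smul hm (by simp)]
  simp only [ENNReal.toReal_ofReal (graphDensity_pos _).le]

/-- By orthogonality a graph point is at least as long as its base point, so the part of the graph
in a ball is parametrised by a subset of a compact ball, on which the continuous density is
integrable. -/
lemma measure_graph_lt_top {s : Set (E d)} (hs : Bornology.IsBounded s) :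
    μHE[d - 1] ({y | inner ℝ y e = g y} ∩ s) < ⊤ := by
  obtain ⟨R, hR⟩ := hs.subset_closedBall 0
  have hcl : MeasurableSet (Metric.closedBall (0 : E d) R) := Metric.isClosed_closedBall.measurableSet
  refine lt_of_le_of_lt (measure_mono (inter_subset_inter_right _ hR)) ?_
  rw [inter_comm, ← Measure.restrict_apply hcl, ← h.map_graphMap,
    h.measurableEmbedding_graphMap.map_apply, withDensity_apply _
      (h.continuous_graphMap.measurable hcl)]
  have hsub : graphMap e g ⁻¹' Metric.closedBall 0 R ⊆ Metric.closedBall 0 R := by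
    intro y hy
    simp only [mem_preimage, mem_closedBall_zero_iff] at hy ⊢
    have h1 : ‖graphMap e g y‖ ^ 2 = ‖(y : E d)‖ ^ 2 + (g y) ^ 2 := by
      rw [graphMap, norm_add_sq_real, inner_smul_right, inner_coe, norm_smul, h.norm_eq]
      simp
    have h2 : ‖y‖ = ‖(y : E d)‖ := rfl
    rw [h2]
    refine le_trans (abs_le_of_sq_le_sq' ?_ (norm_nonneg _)).2 hy
    rw [h1]; nlinarith [sq_nonneg (g y)]
  refine lt_of_le_of_lt (lintegral_mono_set hsub) ?_
  have hc : Continuous fun y : (ℝ ∙ e)ᗮ => graphDensity g y :=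
    h.continuous_graphDensity.comp continuous_subtype_val
  have := (hc.continuousOn.integrableOn_compact (μ := volume)
    (isCompact_closedBall (0 : (ℝ ∙ e)ᗮ) R)).lintegral_lt_top
  exact this

/-- The orthogonal splitting `(y, t) ↦ y + t e` preserves volume, and the shear only translates each
fibre by `g y`. -/
lemma measurePreserving_shearMap :
    MeasurePreserving (shearMap e g) ((volume : Measure (ℝ ∙ e)ᗮ).prod volume) volume := by
  have h0 : MeasurePreserving (fun p : (ℝ ∙ e)ᗮ × ℝ => (p.1 : E d) + p.2 • e)
      ((volume : Measure (ℝ ∙ e)ᗮ).prod volume) volume := by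
    have h1 := ((ℝ ∙ e).measurePreserving_measurableEquivProd (0 : E d)).symm
    rw [InnerProductSpace.euclideanHausdorffMeasure_eq_volume] at h1
    have h2 : MeasurePreserving (Prod.swap : (ℝ ∙ e)ᗮ × (ℝ ∙ e) → (ℝ ∙ e) × (ℝ ∙ e)ᗮ)
        (volume.prod volume) (volume.prod volume) := Measure.measurePreserving_swap
    have h3 : MeasurePreserving (Prod.map id (LinearIsometryEquiv.toSpanUnitSingleton e h.norm_eq) :
        (ℝ ∙ e)ᗮ × ℝ → (ℝ ∙ e)ᗮ × (ℝ ∙ e)) (volume.prod volume) (volume.prod volume) :=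
      (MeasurePreserving.id _).prod
        (LinearIsometryEquiv.toSpanUnitSingleton e h.norm_eq).measurePreserving
    have h5 : (fun p : (ℝ ∙ e)ᗮ × ℝ => (p.1 : E d) + p.2 • e) =
        ((ℝ ∙ e).measurableEquivProd (0 : E d)).symm ∘ Prod.swap ∘
          Prod.map id (LinearIsometryEquiv.toSpanUnitSingleton e h.norm_eq) := by
      funext p
      simp [add_comm]
    rw [h5]
    exact h1.comp (h2.comp h3)
  have h4 : MeasurePreserving (fun p : (ℝ ∙ e)ᗮ × ℝ => (p.1, g p.1 + p.2))
      ((volume : Measure (ℝ ∙ e)ᗮ).prod volume) (volume.prod volume) := by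
    have hg := h.contDiff.continuous
    refine (MeasurePreserving.id _).skew_product
      (g := fun (y : (ℝ ∙ e)ᗮ) (t : ℝ) => g y + t) ?_
      (ae_of_all _ fun y => ?_)
    · exact Continuous.measurable (by fun_prop)
    · exact (measurePreserving_add_left volume (g y)).map_eq
  exact h0.comp h4

lemma setIntegral_hypograph {F : E d → ℂ} (hF : Integrable F) :
    ∫ x in {y | inner ℝ y e < g y}, F x =
      ∫ y : (ℝ ∙ e)ᗮ, ∫ t in Iio (0 : ℝ), F (shearMap e g (y, t)) := by
  have hemb : MeasurableEmbedding (shearMap e g) := h.shearHomeo.measurableEmbedding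
  have hpre : shearMap e g ⁻¹' {y | inner ℝ y e < g y} = univ ×ˢ Iio (0 : ℝ) := by
    ext ⟨y, t⟩
    simp [shearMap, inner_add_left, inner_coe, h.invariant, inner_smul_left, h.norm_eq]
  rw [← h.measurePreserving_shearMap.setIntegral_preimage_emb hemb, hpre, setIntegral_prod]
  · simp
  · exact ((h.measurePreserving_shearMap.integrable_comp_emb hemb).2 hF).integrableOn

-- This is integration by parts against the constant function `1`.
omit h in
lemma integral_fderiv_eq_zero {V : Type*} [NormedAddCommGroup V] [NormedSpace ℝ V]
    [FiniteDimensional ℝ V] [MeasurableSpace V] [BorelSpace V] (μ : Measure V)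
    [μ.IsAddHaarMeasure] {f : V → ℂ} (hf : ContDiff ℝ 1 f)
    (hc : HasCompactSupport f) (v : V) : ∫ x, fderiv ℝ f x v ∂μ = 0 := by
  have hint : Integrable (fun x => fderiv ℝ f x v) μ :=
    ((hf.continuous_fderiv one_ne_zero).clm_apply continuous_const).integrable_of_hasCompactSupport
      (hc.fderiv_apply (𝕜 := ℝ) v)
  have := integral_smul_fderiv_eq_neg_fderiv_smul_of_integrable (μ := μ) (𝕜 := ℝ)
    (f := fun _ : V => (1 : ℝ)) (g := f) (v := v) (by simp) (by simpa using hint)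
    (by simpa using hf.continuous.integrable_of_hasCompactSupport hc)
    (fun x _ => by fun_prop) (fun x _ => hf.differentiable one_ne_zero x)
  simpa using this

lemma isClosedEmbedding_slice (t : ℝ) :
    IsClosedEmbedding fun y : (ℝ ∙ e)ᗮ => shearMap e g (y, t) := by
  have h1 : IsClosedEmbedding fun y : (ℝ ∙ e)ᗮ => (y, t) :=
    Function.LeftInverse.isClosedEmbedding (f := Prod.fst) (fun y => rfl) (by fun_prop)
      (by fun_prop)
  exact h.shearHomeo.isClosedEmbedding.comp h1

lemma isClosedEmbedding_fiber (y : (ℝ ∙ e)ᗮ) :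
    IsClosedEmbedding fun t : ℝ => shearMap e g (y, t) := by
  have h1 : IsClosedEmbedding fun t : ℝ => (y, t) :=
    Function.LeftInverse.isClosedEmbedding (f := Prod.snd) (fun y => rfl) (by fun_prop)
      (by fun_prop)
  exact h.shearHomeo.isClosedEmbedding.comp h1

lemma hasFDerivAt_slice (t : ℝ) (y : (ℝ ∙ e)ᗮ) :
    HasFDerivAt (fun y : (ℝ ∙ e)ᗮ => shearMap e g (y, t)) ((ℝ ∙ e)ᗮ.subtypeL +
      ((fderiv ℝ g y).comp (ℝ ∙ e)ᗮ.subtypeL).smulRight e) y := by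
  have h1 := (h.hasStrictFDerivAt_graphMap y).hasFDerivAt.add_const (t • e)
  refine h1.congr_of_eventuallyEq (Eventually.of_forall fun z => ?_)
  simp [shearMap, graphMap, add_smul, add_assoc]

lemma contDiff_slice (t : ℝ) : ContDiff ℝ 1 fun y : (ℝ ∙ e)ᗮ => shearMap e g (y, t) := by
  have := h.contDiff
  have h1 : ContDiff ℝ 1 fun y : (ℝ ∙ e)ᗮ => (y : E d) := (ℝ ∙ e)ᗮ.subtypeL.contDiff
  unfold shearMap
  exact h1.add (((this.comp h1).add contDiff_const).smul contDiff_const)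

/-- The derivative in the direction `e` integrates along the fibres. -/
lemma setIntegral_fderiv_fiber {φ : E d → ℂ} (hφ : ContDiff ℝ 1 φ) (hc : HasCompactSupport φ)
    (y : (ℝ ∙ e)ᗮ) :
    ∫ t in Iio (0 : ℝ), fderiv ℝ φ (shearMap e g (y, t)) e = φ (graphMap e g y) := by
  have hd : ∀ t : ℝ, HasDerivAt (fun t : ℝ => shearMap e g (y, t)) e t := fun t => by
    have h1 : HasDerivAt (fun t : ℝ => g y + t) 1 t := (hasDerivAt_id t).const_add _
    simpa [shearMap] using (h1.smul_const e).const_add (y : E d)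
  have hsm : ContDiff ℝ 1 fun t : ℝ => shearMap e g (y, t) := by
    change ContDiff ℝ 1 fun t : ℝ => (y : E d) + (g y + t) • e
    fun_prop
  have h1 : ∀ t : ℝ, deriv (fun t => φ (shearMap e g (y, t))) t =
      fderiv ℝ φ (shearMap e g (y, t)) e := fun t =>
    ((hφ.differentiable one_ne_zero _).hasFDerivAt.comp_hasDerivAt t (hd t)).deriv
  have h2 := HasCompactSupport.integral_Iic_deriv_eq (hφ.comp hsm)
    (hc.comp_isClosedEmbedding (h.isClosedEmbedding_fiber y)) 0
  rw [integral_Iic_eq_integral_Iio] at h2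
  simp only [Function.comp_def, h1] at h2
  rw [h2]; simp [shearMap, graphMap]

/-- The divergence theorem below a graph. -/
theorem setIntegral_fderiv_hypograph {φ : E d → ℂ} (hφ : ContDiff ℝ 1 φ)
    (hc : HasCompactSupport φ) (v : E d) :
    ∫ x in {y | inner ℝ y e < g y}, fderiv ℝ φ x v =
      ∫ y : (ℝ ∙ e)ᗮ, (inner ℝ v e - fderiv ℝ g y v) • φ (graphMap e g y) := by
  have hcont : ∀ u, Continuous fun x => fderiv ℝ φ x u := fun u =>
    (hφ.continuous_fderiv one_ne_zero).clm_apply continuous_const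
  have hcs : ∀ u, HasCompactSupport fun x => fderiv ℝ φ x u := fun u => hc.fderiv_apply (𝕜 := ℝ) u
  have hint : ∀ u, Integrable (fun x => fderiv ℝ φ x u) := fun u =>
    (hcont u).integrable_of_hasCompactSupport (hcs u)
  -- Derivatives along `e` are integrated by the fundamental theorem of calculus on fibres, those
  -- along the hyperplane by compact support on slices; `v` is split accordingly.
  obtain ⟨w, hw⟩ : ∃ w : (ℝ ∙ e)ᗮ, v = w + (inner ℝ v e) • e := by
    refine ⟨⟨v - (inner ℝ v e) • e, ?_⟩, by simp⟩
    rw [Submodule.mem_orthogonal_singleton_iff_inner_left, inner_sub_left, inner_smul_left,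
      h.inner_self]
    simp
  have hgw : ∀ y, fderiv ℝ g y v = fderiv ℝ g y w := fun y => by
    conv_lhs => rw [hw, map_add, map_smul, h.fderiv_apply_self]
    simp
  set a := inner ℝ v e
  have hsh : Continuous (shearMap e g) := h.shearHomeo.continuous
  have hg1 : Continuous fun y => fderiv ℝ g y w :=
    (h.contDiff.continuous_fderiv one_ne_zero).clm_apply continuous_const
  have hcsh : ∀ u, HasCompactSupport fun p : (ℝ ∙ e)ᗮ × ℝ => fderiv ℝ φ (shearMap e g p) u :=
    fun u => (hcs u).comp_isClosedEmbedding h.shearHomeo.isClosedEmbedding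
  have hcnt : ∀ u, Continuous fun p : (ℝ ∙ e)ᗮ × ℝ => fderiv ℝ φ (shearMap e g p) u :=
    fun u => (hcont u).comp hsh
  have hi1 : ∀ u, Integrable (fun p : (ℝ ∙ e)ᗮ × ℝ => fderiv ℝ φ (shearMap e g p) u)
      (volume.prod volume) := fun u => (hcnt u).integrable_of_hasCompactSupport (hcsh u)
  have hi2 : Integrable (fun p : (ℝ ∙ e)ᗮ × ℝ =>
      fderiv ℝ g p.1 w • fderiv ℝ φ (shearMap e g p) e) (volume.prod volume) := by
    refine Continuous.integrable_of_hasCompactSupport ?_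
      ((hcsh e).smul_left (f := fun p : (ℝ ∙ e)ᗮ × ℝ => fderiv ℝ g p.1 w))
    exact (hg1.comp (by fun_prop : Continuous fun p : (ℝ ∙ e)ᗮ × ℝ => (p.1 : E d))).smul (hcnt e)
  -- the tangential part integrates to zero
  have htan : ∫ y : (ℝ ∙ e)ᗮ, ∫ t in Iio (0 : ℝ), (fderiv ℝ φ (shearMap e g (y, t)) w +
      fderiv ℝ g y w • fderiv ℝ φ (shearMap e g (y, t)) e) = 0 := by
    have hs := setIntegral_prod (μ := (volume : Measure (ℝ ∙ e)ᗮ)) (ν := (volume : Measure ℝ))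
      (fun p : (ℝ ∙ e)ᗮ × ℝ => fderiv ℝ φ (shearMap e g p) w +
        fderiv ℝ g p.1 w • fderiv ℝ φ (shearMap e g p) e) (s := univ) (t := Iio (0 : ℝ))
      ((hi1 w).add hi2).integrableOn
    rw [setIntegral_univ] at hs
    rw [← hs, ← Measure.prod_restrict, Measure.restrict_univ, integral_prod_symm]
    -- Fubini is used with `t` outside: for fixed `t` the integrand is exactly the derivative in
    -- direction `w` of the slice `y ↦ φ (shearMap e g (y, t))`.
    · refine (integral_congr_ae (g := fun _ : ℝ => (0 : ℂ))
        (ae_of_all _ fun t => ?_)).trans (by simp)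
      have hd : ∀ y : (ℝ ∙ e)ᗮ, fderiv ℝ (fun y : (ℝ ∙ e)ᗮ => φ (shearMap e g (y, t))) y w =
          fderiv ℝ φ (shearMap e g (y, t)) w +
            fderiv ℝ g y w • fderiv ℝ φ (shearMap e g (y, t)) e := fun y => by
        have hD : HasFDerivAt (fun y : (ℝ ∙ e)ᗮ => φ (shearMap e g (y, t))) _ y :=
          (hφ.differentiable one_ne_zero _).hasFDerivAt.comp y (h.hasFDerivAt_slice t y)
        rw [hD.fderiv]
        simp
      have := integral_fderiv_eq_zero volume (hφ.comp (h.contDiff_slice t))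
        (hc.comp_isClosedEmbedding (h.isClosedEmbedding_slice t)) w
      simp only [Function.comp_def, hd] at this
      exact this
    · have := ((hi1 w).add hi2).integrableOn (s := univ ×ˢ Iio (0 : ℝ))
      rw [IntegrableOn, ← Measure.prod_restrict, Measure.restrict_univ] at this
      exact this
  rw [h.setIntegral_hypograph (hint v)]
  have hfib : ∀ u (y : (ℝ ∙ e)ᗮ), IntegrableOn (fun t => fderiv ℝ φ (shearMap e g (y, t)) u)
      (Iio 0) := fun u y =>
    (((hcont u).comp (hsh.comp (by fun_prop))).integrable_of_hasCompactSupport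
      ((hcs u).comp_isClosedEmbedding (h.isClosedEmbedding_fiber y))).integrableOn
  -- Here `v` is the sum of the vector `w + (∂_w g) e`, tangent to the sheared slices, and of `(a -
  -- ∂_w g) e`, which integrates along the fibre to the boundary value.
  have hfib_eq : ∀ y : (ℝ ∙ e)ᗮ, ∫ t in Iio (0 : ℝ), fderiv ℝ φ (shearMap e g (y, t)) v =
      (∫ t in Iio (0 : ℝ), (fderiv ℝ φ (shearMap e g (y, t)) w +
        fderiv ℝ g y w • fderiv ℝ φ (shearMap e g (y, t)) e)) +
      (a - fderiv ℝ g y v) • φ (graphMap e g y) := fun y => by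
    have hlin : ∀ c : ℝ, ∫ t in Iio (0 : ℝ), (fderiv ℝ φ (shearMap e g (y, t)) w +
        c • fderiv ℝ φ (shearMap e g (y, t)) e) =
        (∫ t in Iio (0 : ℝ), fderiv ℝ φ (shearMap e g (y, t)) w) + c • φ (graphMap e g y) :=
      fun c => by
        rw [← h.setIntegral_fderiv_fiber hφ hc y, ← integral_smul]
        exact integral_add (hfib w y) ((hfib e y).smul c)
    rw [hgw, sub_smul, hlin]
    have : ∀ t, fderiv ℝ φ (shearMap e g (y, t)) v =
        fderiv ℝ φ (shearMap e g (y, t)) w + a • fderiv ℝ φ (shearMap e g (y, t)) e := fun t => by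
      conv_lhs => rw [hw, map_add, map_smul]
    simp only [this]
    rw [hlin]
    abel
  simp only [hfib_eq]
  have hint1 : Integrable fun y : (ℝ ∙ e)ᗮ => ∫ t in Iio (0 : ℝ),
      (fderiv ℝ φ (shearMap e g (y, t)) w +
        fderiv ℝ g y w • fderiv ℝ φ (shearMap e g (y, t)) e) := by
    have := ((hi1 w).add hi2).integrableOn (s := univ ×ˢ Iio (0 : ℝ))
    rw [IntegrableOn, ← Measure.prod_restrict, Measure.restrict_univ] at this
    exact this.integral_prod_left
  have hgc : IsClosedEmbedding (graphMap e g) := by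
    have := h.isClosedEmbedding_slice 0
    simp only [shearMap, add_zero] at this
    exact this
  have hgv : Continuous fun y : (ℝ ∙ e)ᗮ => fderiv ℝ g y v :=
    ((h.contDiff.continuous_fderiv one_ne_zero).comp continuous_subtype_val).clm_apply
      continuous_const
  have hint2 : Integrable fun y : (ℝ ∙ e)ᗮ => (a - fderiv ℝ g y v) • φ (graphMap e g y) :=
    ((continuous_const.sub hgv).smul
      (hφ.continuous.comp h.continuous_graphMap)).integrable_of_hasCompactSupport
      ((hc.comp_isClosedEmbedding hgc).smul_left (f := fun y : (ℝ ∙ e)ᗮ => a - fderiv ℝ g y v))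
  rw [integral_add hint1 hint2, htan, zero_add]

end IsGraphFun

end Graph

/-- Existence alone suffices here. The solution operators `opN`, `opG` and `opPinv` are only used
through this lemma, whereas computing traces, weak derivatives and normals also needs uniqueness, as
in `theObj_eq`. -/
lemma theObj_spec {X : Type*} [Zero X] {P : X → Prop} (h : ∃ a, P a) : P (theObj P) := by
  unfold theObj
  rw [dif_pos h]
  exact h.choose_spec

lemma theObj_eq {X : Type*} [Zero X] {P : X → Prop} {a : X} (ha : P a)
    (hu : ∀ b, P b → b = a) : theObj P = a :=
  hu _ (theObj_spec ⟨a, ha⟩)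

/-! ### Boundary charts, outer normal, divergence theorem and trace inequality -/

section Boundary

variable {d : ℕ} {U : Set (E d)}

/-- In `V` the set `U` is the hypograph of `g` in the direction `e`. -/
structure IsBdryChart (U V : Set (E d)) (e : E d) (g : E d → ℝ) : Prop extends
    IsGraphFun e g where
  isOpen : IsOpen V
  mem_iff : ∀ y ∈ V, (y ∈ U ↔ inner ℝ y e < g y)

lemma HasC2Boundary.exists_chart (h : HasC2Boundary U) {x : E d} (hx : x ∈ frontier U) :
    ∃ V e g, x ∈ V ∧ IsBdryChart U V e g := by
  obtain ⟨V, e, g, hV, hxV, he, hg, hinv, hmem⟩ := h x hx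
  exact ⟨V, e, g, hxV, ⟨he, hg.of_le (by norm_num), hinv⟩, hV, hmem⟩

/-- For `u = ν' - ν` one has `⟪u, ν⟫ = -c` and `⟪u, ν'⟫ = c` with `c = 1 - ⟪ν, ν'⟫ > 0`. A short
step along `u` thus enters `U` according to `ν` and leaves it according to `ν'`. The tolerance `c /
(2‖u‖)` costs only half of the gain `c`. -/
lemma IsOuterNormal.unique {x ν ν' : E d} (h : IsOuterNormal U x ν) (h' : IsOuterNormal U x ν') :
    ν = ν' := by
  by_contra hne
  have h1 : inner ℝ ν ν' < 1 := (inner_lt_one_iff_real_of_norm_eq_one h.1 h'.1).2 hne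
  set u := ν' - ν
  have hu : 0 < ‖u‖ := norm_pos_iff.2 (sub_ne_zero.2 (Ne.symm hne))
  have hν : inner ℝ u ν = inner ℝ ν ν' - 1 := by
    rw [inner_sub_left, real_inner_comm, real_inner_self_eq_norm_sq, h.1]; norm_num
  have hν' : inner ℝ u ν' = 1 - inner ℝ ν ν' := by
    rw [inner_sub_left, real_inner_self_eq_norm_sq, h'.1]; norm_num
  set c := 1 - inner ℝ ν ν'
  have hc : 0 < c := by simp only [c]; linarith
  obtain ⟨δ, hδ, H⟩ := h.2 (c / (2 * ‖u‖)) (by positivity)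
  obtain ⟨δ', hδ', H'⟩ := h'.2 (c / (2 * ‖u‖)) (by positivity)
  set t := min δ δ' / (2 * ‖u‖)
  have ht : 0 < t := div_pos (lt_min hδ hδ') (by positivity)
  have htu : t * ‖u‖ = min δ δ' / 2 := by simp only [t]; field_simp
  have hnorm : ‖x + t • u - x‖ = t * ‖u‖ := by
    rw [add_sub_cancel_left, norm_smul, Real.norm_of_nonneg ht.le]
  have hmin : 0 < min δ δ' := lt_min hδ hδ'
  have hin : x + t • u ∈ U := by
    refine (H _ ?_).1 ?_
    · rw [hnorm, htu]; linarith [min_le_left δ δ']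
    · rw [hnorm, add_sub_cancel_left, inner_smul_left, hν]
      have : c / (2 * ‖u‖) * (t * ‖u‖) = t * c / 2 := by field_simp
      rw [this]; simp only [c, conj_trivial] at *; nlinarith
  refine (H' _ ?_).2 ?_ hin
  · rw [hnorm, htu]; linarith [min_le_right δ δ']
  · rw [hnorm, add_sub_cancel_left, inner_smul_left, hν']
    have : c / (2 * ‖u‖) * (t * ‖u‖) = t * c / 2 := by field_simp
    rw [this]; simp only [conj_trivial] at *; nlinarith

/-- The upward unit normal of the graph of `g`. -/
def graphNormal (e : E d) (g : E d → ℝ) (y : E d) : E d :=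
  (graphDensity g y)⁻¹ • (e - gradient g y)

namespace IsBdryChart

variable {V : Set (E d)} {e : E d} {g : E d → ℝ} (h : IsBdryChart U V e g)
include h

lemma mono {V' : Set (E d)} (hV' : IsOpen V') (hsub : V' ⊆ V) : IsBdryChart U V' e g :=
  { h with isOpen := hV', mem_iff := fun y hy => h.mem_iff y (hsub hy) }

/-- The frontier is determined locally, so `U` may be replaced by the full hypograph. A point on the
graph is a limit of points below it because moving along `-e` does not change `g`. -/
lemma mem_frontier_iff {y : E d} (hy : y ∈ V) : y ∈ frontier U ↔ inner ℝ y e = g y := by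
  have hev : ∀ᶠ x in 𝓝 y, x ∈ V := h.isOpen.mem_nhds hy
  have hcont := h.contDiff.continuous
  have key : y ∈ frontier U ↔ y ∈ frontier {x | inner ℝ x e < g x} := by
    rw [frontier_eq_closure_inter_closure, frontier_eq_closure_inter_closure, mem_inter_iff,
      mem_inter_iff, mem_closure_iff_frequently, mem_closure_iff_frequently,
      mem_closure_iff_frequently, mem_closure_iff_frequently]
    refine and_congr (frequently_congr (hev.mono fun x hx => h.mem_iff x hx))
      (frequently_congr (hev.mono fun x hx => not_congr (h.mem_iff x hx)))
  rw [key]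
  constructor
  · exact fun hf => frontier_lt_subset_eq (by fun_prop) hcont hf
  · intro heq
    rw [frontier_eq_closure_inter_closure]
    refine ⟨?_, subset_closure fun hlt : inner ℝ y e < g y => hlt.ne heq⟩
    have ht : Tendsto (fun t : ℝ => y + (-t) • e) (𝓝[>] 0) (𝓝 y) := by
      have : Continuous fun t : ℝ => y + (-t) • e := by fun_prop
      simpa using (this.tendsto 0).mono_left nhdsWithin_le_nhds
    refine mem_closure_of_tendsto ht (eventually_mem_nhdsWithin.mono fun t ht => ?_)
    have ht0 : (0 : ℝ) < t := ht
    simp only [mem_ofPred_eq, h.invariant, inner_add_left, inner_smul_left, h.inner_self, heq]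
    simpa using ht0

lemma norm_sub_gradient (y : E d) : ‖e - gradient g y‖ = graphDensity g y := by
  have h1 : ‖e - gradient g y‖ ^ 2 = 1 + ‖gradient g y‖ ^ 2 := by
    rw [norm_sub_sq_real, h.norm_eq, real_inner_comm, h.inner_gradient_self]; ring
  rw [graphDensity, ← h1, Real.sqrt_sq (norm_nonneg _)]

omit h in
lemma one_le_graphDensity (y : E d) : 1 ≤ graphDensity g y := by
  rw [graphDensity, Real.one_le_sqrt]; nlinarith [sq_nonneg ‖gradient g y‖]

omit h in
lemma inner_graphNormal (y v : E d) :
    inner ℝ v (graphNormal e g y) = (graphDensity g y)⁻¹ * (inner ℝ v e - fderiv ℝ g y v) := by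
  rw [graphNormal, inner_smul_right, inner_sub_right, real_inner_comm (gradient g y),
    inner_gradient_left]

/-- Up to the density, `⟪z - y, ν⟫` is the linearisation at `y` of `⟪z, e⟫ - g z`, whose sign
decides membership. The density is at least `1`, so an excess of `ε‖z - y‖` outweighs the `ε`-small
linearisation error. -/
lemma isOuterNormal {y : E d} (hy : y ∈ V) (hyf : y ∈ frontier U) :
    IsOuterNormal U y (graphNormal e g y) := by
  have hJ := IsGraphFun.graphDensity_pos (g := g) y
  have hJ1 := one_le_graphDensity (g := g) y
  refine ⟨?_, fun ε hε => ?_⟩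
  · rw [graphNormal, norm_smul, h.norm_sub_gradient, norm_inv, Real.norm_of_nonneg hJ.le,
      inv_mul_cancel₀ hJ.ne']
  · have hg := (h.contDiff.differentiable one_ne_zero y).hasFDerivAt
    have h1 := hg.isLittleO.def hε
    have h2 : ∀ᶠ z in 𝓝 y, z ∈ V := h.isOpen.mem_nhds hy
    obtain ⟨δ, hδ, H⟩ := Metric.eventually_nhds_iff.1 (h1.and h2)
    refine ⟨δ, hδ, fun z hz => ?_⟩
    obtain ⟨hz1, hz2⟩ := H (by rwa [dist_eq_norm])
    rw [Real.norm_eq_abs, abs_le] at hz1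
    have heq := (h.mem_frontier_iff hy).1 hyf
    have hz3 : inner ℝ (z - y) e = inner ℝ z e - g y := by rw [inner_sub_left, heq]
    have hin := inner_graphNormal (e := e) (g := g) y (z - y)
    set q := inner ℝ (z - y) (graphNormal e g y)
    have hq : graphDensity g y * q = inner ℝ z e - g y - fderiv ℝ g y (z - y) := by
      rw [hin, hz3]; field_simp
    have hn : 0 ≤ ε * ‖z - y‖ := by positivity
    rw [h.mem_iff z hz2]
    constructor
    · intro hlt
      have : graphDensity g y * q < -(ε * ‖z - y‖) := by nlinarith
      linarith
    · intro hlt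
      have : ε * ‖z - y‖ < graphDensity g y * q := by nlinarith
      intro h'; linarith

lemma outerNormal_eq {y : E d} (hy : y ∈ V) (hyf : y ∈ frontier U) :
    outerNormal U y = graphNormal e g y :=
  theObj_eq (h.isOuterNormal hy hyf) fun _ hb => hb.unique (h.isOuterNormal hy hyf)

lemma continuous_graphNormal : Continuous (graphNormal e g) := by
  have h1 := h.continuous_gradient
  have h2 := h.continuous_graphDensity
  exact (h2.inv₀ fun y => (IsGraphFun.graphDensity_pos y).ne').smul (continuous_const.sub h1)

/-- The divergence theorem for functions supported in a boundary chart. -/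
theorem setIntegral_fderiv (hU : IsOpen U) {φ : E d → ℂ} (hφ : ContDiff ℝ 1 φ)
    (hc : HasCompactSupport φ) (hs : tsupport φ ⊆ V) (v : E d) :
    ∫ x in U, fderiv ℝ φ x v = ∫ x, (inner ℝ v (outerNormal U x) : ℝ) • φ x ∂surfaceMeasure U := by
  have hW : MeasurableSet {y : E d | inner ℝ y e < g y} :=
    (isOpen_lt (by fun_prop) h.contDiff.continuous).measurableSet
  have hG : MeasurableSet {y : E d | inner ℝ y e = g y} :=
    (isClosed_eq (by fun_prop) h.contDiff.continuous).measurableSet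
  have hz : ∀ x ∉ V, φ x = 0 := fun x hx => image_eq_zero_of_notMem_tsupport fun hx' => hx (hs hx')
  have hz' : ∀ x ∉ V, fderiv ℝ φ x v = 0 := fun x hx => by
    have : x ∉ tsupport (fderiv ℝ φ) := fun hx' => hx (hs (tsupport_fderiv_subset ℝ hx'))
    rw [image_eq_zero_of_notMem_tsupport this]; rfl
  -- On `V` the two domains coincide, and off `V` the integrand vanishes; the same holds for the
  -- boundary integrals below.
  have h1 : ∫ x in U, fderiv ℝ φ x v = ∫ x in {y | inner ℝ y e < g y}, fderiv ℝ φ x v := by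
    rw [← integral_indicator hU.measurableSet, ← integral_indicator hW]
    congr 1; ext x
    by_cases hx : x ∈ V
    · simp only [indicator, mem_ofPred_eq, h.mem_iff x hx]
    · simp only [indicator, hz' x hx]; simp
  have h2 : ∫ x, (inner ℝ v (outerNormal U x) : ℝ) • φ x ∂surfaceMeasure U =
      ∫ x in {y | inner ℝ y e = g y}, (inner ℝ v (graphNormal e g x) : ℝ) • φ x ∂μHE[d - 1] := by
    rw [surfaceMeasure, ← integral_indicator isClosed_frontier.measurableSet,
      ← integral_indicator hG]
    congr 1; ext x
    by_cases hx : x ∈ V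
    · by_cases hxf : x ∈ frontier U
      · have := (h.mem_frontier_iff hx).1 hxf
        rw [indicator_of_mem hxf, indicator_of_mem (by exact this), h.outerNormal_eq hx hxf]
      · have : ¬ inner ℝ x e = g x := fun h' => hxf ((h.mem_frontier_iff hx).2 h')
        rw [indicator_of_notMem hxf, indicator_of_notMem (by exact this)]
    · simp only [indicator, hz x hx]; simp
  rw [h1, h2, h.setIntegral_fderiv_hypograph hφ hc v, h.setIntegral_graph]
  refine integral_congr_ae (ae_of_all _ fun y => ?_)
  have hgr : gradient g (graphMap e g y) = gradient g y := by
    have hfun : (fun z => g (z + g y • e)) = g := funext fun z => h.invariant z _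
    have : fderiv ℝ g ((y : E d) + g y • e) = fderiv ℝ g y := by
      rw [← fderiv_comp_add_right, hfun]
    simp only [gradient, graphMap, this]
  have hden : graphDensity g (graphMap e g y) = graphDensity g y := by
    simp only [graphDensity, hgr]
  simp only [graphNormal, hden, hgr, inner_smul_right, inner_sub_right, smul_smul]
  -- The density of the surface measure cancels the normalising factor of `graphNormal`.
  rw [← mul_assoc, mul_inv_cancel₀ (IsGraphFun.graphDensity_pos _).ne', one_mul,
    real_inner_comm (gradient g y), inner_gradient_left]

lemma surfaceMeasure_lt_top (hb : Bornology.IsBounded V) : surfaceMeasure U V < ⊤ := by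
  rw [surfaceMeasure, Measure.restrict_apply h.isOpen.measurableSet]
  refine lt_of_le_of_lt (measure_mono ?_) (h.measure_graph_lt_top hb)
  exact fun x hx => ⟨(h.mem_frontier_iff hx.1).1 hx.2, hx.1⟩

end IsBdryChart

/-- Smooth finite partitions of unity on compact sets, subordinate to a class of open sets. -/
lemma exists_partition {A : Set (E d)} (hA : IsCompact A) {p : Set (E d) → Prop}
    (h : ∀ x ∈ A, ∃ V, IsOpen V ∧ Bornology.IsBounded V ∧ x ∈ V ∧ p V) :
    ∃ (n : ℕ) (V : Fin n → Set (E d)) (χ : Fin n → E d → ℝ), (∀ i, p (V i)) ∧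
      (∀ i, ContDiff ℝ ∞ (χ i)) ∧ (∀ i, HasCompactSupport (χ i)) ∧ (∀ i, tsupport (χ i) ⊆ V i) ∧
      (∀ i x, 0 ≤ χ i x) ∧ ∀ x ∈ A, ∑ i, χ i x = 1 := by
  choose! V hVo hVb hxV hp using h
  obtain ⟨t, htA⟩ := hA.elim_nhds_subcover' (fun x _ => V x)
    (fun x hx => (hVo x hx).mem_nhds (hxV x hx))
  obtain ⟨f, hf⟩ := SmoothPartitionOfUnity.exists_isSubordinate (modelWithCornersSelf ℝ (E d))
    hA.isClosed (fun i : t => V i.1.1) (fun i => hVo _ i.1.2) (by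
      intro x hx
      obtain ⟨i, hi, hxi⟩ := mem_iUnion₂.1 (htA hx)
      exact mem_iUnion.2 ⟨⟨i, hi⟩, hxi⟩)
  let eqv := (Fintype.equivFin t).symm
  refine ⟨Fintype.card t, fun i => V (eqv i).1.1, fun i => f (eqv i), fun i => hp _ (eqv i).1.2,
    fun i => ?_, fun i => ?_, fun i => hf _, fun i x => f.nonneg _ _, fun x hx => ?_⟩
  · exact (f (eqv i)).contMDiff.contDiff
  · exact HasCompactSupport.of_support_subset_isCompact
      ((hVb _ (eqv i).1.2).isCompact_closure) (((subset_tsupport _).trans (hf _)).trans subset_closure)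
  · have := f.sum_eq_one hx
    rw [finsum_eq_sum_of_fintype] at this
    rw [← this]
    exact eqv.sum_comp (fun i => f i x)

/-- Besides boundedness, the chart is shrunk so that the density stays below `M`. Since `⟪e, ν⟫` is
the inverse of the density on the boundary, this keeps `e` uniformly transverse there, which is what
the trace inequality needs. -/
lemma HasC2Boundary.exists_bounded_chart (h : HasC2Boundary U) {x : E d} (hx : x ∈ frontier U) :
    ∃ V, IsOpen V ∧ Bornology.IsBounded V ∧ x ∈ V ∧ ∃ e g, IsBdryChart U V e g ∧
      ∃ M, ∀ y ∈ V, graphDensity g y ≤ M := by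
  obtain ⟨V, e, g, hxV, hV⟩ := h.exists_chart hx
  have ho : IsOpen ((V ∩ Metric.ball x 1) ∩ {y | graphDensity g y < graphDensity g x + 1}) :=
    (hV.isOpen.inter Metric.isOpen_ball).inter
      (isOpen_lt hV.continuous_graphDensity continuous_const)
  refine ⟨_, ho, Metric.isBounded_ball.subset
    (inter_subset_left.trans inter_subset_right), ⟨⟨hxV, Metric.mem_ball_self one_pos⟩, ?_⟩, e, g,
    hV.mono ho (inter_subset_left.trans inter_subset_left), graphDensity g x + 1, ?_⟩
  · simp
  · exact fun y hy => hy.2.le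

lemma isCompact_frontier (hb : Bornology.IsBounded U) : IsCompact (frontier U) :=
  hb.isCompact_closure.of_isClosed_subset isClosed_frontier frontier_subset_closure

lemma HasC2Boundary.isFiniteMeasure (h : HasC2Boundary U) (hb : Bornology.IsBounded U) :
    IsFiniteMeasure (surfaceMeasure U) := by
  have h1 : surfaceMeasure U (frontier U) < ⊤ := by
    refine (isCompact_frontier hb).measure_lt_top_of_nhdsWithin fun x hx => ?_
    obtain ⟨V, hVo, hVb, hxV, e, g, hV, -⟩ := h.exists_bounded_chart hx
    exact ⟨V, mem_nhdsWithin_of_mem_nhds (hVo.mem_nhds hxV), hV.surfaceMeasure_lt_top hVb⟩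
  rw [surfaceMeasure, Measure.restrict_apply isClosed_frontier.measurableSet, inter_self] at h1
  refine ⟨?_⟩
  rwa [surfaceMeasure, Measure.restrict_apply_univ]

lemma HasC2Boundary.isOuterNormal (h : HasC2Boundary U) {x : E d} (hx : x ∈ frontier U) :
    IsOuterNormal U x (outerNormal U x) := by
  obtain ⟨V, e, g, hxV, hV⟩ := h.exists_chart hx
  rw [hV.outerNormal_eq hxV hx]
  exact hV.isOuterNormal hxV hx

lemma HasC2Boundary.continuousOn_outerNormal (h : HasC2Boundary U) :
    ContinuousOn (outerNormal U) (frontier U) := by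
  intro x hx
  obtain ⟨V, e, g, hxV, hV⟩ := h.exists_chart hx
  refine (hV.continuous_graphNormal.continuousWithinAt (s := frontier U)).congr_of_eventuallyEq ?_
    (hV.outerNormal_eq hxV hx)
  filter_upwards [mem_nhdsWithin_of_mem_nhds (hV.isOpen.mem_nhds hxV), self_mem_nhdsWithin]
    with y hy hyf using hV.outerNormal_eq hy hyf

lemma HasC2Boundary.aestronglyMeasurable_outerNormal (h : HasC2Boundary U) :
    AEStronglyMeasurable (outerNormal U) (surfaceMeasure U) :=
  h.continuousOn_outerNormal.aestronglyMeasurable isClosed_frontier.measurableSet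

lemma ae_mem_frontier : ∀ᵐ x ∂surfaceMeasure U, x ∈ frontier U :=
  ae_restrict_mem isClosed_frontier.measurableSet

lemma HasC2Boundary.ae_norm_outerNormal (h : HasC2Boundary U) :
    ∀ᵐ x ∂surfaceMeasure U, ‖outerNormal U x‖ = 1 :=
  ae_mem_frontier.mono fun _ hx => (h.isOuterNormal hx).1

lemma HasC2Boundary.integrable_inner_smul (h : HasC2Boundary U) (hb : Bornology.IsBounded U)
    {φ : E d → ℂ} (hφ : Continuous φ) (hc : HasCompactSupport φ) (v : E d) :
    Integrable (fun x => (inner ℝ v (outerNormal U x) : ℝ) • φ x) (surfaceMeasure U) := by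
  have := h.isFiniteMeasure hb
  have h1 : Integrable φ (surfaceMeasure U) := hφ.integrable_of_hasCompactSupport hc
  refine Integrable.bdd_smul (𝕜 := ℝ) (φ := fun x => inner ℝ v (outerNormal U x)) h1 ‖v‖ ?_ ?_
  · exact (aestronglyMeasurable_const).inner h.aestronglyMeasurable_outerNormal
  · filter_upwards [h.ae_norm_outerNormal] with x hx
    have := norm_inner_le_norm (𝕜 := ℝ) v (outerNormal U x)
    rwa [hx, mul_one] at this

/-- The divergence theorem on a bounded domain with `C²` boundary. -/
theorem HasC2Boundary.setIntegral_fderiv (h : HasC2Boundary U) (hU : IsOpen U)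
    (hb : Bornology.IsBounded U) {φ : E d → ℂ} (hφ : ContDiff ℝ 1 φ) (hc : HasCompactSupport φ)
    (v : E d) :
    ∫ x in U, fderiv ℝ φ x v = ∫ x, (inner ℝ v (outerNormal U x) : ℝ) • φ x ∂surfaceMeasure U := by
  -- The pieces are either supported in `U`, where both sides of the formula vanish, or supported in
  -- a boundary chart.
  obtain ⟨n, V, χ, hV, hχs, hχc, hχV, -, hχ1⟩ := exists_partition hb.isCompact_closure
    (p := fun V => V ⊆ U ∨ ∃ e g, IsBdryChart U V e g) (by
      intro x hx
      rw [closure_eq_self_union_frontier] at hx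
      by_cases hxU : x ∈ U
      · exact ⟨U, hU, hb, hxU, Or.inl subset_rfl⟩
      · obtain ⟨V, hVo, hVb, hxV, e, g, hV, -⟩ := h.exists_bounded_chart (hx.resolve_left hxU)
        exact ⟨V, hVo, hVb, hxV, Or.inr ⟨e, g, hV⟩⟩)
  have hχφ : ∀ i, ContDiff ℝ 1 fun x => χ i x • φ x := fun i =>
    ((hχs i).of_le (by norm_cast)).smul hφ
  have hχφc : ∀ i, HasCompactSupport fun x => χ i x • φ x := fun i =>
    hc.smul_left (f := χ i)
  have hloc : ∀ i, ∫ x in U, fderiv ℝ (fun x => χ i x • φ x) x v =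
      ∫ x, (inner ℝ v (outerNormal U x) : ℝ) • (χ i x • φ x) ∂surfaceMeasure U := by
    intro i
    have hsup : tsupport (fun x => χ i x • φ x) ⊆ V i :=
      (tsupport_smul_subset_left _ _).trans (hχV i)
    rcases hV i with hVU | ⟨e, g, hV⟩
    · have h1 : ∫ x in U, fderiv ℝ (fun x => χ i x • φ x) x v = 0 := by
        rw [setIntegral_eq_integral_of_forall_compl_eq_zero]
        · exact IsGraphFun.integral_fderiv_eq_zero volume (hχφ i) (hχφc i) v
        · intro x hx
          have : x ∉ tsupport (fderiv ℝ fun x => χ i x • φ x) := fun hx' =>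
            hx (hVU (hsup (tsupport_fderiv_subset ℝ hx')))
          rw [image_eq_zero_of_notMem_tsupport this]; rfl
      rw [h1, eq_comm]
      refine integral_eq_zero_of_ae ?_
      filter_upwards [ae_mem_frontier] with x hx
      have hx' : x ∉ U := (hU.frontier_eq ▸ hx).2
      have : χ i x • φ x = 0 := image_eq_zero_of_notMem_tsupport
        (f := fun x => χ i x • φ x) fun hx'' => hx' (hVU (hsup hx''))
      simp [this]
    · exact hV.setIntegral_fderiv hU (hχφ i) (hχφc i) hsup v
  have hL : ∫ x in U, fderiv ℝ φ x v = ∑ i, ∫ x in U, fderiv ℝ (fun x => χ i x • φ x) x v := by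
    rw [← integral_finsetSum]
    · refine setIntegral_congr_fun hU.measurableSet fun x hx => ?_
      have hev : φ =ᶠ[𝓝 x] fun y => ∑ i, χ i y • φ y := by
        filter_upwards [hU.mem_nhds hx] with y hy
        rw [← Finset.sum_smul, hχ1 y (subset_closure hy), one_smul]
      rw [hev.fderiv_eq, fderiv_fun_sum fun i _ => (hχφ i).differentiable one_ne_zero x]
      simp
    · exact fun i _ => ((((hχφ i).continuous_fderiv one_ne_zero).clm_apply
        continuous_const).integrable_of_hasCompactSupport
          ((hχφc i).fderiv_apply (𝕜 := ℝ) v)).integrableOn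
  have hR : ∫ x, (inner ℝ v (outerNormal U x) : ℝ) • φ x ∂surfaceMeasure U =
      ∑ i, ∫ x, (inner ℝ v (outerNormal U x) : ℝ) • (χ i x • φ x) ∂surfaceMeasure U := by
    rw [← integral_finsetSum]
    · refine integral_congr_ae ?_
      filter_upwards [ae_mem_frontier] with x hx
      rw [← Finset.smul_sum, ← Finset.sum_smul, hχ1 x (frontier_subset_closure hx), one_smul]
    · exact fun i _ => h.integrable_inner_smul hb (hχφ i).continuous (hχφc i) v
  rw [hL, hR]
  exact Finset.sum_congr rfl fun i _ => hloc i

lemma norm_fderiv_le_sum_pd (φ : E d → ℂ) (x v : E d) (hv : ‖v‖ ≤ 1) :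
    ‖fderiv ℝ φ x v‖ ≤ ∑ i, ‖pd i φ x‖ := by
  have h1 : v = ∑ i, v i • EuclideanSpace.single i (1 : ℝ) := by
    have := (EuclideanSpace.basisFun (Fin d) ℝ).sum_repr v
    simpa using this.symm
  conv_lhs => rw [h1, map_sum]
  refine (norm_sum_le _ _).trans (Finset.sum_le_sum fun i _ => ?_)
  rw [map_smul, norm_smul]
  have : ‖v i‖ ≤ 1 := (PiLp.norm_apply_le v i).trans hv
  exact mul_le_of_le_one_left (norm_nonneg _) this

lemma contDiff_pd {φ : E d → ℂ} {n m : WithTop ℕ∞} (hφ : ContDiff ℝ n φ) (hmn : m + 1 ≤ n)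
    (i : Fin d) : ContDiff ℝ m (pd i φ) :=
  (hφ.fderiv_right hmn).clm_apply contDiff_const

lemma hasCompactSupport_pd {φ : E d → ℂ} (hc : HasCompactSupport φ) (i : Fin d) :
    HasCompactSupport (pd i φ) := hc.fderiv_apply (𝕜 := ℝ) _

/-- The trace inequality for smooth functions. -/
theorem HasC2Boundary.exists_trace_bound (h : HasC2Boundary U) (hU : IsOpen U)
    (hb : Bornology.IsBounded U) : ∃ C : ℝ, 0 ≤ C ∧ ∀ φ : E d → ℂ, ContDiff ℝ 1 φ →
      HasCompactSupport φ → ∫ x, ‖φ x‖ ^ 2 ∂surfaceMeasure U ≤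
        C * ((∫ x in U, ‖φ x‖ ^ 2) + ∑ i, ∫ x in U, ‖pd i φ x‖ ^ 2) := by
  have hfin := h.isFiniteMeasure hb
  obtain ⟨n, V, χ, hV, hχs, hχc, hχV, hχ0, hχ1⟩ := exists_partition (isCompact_frontier hb)
    (p := fun V => ∃ e g, IsBdryChart U V e g ∧ ∃ M, ∀ y ∈ V, graphDensity g y ≤ M)
    (fun x hx => h.exists_bounded_chart hx)
  choose e g hV M hM using hV
  have hBex : ∀ i, ∃ B : ℝ, 0 ≤ B ∧ ∀ x, χ i x ≤ B ∧ ‖fderiv ℝ (χ i) x (e i)‖ ≤ B := by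
    intro i
    have h1 : ContDiff ℝ 1 (χ i) := (hχs i).of_le (by norm_cast)
    obtain ⟨B1, hB1⟩ := (hχc i).exists_bound_of_continuous (hχs i).continuous
    obtain ⟨B2, hB2⟩ := ((hχc i).fderiv_apply (𝕜 := ℝ) (e i)).exists_bound_of_continuous
      ((h1.continuous_fderiv one_ne_zero).clm_apply continuous_const)
    refine ⟨max B1 B2, ?_, fun x => ⟨?_, (hB2 x).trans (le_max_right _ _)⟩⟩
    · exact ((norm_nonneg _).trans (hB1 0)).trans (le_max_left _ _)
    · exact ((le_abs_self _).trans (hB1 x)).trans (le_max_left _ _)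
  choose B hB0 hB using hBex
  -- `M i` makes up for `⟪e, ν⟫ ≥ 1 / M i`, and `B i` bounds `χ i` and its derivative along `e i`.
  -- The factor `d + 1` comes from `2|φ| ∑|∂_j φ| ≤ d|φ|² + ∑|∂_j φ|²` and one more `|φ|²` from
  -- differentiating `χ i`.
  refine ⟨∑ i, |M i| * (B i * (d + 1)), by
    refine Finset.sum_nonneg fun i _ => ?_
    have := hB0 i; positivity, fun φ hφ hc => ?_⟩
  set Q := (∫ x in U, ‖φ x‖ ^ 2) + ∑ i, ∫ x in U, ‖pd i φ x‖ ^ 2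
  have hsqc : ∀ ψ : E d → ℂ, HasCompactSupport ψ → HasCompactSupport fun x => ‖ψ x‖ ^ 2 :=
    fun ψ hψ => hψ.comp_left (g := fun z : ℂ => ‖z‖ ^ 2) (by simp)
  have hpdc : ∀ i, Continuous (pd i φ) := fun i =>
    (contDiff_pd hφ (m := 0) (by norm_num) i).continuous
  have hi0 : IntegrableOn (fun x => ‖φ x‖ ^ 2) U :=
    ((hφ.continuous.norm.pow 2).integrable_of_hasCompactSupport (hsqc φ hc)).integrableOn
  have hi1 : ∀ i, IntegrableOn (fun x => ‖pd i φ x‖ ^ 2) U := fun i =>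
    (((hpdc i).norm.pow 2).integrable_of_hasCompactSupport
      (hsqc _ (hasCompactSupport_pd hc i))).integrableOn
  -- each chart
  have hchart : ∀ i, ∫ x, χ i x * ‖φ x‖ ^ 2 ∂surfaceMeasure U ≤ |M i| * (B i * (d + 1)) * Q := by
    intro i
    have hχ1 : ContDiff ℝ 1 (χ i) := (hχs i).of_le (by norm_cast)
    have hconj : ContDiff ℝ 1 fun x => conj (φ x) :=
      (Complex.conjCLE.contDiff (𝕜 := ℝ)).comp hφ
    -- The divergence theorem for `χ|φ|²` in the direction `e i` bounds the boundary integral of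
    -- `⟪e, ν⟫ χ|φ|²` by interior terms.
    set ψ : E d → ℂ := fun x => χ i x • (φ x * conj (φ x)) with hψ
    have hψd : ContDiff ℝ 1 ψ := hχ1.smul (hφ.mul hconj)
    have hψc : HasCompactSupport ψ := (hχc i).smul_right
    have hψV : tsupport ψ ⊆ V i := (tsupport_smul_subset_left _ _).trans (hχV i)
    have hdiv := (hV i).setIntegral_fderiv hU hψd hψc hψV (e i)
    have hψr : ∀ x, ψ x = ((χ i x * ‖φ x‖ ^ 2 : ℝ) : ℂ) := fun x => by
      simp only [hψ, Complex.mul_conj, Complex.normSq_eq_norm_sq]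
      push_cast; simp
    have hbd : ∀ x, ‖fderiv ℝ ψ x (e i)‖ ≤
        B i * (d + 1) * (‖φ x‖ ^ 2 + ∑ j, ‖pd j φ x‖ ^ 2) := by
      intro x
      have d1 := (hχ1.differentiable one_ne_zero x).hasFDerivAt
      have d2 := (hφ.differentiable one_ne_zero x).hasFDerivAt
      have d3 : HasFDerivAt (fun x => conj (φ x))
          ((Complex.conjCLE : ℂ →L[ℝ] ℂ).comp (fderiv ℝ φ x)) x :=
        (Complex.conjCLE : ℂ →L[ℝ] ℂ).hasFDerivAt.comp x d2
      have d4 := d1.smul (d2.mul d3)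
      have d5 : fderiv ℝ ψ x (e i) = χ i x • (φ x * conj (fderiv ℝ φ x (e i)) +
          conj (φ x) * fderiv ℝ φ x (e i)) +
          fderiv ℝ (χ i) x (e i) • (φ x * conj (φ x)) := by
        have d6 : fderiv ℝ ψ x = _ := d4.fderiv
        rw [d6]
        simp
      have d7 := norm_fderiv_le_sum_pd φ x (e i) (hV i).norm_eq.le
      set D := ‖fderiv ℝ φ x (e i)‖
      have hχn : ‖χ i x‖ ≤ B i := by
        rw [Real.norm_of_nonneg (hχ0 i x)]; exact (hB i x).1
      calc ‖fderiv ℝ ψ x (e i)‖ ≤ B i * (‖φ x‖ * D + ‖φ x‖ * D) + B i * (‖φ x‖ * ‖φ x‖) := by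
            rw [d5]
            refine (norm_add_le _ _).trans (add_le_add ?_ ?_)
            · rw [norm_smul]
              refine mul_le_mul hχn ((norm_add_le _ _).trans ?_) (norm_nonneg _) (hB0 i)
              simp [D]
            · rw [norm_smul]
              refine mul_le_mul (hB i x).2 ?_ (norm_nonneg _) (hB0 i)
              simp
        _ = B i * (2 * ‖φ x‖ * D + ‖φ x‖ ^ 2) := by ring
        _ ≤ B i * (2 * ‖φ x‖ * (∑ j, ‖pd j φ x‖) + ‖φ x‖ ^ 2) := by
            have := hB0 i
            gcongr
        _ ≤ B i * ((d + 1) * (‖φ x‖ ^ 2 + ∑ j, ‖pd j φ x‖ ^ 2)) := by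
            refine mul_le_mul_of_nonneg_left ?_ (hB0 i)
            have h1 : 2 * ‖φ x‖ * (∑ j, ‖pd j φ x‖) ≤ d * ‖φ x‖ ^ 2 + ∑ j, ‖pd j φ x‖ ^ 2 := by
              have : (d : ℝ) * ‖φ x‖ ^ 2 = ∑ _j : Fin d, ‖φ x‖ ^ 2 := by simp
              rw [this, ← Finset.sum_add_distrib, Finset.mul_sum]
              exact Finset.sum_le_sum fun j _ => two_mul_le_add_sq _ _
            have h2 : 0 ≤ ∑ j, ‖pd j φ x‖ ^ 2 := by positivity
            nlinarith [(Nat.cast_nonneg d : (0 : ℝ) ≤ d)]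
        _ = _ := by ring
    have hint := h.integrable_inner_smul hb hψd.continuous hψc (e i)
    have hmono : ∫ x, χ i x * ‖φ x‖ ^ 2 ∂surfaceMeasure U ≤
        |M i| * ∫ x, inner ℝ (e i) (outerNormal U x) * (χ i x * ‖φ x‖ ^ 2) ∂surfaceMeasure U := by
      rw [← integral_const_mul]
      refine integral_mono_ae ?_ ?_ ?_
      · exact (((hχs i).continuous.mul (hφ.continuous.norm.pow 2)).integrable_of_hasCompactSupport
          (hχc i).mul_right)
      · refine Integrable.const_mul ?_ _
        have := hint.re
        refine this.congr (ae_of_all _ fun x => ?_)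
        beta_reduce
        rw [hψr, Complex.real_smul, ← Complex.ofReal_mul]
        exact Complex.ofReal_re _
      · filter_upwards [ae_mem_frontier] with x hx
        by_cases hxV : x ∈ V i
        · have h1 := (hV i).outerNormal_eq hxV hx
          have h2 : inner ℝ (e i) (outerNormal U x) = (graphDensity (g i) x)⁻¹ := by
            rw [h1, IsBdryChart.inner_graphNormal, (hV i).inner_self, (hV i).fderiv_apply_self]; simp
          rw [h2]
          have hJ := IsGraphFun.graphDensity_pos (g := g i) x
          have h3 : 1 ≤ |M i| * (graphDensity (g i) x)⁻¹ := by
            rw [← div_eq_mul_inv, one_le_div hJ]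
            exact (hM i x hxV).trans (le_abs_self _)
          have h4 : 0 ≤ χ i x * ‖φ x‖ ^ 2 := mul_nonneg (hχ0 i x) (by positivity)
          calc χ i x * ‖φ x‖ ^ 2 = 1 * (χ i x * ‖φ x‖ ^ 2) := (one_mul _).symm
            _ ≤ (|M i| * (graphDensity (g i) x)⁻¹) * (χ i x * ‖φ x‖ ^ 2) := by gcongr
            _ = _ := by ring
        · have : χ i x = 0 := image_eq_zero_of_notMem_tsupport fun hx' => hxV (hχV i hx')
          simp [this]
    have hdiv' : ∫ x, inner ℝ (e i) (outerNormal U x) * (χ i x * ‖φ x‖ ^ 2) ∂surfaceMeasure U ≤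
        ∫ x in U, ‖fderiv ℝ ψ x (e i)‖ := by
      have : ((∫ x, inner ℝ (e i) (outerNormal U x) * (χ i x * ‖φ x‖ ^ 2) ∂surfaceMeasure U : ℝ) : ℂ)
          = ∫ x in U, fderiv ℝ ψ x (e i) := by
        rw [hdiv, ← integral_complex_ofReal]
        refine integral_congr_ae (ae_of_all _ fun x => ?_)
        simp only [hψr, Complex.real_smul]; push_cast; ring
      refine (le_abs_self _).trans ?_
      rw [← Real.norm_eq_abs, ← Complex.norm_real, this]
      exact norm_integral_le_integral_norm _
    have hfin' : ∫ x in U, ‖fderiv ℝ ψ x (e i)‖ ≤ B i * (d + 1) * Q := by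
      have : B i * (d + 1) * Q =
          ∫ x in U, B i * (d + 1) * (‖φ x‖ ^ 2 + ∑ j, ‖pd j φ x‖ ^ 2) := by
        rw [integral_const_mul, integral_add hi0 (integrable_finsetSum _ fun j _ => hi1 j),
          integral_finsetSum _ fun j _ => hi1 j]
      rw [this]
      refine integral_mono ?_ ?_ hbd
      · exact (((hψd.continuous_fderiv one_ne_zero).clm_apply
          continuous_const).integrable_of_hasCompactSupport
            (hψc.fderiv_apply (𝕜 := ℝ) _)).norm.integrableOn
      · exact (hi0.add (integrable_finsetSum _ fun j _ => hi1 j)).const_mul _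
    calc _ ≤ _ := hmono
      _ ≤ |M i| * (B i * (d + 1) * Q) := by gcongr; exact hdiv'.trans hfin'
      _ = _ := by ring
  calc ∫ x, ‖φ x‖ ^ 2 ∂surfaceMeasure U = ∫ x, ∑ i, χ i x * ‖φ x‖ ^ 2 ∂surfaceMeasure U := by
        refine integral_congr_ae ?_
        filter_upwards [ae_mem_frontier] with x hx
        rw [← Finset.sum_mul, hχ1 x hx, one_mul]
    _ = ∑ i, ∫ x, χ i x * ‖φ x‖ ^ 2 ∂surfaceMeasure U := by
        refine integral_finsetSum _ fun i _ => ?_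
        exact (((hχs i).continuous.mul (hφ.continuous.norm.pow 2)).integrable_of_hasCompactSupport
          (hχc i).mul_right)
    _ ≤ _ := by
        rw [Finset.sum_mul]
        exact Finset.sum_le_sum fun i _ => hchart i

end Boundary

/-! ### Square integrable functions as elements of `L²` -/

section ToL2

variable {X : Type*} [MeasurableSpace X] {μ : Measure X}

open Classical in
/-- The class in `L²(μ)` of a square integrable function; `0` for other functions. -/
def toL2 (μ : Measure X) (φ : X → ℂ) : Lp ℂ 2 μ :=
  if h : MemLp φ 2 μ then h.toLp φ else 0

lemma coeFn_toL2 {φ : X → ℂ} (h : MemLp φ 2 μ) : toL2 μ φ =ᵐ[μ] φ := by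
  rw [toL2, dif_pos h]; exact h.coeFn_toLp

lemma toL2_coeFn (f : Lp ℂ 2 μ) : toL2 μ f = f :=
  Lp.ext (coeFn_toL2 (Lp.memLp f))

lemma toL2_congr {φ ψ : X → ℂ} (h : φ =ᵐ[μ] ψ) : toL2 μ φ = toL2 μ ψ := by
  by_cases hφ : MemLp φ 2 μ
  · exact Lp.ext ((coeFn_toL2 hφ).trans (h.trans (coeFn_toL2 (hφ.ae_eq h)).symm))
  · rw [toL2, dif_neg hφ, toL2, dif_neg fun hψ => hφ (hψ.ae_eq h.symm)]

lemma toL2_add {φ ψ : X → ℂ} (hφ : MemLp φ 2 μ) (hψ : MemLp ψ 2 μ) :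
    toL2 μ (fun x => φ x + ψ x) = toL2 μ φ + toL2 μ ψ := by
  refine Lp.ext ((coeFn_toL2 (hφ.add hψ)).trans ?_)
  filter_upwards [coeFn_toL2 hφ, coeFn_toL2 hψ, Lp.coeFn_add (toL2 μ φ) (toL2 μ ψ)] with x h1 h2 h3
  rw [h3, Pi.add_apply, Pi.add_apply, h1, h2]

lemma toL2_smul {φ : X → ℂ} (hφ : MemLp φ 2 μ) (c : ℂ) :
    toL2 μ (fun x => c * φ x) = c • toL2 μ φ := by
  refine Lp.ext ((coeFn_toL2 (hφ.const_mul c)).trans ?_)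
  filter_upwards [coeFn_toL2 hφ, Lp.coeFn_smul c (toL2 μ φ)] with x h1 h3
  rw [h3, Pi.smul_apply, h1, smul_eq_mul]

lemma toL2_sub {φ ψ : X → ℂ} (hφ : MemLp φ 2 μ) (hψ : MemLp ψ 2 μ) :
    toL2 μ (fun x => φ x - ψ x) = toL2 μ φ - toL2 μ ψ := by
  refine Lp.ext ((coeFn_toL2 (hφ.sub hψ)).trans ?_)
  filter_upwards [coeFn_toL2 hφ, coeFn_toL2 hψ, Lp.coeFn_sub (toL2 μ φ) (toL2 μ ψ)] with x h1 h2 h3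
  rw [h3, Pi.sub_apply, Pi.sub_apply, h1, h2]

lemma toL2_zero : toL2 μ (fun _ => 0) = 0 := by
  refine Lp.ext ((coeFn_toL2 (μ := μ) (φ := fun _ => 0) (by simp)).trans (Lp.coeFn_zero _ _ _).symm)

lemma edist_toL2 {φ : X → ℂ} (hφ : MemLp φ 2 μ) (f : Lp ℂ 2 μ) :
    edist (toL2 μ φ) f = eLpNorm (fun x => φ x - f x) 2 μ := by
  rw [Lp.edist_def]
  refine eLpNorm_congr_ae ?_
  filter_upwards [coeFn_toL2 hφ] with x hx
  rw [Pi.sub_apply, hx]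

lemma tendsto_toL2_iff {φ : ℕ → X → ℂ} (hφ : ∀ n, MemLp (φ n) 2 μ) (f : Lp ℂ 2 μ) :
    Tendsto (fun n => eLpNorm (fun x => φ n x - f x) 2 μ) atTop (𝓝 0) ↔
      Tendsto (fun n => toL2 μ (φ n)) atTop (𝓝 f) := by
  rw [tendsto_iff_edist_tendsto_0]
  simp only [edist_toL2 (hφ _)]

lemma norm_sq_eq_integral (f : Lp ℂ 2 μ) : ‖f‖ ^ 2 = ∫ x, ‖f x‖ ^ 2 ∂μ := by
  have h := @L2.inner_def X ℂ ℂ _ _ _ _ _ f f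
  rw [inner_self_eq_norm_sq_to_K] at h
  have h2 : ∀ x, inner ℂ (f x) (f x) = ((‖f x‖ ^ 2 : ℝ) : ℂ) := fun x => by
    rw [inner_self_eq_norm_sq_to_K]; simp
  simp only [h2] at h
  rw [integral_complex_ofReal] at h
  have h3 : ((‖f‖ ^ 2 : ℝ) : ℂ) = ((∫ x, ‖f x‖ ^ 2 ∂μ : ℝ) : ℂ) := by rw [← h]; simp
  exact_mod_cast h3

lemma norm_toL2_sq {φ : X → ℂ} (hφ : MemLp φ 2 μ) : ‖toL2 μ φ‖ ^ 2 = ∫ x, ‖φ x‖ ^ 2 ∂μ := by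
  rw [norm_sq_eq_integral]
  exact integral_congr_ae ((coeFn_toL2 hφ).mono fun x hx => by simp only [hx])

lemma inner_eq_integral (f g : Lp ℂ 2 μ) : inner ℂ g f = ∫ x, f x * conj (g x) ∂μ := by
  rw [L2.inner_def]; simp only [RCLike.inner_apply]

lemma inner_toL2_toL2 {φ ψ : X → ℂ} (hφ : MemLp φ 2 μ) (hψ : MemLp ψ 2 μ) :
    inner ℂ (toL2 μ ψ) (toL2 μ φ) = ∫ x, φ x * conj (ψ x) ∂μ := by
  rw [inner_eq_integral]
  refine integral_congr_ae ?_
  filter_upwards [coeFn_toL2 hφ, coeFn_toL2 hψ] with x h1 h2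
  rw [h1, h2]

lemma inner_toL2 {ψ : X → ℂ} (f : Lp ℂ 2 μ) (hψ : MemLp ψ 2 μ) :
    inner ℂ (toL2 μ ψ) f = ∫ x, f x * conj (ψ x) ∂μ := by
  rw [inner_eq_integral]
  refine integral_congr_ae ?_
  filter_upwards [coeFn_toL2 hψ] with x h2
  rw [h2]

end ToL2

/-! ### Weak derivatives and the space `H¹` -/

section WeakDerivatives

variable {d : ℕ} {U : Set (E d)}

lemma ip_eq_integral (f g : L2 U) : ip f g = ∫ x in U, f x * conj (g x) := inner_eq_integral f g

lemma ip_add_left (f f' g : L2 U) : ip (f + f') g = ip f g + ip f' g := inner_add_right _ _ _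
lemma ip_add_right (f g g' : L2 U) : ip f (g + g') = ip f g + ip f g' := inner_add_left _ _ _
lemma ip_sub_left (f f' g : L2 U) : ip (f - f') g = ip f g - ip f' g := inner_sub_right _ _ _
lemma ip_neg_left (f g : L2 U) : ip (-f) g = -ip f g := inner_neg_right _ _
lemma ip_smul_left (c : ℂ) (f g : L2 U) : ip (c • f) g = c * ip f g := inner_smul_right _ _ _
lemma ip_smul_right (c : ℂ) (f g : L2 U) : ip f (c • g) = conj c * ip f g := inner_smul_left _ _ _
lemma conj_ip (f g : L2 U) : conj (ip f g) = ip g f := inner_conj_symm _ _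
lemma ip_self (f : L2 U) : ip f f = ((‖f‖ ^ 2 : ℝ) : ℂ) := by
  rw [ip, inner_self_eq_norm_sq_to_K]; simp
lemma norm_ip_le (f g : L2 U) : ‖ip f g‖ ≤ ‖f‖ * ‖g‖ := by
  rw [mul_comm]; exact norm_inner_le_norm g f
lemma ip_zero_left (g : L2 U) : ip 0 g = 0 := inner_zero_right _
lemma ip_sum_left {ι : Type*} (s : Finset ι) (f : ι → L2 U) (g : L2 U) :
    ip (∑ i ∈ s, f i) g = ∑ i ∈ s, ip (f i) g := inner_sum _ _ _

lemma continuous_ip : Continuous fun p : L2 U × L2 U => ip p.1 p.2 :=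
  continuous_inner.comp continuous_swap

/-- The class in `L²(U)` of a function on the whole space. -/
abbrev rL2 (U : Set (E d)) (φ : E d → ℂ) : L2 U := toL2 (volume.restrict U) φ

/-- Smooth functions with compact support in the whole space. -/
structure IsCc (φ : E d → ℂ) : Prop where
  smooth : ContDiff ℝ ∞ φ
  compact : HasCompactSupport φ

lemma IsTest.isCc {φ : E d → ℂ} (h : IsTest U φ) : IsCc φ := ⟨h.1, h.2.1⟩

namespace IsCc

variable {φ ψ : E d → ℂ} (h : IsCc φ)
include h

lemma contDiff_one : ContDiff ℝ 1 φ := h.smooth.of_le (by norm_cast)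

lemma memLp (μ : Measure (E d)) [IsFiniteMeasureOnCompacts μ] : MemLp φ 2 μ :=
  h.smooth.continuous.memLp_of_hasCompactSupport h.compact

lemma pd (i : Fin d) : IsCc (pd i φ) :=
  ⟨contDiff_pd h.smooth (by norm_cast) i, hasCompactSupport_pd h.compact i⟩

lemma add (h' : IsCc ψ) : IsCc fun x => φ x + ψ x := ⟨h.smooth.add h'.smooth, h.compact.add h'.compact⟩

lemma sub (h' : IsCc ψ) : IsCc fun x => φ x - ψ x := ⟨h.smooth.sub h'.smooth, h.compact.sub h'.compact⟩

lemma const_mul (c : ℂ) : IsCc fun x => c * φ x :=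
  ⟨contDiff_const.mul h.smooth, h.compact.mul_left (f := fun _ => c)⟩

lemma mul (h' : IsCc ψ) : IsCc fun x => φ x * ψ x := ⟨h.smooth.mul h'.smooth, h.compact.mul_right⟩

lemma star : IsCc fun x => conj (φ x) :=
  ⟨(Complex.conjCLE.contDiff (𝕜 := ℝ)).comp h.smooth, h.compact.comp_left (g := conj) (by simp)⟩

lemma differentiable : Differentiable ℝ φ := h.contDiff_one.differentiable one_ne_zero

lemma pd_add (h' : IsCc ψ) (i : Fin d) :
    StructuralAcoustics.pd i (fun x => φ x + ψ x) =
      fun x => StructuralAcoustics.pd i φ x + StructuralAcoustics.pd i ψ x := by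
  ext x
  simp only [StructuralAcoustics.pd]
  rw [fderiv_fun_add (h.differentiable x) (h'.differentiable x)]; rfl

lemma pd_sub (h' : IsCc ψ) (i : Fin d) :
    StructuralAcoustics.pd i (fun x => φ x - ψ x) =
      fun x => StructuralAcoustics.pd i φ x - StructuralAcoustics.pd i ψ x := by
  ext x
  simp only [StructuralAcoustics.pd]
  rw [fderiv_fun_sub (h.differentiable x) (h'.differentiable x)]; rfl

lemma pd_const_mul (c : ℂ) (i : Fin d) :
    StructuralAcoustics.pd i (fun x => c * φ x) = fun x => c * StructuralAcoustics.pd i φ x := by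
  ext x
  simp only [StructuralAcoustics.pd]
  rw [fderiv_const_mul (h.differentiable x)]; rfl

lemma pd_mul (h' : IsCc ψ) (i : Fin d) :
    StructuralAcoustics.pd i (fun x => φ x * ψ x) =
      fun x => φ x * StructuralAcoustics.pd i ψ x + ψ x * StructuralAcoustics.pd i φ x := by
  ext x
  simp only [StructuralAcoustics.pd]
  rw [fderiv_fun_mul (h.differentiable x) (h'.differentiable x)]; rfl

lemma pd_conj (i : Fin d) :
    StructuralAcoustics.pd i (fun x => (starRingEnd ℂ) (φ x)) =
      fun x => (starRingEnd ℂ) (StructuralAcoustics.pd i φ x) := by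
  ext x
  have h1 : HasFDerivAt (fun x => (starRingEnd ℂ) (φ x))
      ((Complex.conjCLE : ℂ →L[ℝ] ℂ).comp (fderiv ℝ φ x)) x :=
    (Complex.conjCLE : ℂ →L[ℝ] ℂ).hasFDerivAt.comp x (h.differentiable x).hasFDerivAt
  simp only [StructuralAcoustics.pd]
  rw [h1.fderiv]; rfl

end IsCc

lemma isCc_ofReal {φ : E d → ℝ} (h1 : ContDiff ℝ ∞ φ) (h2 : HasCompactSupport φ) :
    IsCc fun x => (φ x : ℂ) :=
  ⟨(Complex.ofRealCLM.contDiff (𝕜 := ℝ)).comp h1, h2.comp_left (g := Complex.ofReal) (by simp)⟩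

lemma pd_ofReal {φ : E d → ℝ} (h : Differentiable ℝ φ) (i : Fin d) :
    pd i (fun x => (φ x : ℂ)) = fun x => ((pd i φ x : ℝ) : ℂ) := by
  ext x
  have h1 : HasFDerivAt (fun x => (φ x : ℂ)) (Complex.ofRealCLM.comp (fderiv ℝ φ x)) x :=
    Complex.ofRealCLM.hasFDerivAt.comp x (h x).hasFDerivAt
  simp only [pd]
  rw [h1.fderiv]; rfl

lemma IsTest.ofReal {φ : E d → ℝ} (h : IsTest U φ) : IsTest U fun x => (φ x : ℂ) := by
  have := isCc_ofReal h.1 h.2.1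
  refine ⟨this.1, this.2, (closure_mono ?_).trans h.2.2⟩
  intro x hx
  simpa using hx

lemma IsTest.comp_clm {F F' : Type*} [NormedAddCommGroup F] [NormedSpace ℝ F]
    [NormedAddCommGroup F'] [NormedSpace ℝ F'] {φ : E d → F}
    (h : IsTest U φ) (L : F →L[ℝ] F') : IsTest U fun x => L (φ x) := by
  refine ⟨L.contDiff.comp h.1, h.2.1.comp_left (g := L) (by simp), (closure_mono ?_).trans h.2.2⟩
  intro x hx hx'
  exact hx (by simp [hx'])

lemma IsTest.pd {F : Type*} [NormedAddCommGroup F] [NormedSpace ℝ F] {φ : E d → F}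
    (h : IsTest U φ) (i : Fin d) : IsTest U (pd i φ) := by
  refine ⟨(h.1.fderiv_right (m := ∞) (by norm_cast)).clm_apply contDiff_const,
    h.2.1.fderiv_apply (𝕜 := ℝ) _, ?_⟩
  refine (closure_mono ?_).trans ((tsupport_fderiv_subset ℝ (f := φ)).trans h.2.2)
  intro x hx hx'
  apply hx
  simp only [StructuralAcoustics.pd, hx']; rfl

lemma IsTest.eq_zero {F : Type*} [NormedAddCommGroup F] [NormedSpace ℝ F] {φ : E d → F}
    (h : IsTest U φ) {x : E d} (hx : x ∉ U) : φ x = 0 :=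
  image_eq_zero_of_notMem_tsupport fun hx' => hx (h.2.2 hx')

lemma pd_comp_clm {F F' : Type*} [NormedAddCommGroup F] [NormedSpace ℝ F]
    [NormedAddCommGroup F'] [NormedSpace ℝ F'] {φ : E d → F} (h : Differentiable ℝ φ)
    (L : F →L[ℝ] F') (i : Fin d) : pd i (fun x => L (φ x)) = fun x => L (pd i φ x) := by
  ext x
  have h1 : HasFDerivAt (fun x => L (φ x)) (L.comp (fderiv ℝ φ x)) x :=
    L.hasFDerivAt.comp x (h x).hasFDerivAt
  simp only [pd]
  rw [h1.fderiv]; rfl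

lemma ip_rL2_ofReal (f : L2 U) {φ : E d → ℝ} (h1 : ContDiff ℝ ∞ φ) (h2 : HasCompactSupport φ) :
    ip f (rL2 U fun x => (φ x : ℂ)) = ∫ x in U, φ x • f x := by
  rw [ip, inner_toL2 f ((isCc_ofReal h1 h2).memLp _)]
  refine integral_congr_ae (ae_of_all _ fun x => ?_)
  simp [mul_comm]

/-- A weak derivative can be tested with complex test functions. -/
lemma hasWeakPartial_iff {i : Fin d} {f g : L2 U} :
    HasWeakPartial i f g ↔ ∀ φ : E d → ℂ, IsTest U φ → ip f (rL2 U (pd i φ)) = -ip g (rL2 U φ) := by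
  constructor
  · intro h φ hφ
    have hre := hφ.comp_clm Complex.reCLM
    have him := hφ.comp_clm Complex.imCLM
    have hreal : ∀ ψ : E d → ℝ, IsTest U ψ →
        ip f (rL2 U fun x => ((pd i ψ x : ℝ) : ℂ)) = -ip g (rL2 U fun x => (ψ x : ℂ)) := by
      intro ψ hψ
      rw [ip_rL2_ofReal f (hψ.pd i).1 (hψ.pd i).2.1, ip_rL2_ofReal g hψ.1 hψ.2.1]
      exact h ψ hψ
    have hd : Differentiable ℝ φ := hφ.isCc.differentiable
    have e1 : rL2 U φ = rL2 U (fun x => ((Complex.reCLM (φ x) : ℝ) : ℂ)) +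
        Complex.I • rL2 U (fun x => ((Complex.imCLM (φ x) : ℝ) : ℂ)) := by
      have m1 := (isCc_ofReal hre.1 hre.2.1).memLp (volume.restrict U)
      have m2 := (isCc_ofReal him.1 him.2.1).memLp (volume.restrict U)
      rw [rL2, rL2, rL2, ← toL2_smul m2, ← toL2_add m1 (m2.const_mul _)]
      congr 1; ext x
      simp [mul_comm Complex.I, Complex.re_add_im]
    have e2 : rL2 U (pd i φ) = rL2 U (fun x => ((pd i (fun x => Complex.reCLM (φ x)) x : ℝ) : ℂ)) +
        Complex.I • rL2 U (fun x => ((pd i (fun x => Complex.imCLM (φ x)) x : ℝ) : ℂ)) := by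
      have m1 := (isCc_ofReal (hre.pd i).1 (hre.pd i).2.1).memLp (volume.restrict U)
      have m2 := (isCc_ofReal (him.pd i).1 (him.pd i).2.1).memLp (volume.restrict U)
      rw [rL2, rL2, rL2, ← toL2_smul m2, ← toL2_add m1 (m2.const_mul _)]
      congr 1; ext x
      rw [pd_comp_clm hd, pd_comp_clm hd]
      simp [mul_comm Complex.I, Complex.re_add_im]
    rw [e1, e2, ip_add_right, ip_add_right, ip_smul_right, ip_smul_right, hreal _ hre, hreal _ him]
    ring
  · intro h φ hφ
    have h1 := h _ hφ.ofReal
    rw [pd_ofReal (hφ.1.differentiable (by simp)), ip_rL2_ofReal f (hφ.pd i).1 (hφ.pd i).2.1,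
      ip_rL2_ofReal g hφ.1 hφ.2.1] at h1
    exact h1

lemma eq_zero_of_integral_test (hU : IsOpen U) {f : L2 U}
    (h : ∀ φ : E d → ℝ, IsTest U φ → ∫ x in U, φ x • f x = 0) : f = 0 := by
  have hloc : LocallyIntegrableOn f U volume :=
    locallyIntegrableOn_of_locallyIntegrable_restrict
      ((Lp.memLp f).locallyIntegrable (by norm_num))
  have := hU.ae_eq_zero_of_integral_contDiff_smul_eq_zero hloc fun φ h1 h2 h3 => by
    rw [← h φ ⟨h1, h2, h3⟩, setIntegral_eq_integral_of_forall_compl_eq_zero]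
    intro x hx
    rw [image_eq_zero_of_notMem_tsupport fun hx' => hx (h3 hx'), zero_smul]
  refine Lp.ext ?_
  filter_upwards [(ae_restrict_iff' hU.measurableSet).2 this,
    Lp.coeFn_zero ℂ 2 (volume.restrict U)] with x h1 h2
  rw [h1, h2]; rfl

lemma HasWeakPartial.unique (hU : IsOpen U) {i : Fin d} {f g g' : L2 U} (h : HasWeakPartial i f g)
    (h' : HasWeakPartial i f g') : g = g' := by
  rw [← sub_eq_zero]
  refine eq_zero_of_integral_test hU fun φ hφ => ?_
  rw [← ip_rL2_ofReal _ hφ.1 hφ.2.1, ip_sub_left, ip_rL2_ofReal _ hφ.1 hφ.2.1,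
    ip_rL2_ofReal _ hφ.1 hφ.2.1, sub_eq_zero, ← neg_inj, ← h φ hφ, ← h' φ hφ]

lemma HasLaplacian.unique (hU : IsOpen U) {f g g' : L2 U} (h : HasLaplacian f g)
    (h' : HasLaplacian f g') : g = g' := by
  rw [← sub_eq_zero]
  refine eq_zero_of_integral_test hU fun φ hφ => ?_
  rw [← ip_rL2_ofReal _ hφ.1 hφ.2.1, ip_sub_left, ip_rL2_ofReal _ hφ.1 hφ.2.1,
    ip_rL2_ofReal _ hφ.1 hφ.2.1, sub_eq_zero, ← h φ hφ, ← h' φ hφ]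

lemma weakPartial_eq (hU : IsOpen U) {i : Fin d} {f g : L2 U} (h : HasWeakPartial i f g) :
    weakPartial i f = g := theObj_eq h fun _ hb => hb.unique hU h

lemma laplacian_eq (hU : IsOpen U) {f g : L2 U} (h : HasLaplacian f g) :
    laplacian f = g := theObj_eq h fun _ hb => hb.unique hU h

lemma hasWeakPartial_weakPartial {f : L2 U} (hf : f ∈ H1 U) (i : Fin d) :
    HasWeakPartial i f (weakPartial i f) := theObj_spec (hf i)

lemma HasWeakPartial.add {i : Fin d} {f f' g g' : L2 U} (h : HasWeakPartial i f g)
    (h' : HasWeakPartial i f' g') : HasWeakPartial i (f + f') (g + g') := by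
  rw [hasWeakPartial_iff] at *
  intro φ hφ
  rw [ip_add_left, ip_add_left, h φ hφ, h' φ hφ]; ring

lemma HasWeakPartial.smul {i : Fin d} {f g : L2 U} (h : HasWeakPartial i f g) (c : ℂ) :
    HasWeakPartial i (c • f) (c • g) := by
  rw [hasWeakPartial_iff] at *
  intro φ hφ
  rw [ip_smul_left, ip_smul_left, h φ hφ]; ring

/-- Closedness of the weak derivative: each test identity is continuous in both functions. All
completeness arguments for `H¹`, `H¹₀` and the plate space reduce to it. -/
lemma HasWeakPartial.of_tendsto {i : Fin d} {f g : ℕ → L2 U} {f₀ g₀ : L2 U}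
    (h : ∀ n, HasWeakPartial i (f n) (g n)) (hf : Tendsto f atTop (𝓝 f₀))
    (hg : Tendsto g atTop (𝓝 g₀)) : HasWeakPartial i f₀ g₀ := by
  rw [hasWeakPartial_iff]
  intro φ hφ
  have h1 := (continuous_ip.tendsto (f₀, rL2 U (pd i φ))).comp
    (hf.prodMk_nhds tendsto_const_nhds)
  have h2 := ((continuous_ip.tendsto (g₀, rL2 U φ)).comp
    (hg.prodMk_nhds tendsto_const_nhds)).neg
  refine tendsto_nhds_unique h1 (h2.congr fun n => ?_)
  exact (hasWeakPartial_iff.1 (h n) φ hφ).symm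

/-- `H¹(U)` as a subspace. -/
def H1sub (U : Set (E d)) : Submodule ℂ (L2 U) where
  carrier := H1 U
  zero_mem' i := ⟨0, hasWeakPartial_iff.2 fun φ _ => by rw [ip_zero_left, ip_zero_left, neg_zero]⟩
  add_mem' ha hb i := ⟨_, (hasWeakPartial_weakPartial ha i).add (hasWeakPartial_weakPartial hb i)⟩
  smul_mem' c _ ha i := ⟨_, (hasWeakPartial_weakPartial ha i).smul c⟩

lemma weakPartial_add (hU : IsOpen U) {f g : L2 U} (hf : f ∈ H1 U) (hg : g ∈ H1 U) (i : Fin d) :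
    weakPartial i (f + g) = weakPartial i f + weakPartial i g :=
  weakPartial_eq hU ((hasWeakPartial_weakPartial hf i).add (hasWeakPartial_weakPartial hg i))

lemma weakPartial_smul (hU : IsOpen U) {f : L2 U} (hf : f ∈ H1 U) (c : ℂ) (i : Fin d) :
    weakPartial i (c • f) = c • weakPartial i f :=
  weakPartial_eq hU ((hasWeakPartial_weakPartial hf i).smul c)

lemma weakPartial_sub (hU : IsOpen U) {f g : L2 U} (hf : f ∈ H1 U) (hg : g ∈ H1 U) (i : Fin d) :
    weakPartial i (f - g) = weakPartial i f - weakPartial i g := by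
  rw [sub_eq_add_neg, ← neg_one_smul ℂ g, weakPartial_add hU hf ((H1sub U).smul_mem _ hg),
    weakPartial_smul hU hg, neg_one_smul, sub_eq_add_neg]

/-- Classical and weak derivatives agree. -/
lemma IsCc.hasWeakPartial {φ : E d → ℂ} (h : IsCc φ) (i : Fin d) :
    HasWeakPartial i (rL2 U φ) (rL2 U (StructuralAcoustics.pd i φ)) := by
  rw [hasWeakPartial_iff]
  intro ψ hψ
  have hψc := hψ.isCc
  rw [ip, ip, inner_toL2_toL2 (h.memLp _) ((hψc.pd i).memLp _),
    inner_toL2_toL2 ((h.pd i).memLp _) (hψc.memLp _),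
    setIntegral_eq_integral_of_forall_compl_eq_zero (fun x hx => by
      rw [(hψ.pd i).eq_zero hx]; simp),
    setIntegral_eq_integral_of_forall_compl_eq_zero (fun x hx => by
      rw [hψ.eq_zero hx]; simp), ← add_eq_zero_iff_eq_neg, ← integral_add]
  · have h1 := IsGraphFun.integral_fderiv_eq_zero volume (h.mul hψc.star).contDiff_one
      (h.mul hψc.star).compact (EuclideanSpace.single i 1)
    rw [← h1]
    refine integral_congr_ae (ae_of_all _ fun x => ?_)
    have h2 := congrFun (h.pd_mul hψc.star i) x
    rw [hψc.pd_conj] at h2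
    simp only [StructuralAcoustics.pd] at h2 ⊢
    rw [h2]; ring
  · have := h.mul (hψc.pd i).star
    exact this.smooth.continuous.integrable_of_hasCompactSupport this.compact
  · have := (h.pd i).mul hψc.star
    exact this.smooth.continuous.integrable_of_hasCompactSupport this.compact

lemma IsCc.mem_H1 {φ : E d → ℂ} (h : IsCc φ) : rL2 U φ ∈ H1 U := fun i => ⟨_, h.hasWeakPartial i⟩

lemma IsCc.weakPartial_eq (hU : IsOpen U) {φ : E d → ℂ} (h : IsCc φ) (i : Fin d) :
    weakPartial i (rL2 U φ) = rL2 U (StructuralAcoustics.pd i φ) :=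
  StructuralAcoustics.weakPartial_eq hU (h.hasWeakPartial i)

lemma tendstoH1_iff {φ : ℕ → E d → ℂ} (hφ : ∀ n, IsCc (φ n)) {f : L2 U} :
    TendstoH1 φ f ↔ Tendsto (fun n => rL2 U (φ n)) atTop (𝓝 f) ∧
      ∀ i, Tendsto (fun n => rL2 U (pd i (φ n))) atTop (𝓝 (weakPartial i f)) := by
  rw [TendstoH1, tendsto_toL2_iff fun n => (hφ n).memLp _]
  exact and_congr_right fun _ => forall_congr' fun i =>
    tendsto_toL2_iff (fun n => ((hφ n).pd i).memLp _) _

lemma hasLaplacian_of_mem_H2 {f : L2 U} (hf : f ∈ H2 U) :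
    HasLaplacian f (∑ i, weakPartial i (weakPartial i f)) := by
  intro φ hφ
  have h1 : ∀ i, ∫ x in U, pd i (pd i φ) x • f x =
      ∫ x in U, φ x • weakPartial i (weakPartial i f) x := fun i => by
    rw [hasWeakPartial_weakPartial hf.1 i _ (hφ.pd i),
      hasWeakPartial_weakPartial (hf.2 i) i φ hφ, neg_neg]
  have h2 : ∀ i, Integrable (fun x => pd i (pd i φ) x • f x) (volume.restrict U) := fun i => by
    have h3 := isCc_ofReal ((hφ.pd i).pd i).1 ((hφ.pd i).pd i).2.1
    have := (h3.memLp (volume.restrict U)).integrable_mul (Lp.memLp f)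
    exact this.congr (ae_of_all _ fun x => by simp)
  simp only [Finset.sum_smul]
  rw [integral_finsetSum _ fun i _ => h2 i, ← ip_rL2_ofReal _ hφ.1 hφ.2.1, ip_sum_left]
  refine Finset.sum_congr rfl fun i _ => ?_
  rw [h1, ip_rL2_ofReal _ hφ.1 hφ.2.1]

lemma laplacian_of_mem_H2 (hU : IsOpen U) {f : L2 U} (hf : f ∈ H2 U) :
    laplacian f = ∑ i, weakPartial i (weakPartial i f) :=
  laplacian_eq hU (hasLaplacian_of_mem_H2 hf)

/-- Weak derivatives commute. -/
lemma HasWeakPartial.comm {i j : Fin d} {f g h k : L2 U} (hj : HasWeakPartial j f g)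
    (hij : HasWeakPartial i g k) (hi : HasWeakPartial i f h) : HasWeakPartial j h k := by
  intro φ hφ
  -- Both derivatives are moved to the test function, where they commute classically.
  have hsymm : pd i (pd j φ) = pd j (pd i φ) := by
    ext x
    have hs : IsSymmSndFDerivAt ℝ φ x := (hφ.1.contDiffAt).isSymmSndFDerivAt (by simp; norm_cast)
    have hd : DifferentiableAt ℝ (fderiv ℝ φ) x :=
      ((hφ.1.fderiv_right (m := 1) (by norm_cast)).differentiable one_ne_zero) x
    have hsw : ∀ u v : E d, fderiv ℝ (fun y => fderiv ℝ φ y u) x v =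
        fderiv ℝ (fderiv ℝ φ) x v u := fun u v => by
      rw [fderiv_clm_apply hd (by fun_prop)]; simp
    exact (hsw _ _).trans ((hs _ _).trans (hsw _ _).symm)
  rw [← neg_inj, ← hi _ (hφ.pd j), hsymm, hj _ (hφ.pd i), hij φ hφ]

end WeakDerivatives

/-! ### Mollification in `L²` -/

section Mollification

variable {d : ℕ}

/-- A smooth compactly supported probability density. -/
structure IsMollifier (k : E d → ℝ) : Prop where
  smooth : ContDiff ℝ ∞ k
  compact : HasCompactSupport k
  nonneg : ∀ x, 0 ≤ k x
  integral_eq : ∫ x, k x = 1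

/-- The convolution of a function with a mollifier. -/
def mollify (k : E d → ℝ) (F : E d → ℂ) : E d → ℂ :=
  convolution k F (ContinuousLinearMap.lsmul ℝ ℝ) volume

namespace IsMollifier

variable {k : E d → ℝ} (hk : IsMollifier k) {F : E d → ℂ}
include hk

lemma isProbabilityMeasure :
    IsProbabilityMeasure ((volume : Measure (E d)).withDensity fun x => ENNReal.ofReal (k x)) := by
  refine ⟨?_⟩
  rw [withDensity_apply _ MeasurableSet.univ, Measure.restrict_univ,
    ← ofReal_integral_eq_lintegral_ofReal
      (hk.smooth.continuous.integrable_of_hasCompactSupport hk.compact)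
      (ae_of_all _ hk.nonneg), hk.integral_eq, ENNReal.ofReal_one]

/-- Mollification is a contraction on `L²`. -/
lemma eLpNorm_mollify_le (hF : StronglyMeasurable F) :
    eLpNorm (mollify k F) 2 volume ≤ eLpNorm F 2 volume := by
  set P := (volume : Measure (E d)).withDensity fun x => ENNReal.ofReal (k x)
  have hP : IsProbabilityMeasure P := hk.isProbabilityMeasure
  have hkm : Measurable fun x => ENNReal.ofReal (k x) := by
    have := hk.smooth.continuous
    fun_prop
  have hsq : ∀ {Y : Type _} [MeasurableSpace Y] (μ : Measure Y) (G : Y → ℂ),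
      eLpNorm G 2 μ ^ 2 = ∫⁻ x, ‖G x‖ₑ ^ 2 ∂μ := fun μ G => by
    have := eLpNorm_nnreal_pow_eq_lintegral (μ := μ) (f := G) (p := 2) (by norm_num)
    simpa using this
  -- The convolution is an average of translates against the probability measure `P`, so its modulus
  -- squared is at most the average of the squares. Fubini and translation invariance then give the
  -- contraction.
  have hpt : ∀ x, ‖mollify k F x‖ₑ ^ 2 ≤ ∫⁻ t, ‖F (x - t)‖ₑ ^ 2 ∂P := by
    intro x
    have hm : StronglyMeasurable fun t => F (x - t) :=
      hF.comp_measurable (measurable_const.sub measurable_id)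
    have e : mollify k F x = ∫ t, F (x - t) ∂P := by
      rw [integral_withDensity_eq_integral_toReal_smul hkm (by simp)]
      refine integral_congr_ae (ae_of_all _ fun t => ?_)
      simp [ENNReal.toReal_ofReal (hk.nonneg t)]
    rw [← hsq, e]
    gcongr
    refine (enorm_integral_le_lintegral_enorm _).trans ?_
    rw [← eLpNorm_one_eq_lintegral_enorm]
    exact eLpNorm_le_eLpNorm_of_exponent_le (by norm_num) hm.aestronglyMeasurable
  have hle : eLpNorm (mollify k F) 2 volume ^ 2 ≤ eLpNorm F 2 volume ^ 2 := by
    rw [hsq, hsq]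
    calc ∫⁻ x, ‖mollify k F x‖ₑ ^ 2 ≤ ∫⁻ x, ∫⁻ t, ‖F (x - t)‖ₑ ^ 2 ∂P := lintegral_mono hpt
      _ = ∫⁻ t, (∫⁻ x, ‖F (x - t)‖ₑ ^ 2 ∂volume) ∂P := by
          refine lintegral_lintegral_swap (μ := volume) (ν := P)
            (f := fun x t => ‖F (x - t)‖ₑ ^ 2) ?_
          have : Measurable fun p : E d × E d => F (p.1 - p.2) :=
            hF.measurable.comp (measurable_fst.sub measurable_snd)
          exact (this.enorm.pow_const 2).aemeasurable
      _ = ∫⁻ _, (∫⁻ x, ‖F x‖ₑ ^ 2 ∂volume) ∂P := by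
          refine lintegral_congr fun t => ?_
          exact lintegral_sub_right_eq_self (μ := volume) (fun x => ‖F x‖ₑ ^ 2) t
      _ = _ := by simp
  exact (ENNReal.pow_le_pow_left_iff two_ne_zero).1 hle

lemma isCc_mollify (hF : MemLp F 2 volume) (hc : HasCompactSupport F) : IsCc (mollify k F) := by
  refine ⟨?_, HasCompactSupport.convolution _ hk.compact hc⟩
  have := HasCompactSupport.contDiff_convolution_left (n := ⊤) (ContinuousLinearMap.lsmul ℝ ℝ (E := ℂ))
    hk.compact hk.smooth (hF.locallyIntegrable (by norm_num))
  exact this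

lemma mollify_sub {G : E d → ℂ} (hF : LocallyIntegrable F) (hG : LocallyIntegrable G) (x : E d) :
    mollify k (F - G) x = mollify k F x - mollify k G x := by
  have h1 := hk.compact.convolutionExists_left (ContinuousLinearMap.lsmul ℝ ℝ)
    hk.smooth.continuous hF x
  have h2 := hk.compact.convolutionExists_left (ContinuousLinearMap.lsmul ℝ ℝ)
    hk.smooth.continuous hG x
  simp only [mollify, convolution_def]
  rw [← integral_sub h1.integrable h2.integrable]
  simp [mul_sub]

/-- The derivative falls on the kernel. The right-hand side is then, up to sign, a weak derivative
of `F` tested with `z ↦ k (x - z)`. -/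
lemma pd_mollify (hF : MemLp F 2 volume) (i : Fin d) (x : E d) :
    pd i (mollify k F) x = ∫ z, pd i k (x - z) • F z := by
  have hk1 : ContDiff ℝ 1 k := hk.smooth.of_le (by norm_cast)
  have hL := hF.locallyIntegrable (by norm_num)
  have h1 := HasCompactSupport.hasFDerivAt_convolution_left (ContinuousLinearMap.lsmul ℝ ℝ)
    hk.compact hk1 hL x
  have h2 := (hk.compact.fderiv (𝕜 := ℝ)).convolutionExists_left
    (ContinuousLinearMap.precompL (E d) (ContinuousLinearMap.lsmul ℝ ℝ (E := ℂ)))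
    (hk1.continuous_fderiv one_ne_zero) hL x
  have h3 : pd i (mollify k F) x = _ := congrArg (fun L => L (EuclideanSpace.single i 1)) h1.fderiv
  rw [h3, convolution_def, ContinuousLinearMap.integral_apply h2.integrable,
    ← integral_sub_left_eq_self _ volume x]
  simp only [sub_sub_cancel]
  rfl

end IsMollifier

/-- Approximate `F` in `L²` by a continuous `g` with compact support. The contraction property
controls the mollification of `F - g`, and for `g` itself uniform continuity gives a uniform bound
supported in a fixed ball. The kernels need not be centred at the origin; it is enough that their
supports shrink to it. -/
lemma tendsto_mollify {k : ℕ → E d → ℝ} (hk : ∀ n, IsMollifier (k n)) {r : ℕ → ℝ}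
    (hr : Tendsto r atTop (𝓝 0)) (hkr : ∀ n, Function.support (k n) ⊆ Metric.ball 0 (r n))
    {F : E d → ℂ} (hFm : StronglyMeasurable F) (hF : MemLp F 2 volume) :
    Tendsto (fun n => eLpNorm (fun x => mollify (k n) F x - F x) 2 volume) atTop (𝓝 0) := by
  rw [ENNReal.tendsto_nhds_zero]
  intro ε hε
  rcases eq_or_ne ε ⊤ with rfl | hεt
  · simp
  obtain ⟨ε', hε'0, hε'⟩ : ∃ ε' : ℝ, 0 < ε' ∧ ENNReal.ofReal ε' * 3 ≤ ε := by
    refine ⟨(ε / 3).toReal, ENNReal.toReal_pos ?_ ?_, ?_⟩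
    · exact (ENNReal.div_pos hε.ne' (by norm_num)).ne'
    · exact ENNReal.div_ne_top hεt (by norm_num)
    · rw [ENNReal.ofReal_toReal (ENNReal.div_ne_top hεt (by norm_num)),
        ENNReal.div_mul_cancel (by norm_num) (by norm_num)]
  obtain ⟨g, hgc, hgs, hg⟩ := hF.exist_eLpNorm_sub_le (by norm_num) (by norm_num) hε'0
  have hgi : LocallyIntegrable g := hgs.continuous.locallyIntegrable
  have hFi := hF.locallyIntegrable (μ := volume) (by norm_num)
  -- the smooth part converges uniformly with supports in a fixed ball
  obtain ⟨R, hR⟩ := hgc.isCompact.isBounded.subset_closedBall 0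
  set B := Metric.closedBall (0 : E d) (R + 1)
  have hBfin : volume B < ⊤ := measure_closedBall_lt_top
  obtain ⟨η, hη0, hη⟩ : ∃ η : ℝ, 0 < η ∧
      ENNReal.ofReal η * volume B ^ (1 / (2 : ℝ≥0∞).toReal) ≤ ENNReal.ofReal ε' := by
    set c := (volume B ^ (1 / (2 : ℝ≥0∞).toReal)).toReal
    have hc : volume B ^ (1 / (2 : ℝ≥0∞).toReal) = ENNReal.ofReal c := by
      rw [ENNReal.ofReal_toReal]
      exact (ENNReal.rpow_lt_top_of_nonneg (by positivity) hBfin.ne).ne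
    have hc0 : 0 ≤ c := ENNReal.toReal_nonneg
    refine ⟨ε' / (c + 1), by positivity, ?_⟩
    rw [hc, ← ENNReal.ofReal_mul (by positivity)]
    refine ENNReal.ofReal_le_ofReal ?_
    rw [div_mul_eq_mul_div, div_le_iff₀ (by positivity)]
    nlinarith
  have huc := hgs.continuous.uniformContinuous_of_tendsto_cocompact (x := 0) hgc.is_zero_at_infty
  obtain ⟨δ, hδ0, hδ⟩ := Metric.uniformContinuous_iff.1 huc η hη0
  have hev : ∀ᶠ n in atTop, r n < min δ 1 := hr.eventually (gt_mem_nhds (lt_min hδ0 one_pos))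
  filter_upwards [hev] with n hn
  have hrδ : r n < δ := hn.trans_le (min_le_left _ _)
  have hr1 : r n < 1 := hn.trans_le (min_le_right _ _)
  have hsm : eLpNorm (mollify (k n) g - g) 2 volume ≤ ENNReal.ofReal ε' := by
    refine (eLpNorm_sub_le_of_dist_bdd volume (by norm_num) Metric.isClosed_closedBall.measurableSet
      hη0.le (s := B) (fun x => ?_) ?_ ?_).trans hη
    · refine dist_convolution_le hη0.le (hkr n) (hk n).nonneg (hk n).integral_eq
        hgs.continuous.aestronglyMeasurable fun y hy => (hδ ?_).le
      exact (Metric.mem_ball.1 hy).trans hrδ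
    · refine (support_convolution_subset_swap _).trans ?_
      rintro _ ⟨a, ha, b, hb, rfl⟩
      have h1 := mem_closedBall_zero_iff.1 (hR (subset_tsupport g ha))
      have h2 := mem_ball_zero_iff.1 (hkr n hb)
      exact mem_closedBall_zero_iff.2 ((norm_add_le _ _).trans (by linarith))
    · intro x hx
      have h1 := mem_closedBall_zero_iff.1 (hR (subset_tsupport g hx))
      exact mem_closedBall_zero_iff.2 (by linarith)
  have hgm : MemLp g 2 volume := hgs.continuous.memLp_of_hasCompactSupport hgc
  have hcont : ∀ {H : E d → ℂ}, LocallyIntegrable H → Continuous (mollify (k n) H) := fun hH =>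
    (hk n).compact.continuous_convolution_left _ (hk n).smooth.continuous hH
  have hdec : (fun x => mollify (k n) F x - F x) =
      mollify (k n) (F - g) + (mollify (k n) g - g) - (F - g) := by
    funext x
    simp only [Pi.sub_apply, Pi.add_apply, (hk n).mollify_sub hFi hgi]
    ring
  have m1 : AEStronglyMeasurable (mollify (k n) (F - g)) volume :=
    (hcont (hFi.sub hgi)).aestronglyMeasurable
  have m2 : AEStronglyMeasurable (mollify (k n) g - g) volume :=
    ((hcont hgi).sub hgs.continuous).aestronglyMeasurable
  have m3 : AEStronglyMeasurable (F - g) volume :=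
    hFm.aestronglyMeasurable.sub hgs.continuous.aestronglyMeasurable
  rw [hdec]
  calc _ ≤ _ := (eLpNorm_sub_le (m1.add m2) m3 (by norm_num)).trans
        (add_le_add_left (eLpNorm_add_le m1 m2 (by norm_num)) _)
    _ ≤ ENNReal.ofReal ε' + ENNReal.ofReal ε' + ENNReal.ofReal ε' := by
        gcongr
        exact ((hk n).eLpNorm_mollify_le
          (hFm.sub hgs.continuous.stronglyMeasurable)).trans hg
    _ = ENNReal.ofReal ε' * 3 := by ring
    _ ≤ ε := hε'

lemma exists_mollifier (c : E d) {r : ℝ} (hr : 0 < r) :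
    ∃ k : E d → ℝ, IsMollifier k ∧ Function.support k = Metric.ball c r ∧
      tsupport k = Metric.closedBall c r := by
  let f : ContDiffBump c := ⟨r / 2, r, by positivity, by linarith⟩
  exact ⟨f.normed volume, ⟨f.contDiff_normed, f.hasCompactSupport_normed, f.nonneg_normed,
    f.integral_normed⟩, f.support_normed_eq, f.tsupport_normed_eq⟩

end Mollification

/-! ### Density of smooth functions in `H¹` of a domain -/

section Density

variable {d : ℕ} {U : Set (E d)}

/-- Points of `U` in `V` can be moved into `U` along a direction `e`, together with a ball of
comparable radius. -/
def HasInnerCone (U V : Set (E d)) : Prop :=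
  ∃ (e : E d) (c t₀ : ℝ), ‖e‖ ≤ 1 ∧ 0 < c ∧ c ≤ 1 ∧ 0 < t₀ ∧
    ∀ x ∈ U ∩ V, ∀ t, 0 < t → t < t₀ → Metric.closedBall (x - t • e) (c * t) ⊆ U

/-- At an interior point the direction `e = 0` will do. At a boundary point `U` lies below the graph
of a locally Lipschitz function, so moving down by `t` leaves room for a ball of radius proportional
to `t`. -/
lemma HasC2Boundary.exists_innerCone (h : HasC2Boundary U) (hU : IsOpen U) {x : E d}
    (hx : x ∈ closure U) :
    ∃ V, IsOpen V ∧ Bornology.IsBounded V ∧ x ∈ V ∧ HasInnerCone U V := by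
  by_cases hxU : x ∈ U
  · obtain ⟨r, hr, hball⟩ := Metric.isOpen_iff.1 hU x hxU
    refine ⟨Metric.ball x (r / 2), Metric.isOpen_ball, Metric.isBounded_ball,
      Metric.mem_ball_self (by positivity), 0, 1, r / 2, by simp, one_pos, le_rfl, by positivity,
      fun y hy t ht0 ht y' hy' => hball ?_⟩
    have h1 := Metric.mem_ball.1 hy.2
    have h2 := Metric.mem_closedBall.1 hy'
    rw [smul_zero, sub_zero, one_mul] at h2
    refine Metric.mem_ball.2 ((dist_triangle _ y _).trans_lt (by linarith))
  · have hxf : x ∈ frontier U := by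
      rw [closure_eq_self_union_frontier] at hx; exact hx.resolve_left hxU
    obtain ⟨V, e, g, hxV, hV⟩ := h.exists_chart hxf
    obtain ⟨L, s, hs, hL⟩ := (hV.contDiff.contDiffAt (x := x)).exists_lipschitzOnWith
    obtain ⟨r, hr, hball⟩ := Metric.mem_nhds_iff.1 (inter_mem hs (hV.isOpen.mem_nhds hxV))
    -- The shift lowers the height by `t`; within the ball the height may rise by `c t` and the
    -- graph may drop by `L c t`. This choice gives `c (1 + L) < 1`.
    set c : ℝ := 1 / (2 + L)
    have hL0 : (0 : ℝ) ≤ L := L.2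
    have hc0 : 0 < c := by positivity
    have hc1 : c ≤ 1 := by
      rw [div_le_one (by positivity)]; linarith
    have hcL : c * (1 + L) < 1 := by
      simp only [c]; rw [one_div, inv_mul_lt_iff₀ (by positivity)]; linarith
    refine ⟨Metric.ball x (r / 4), Metric.isOpen_ball, Metric.isBounded_ball,
      Metric.mem_ball_self (by positivity), e, c, r / 4, hV.norm_eq.le, hc0, hc1, by positivity,
      fun y hy t ht0 ht z hz => ?_⟩
    have h1 := Metric.mem_ball.1 hy.2
    have h2 := Metric.mem_closedBall.1 hz
    have hct : c * t ≤ t := mul_le_of_le_one_left ht0.le hc1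
    have h3 : dist (y - t • e) x < r := by
      have : dist (y - t • e) y = t := by
        rw [dist_eq_norm, sub_sub_cancel_left, norm_neg, norm_smul, hV.norm_eq,
          Real.norm_of_nonneg ht0.le, mul_one]
      exact (dist_triangle _ y _).trans_lt (by linarith)
    have h4 : dist z x < r := by
      have : dist (y - t • e) y = t := by
        rw [dist_eq_norm, sub_sub_cancel_left, norm_neg, norm_smul, hV.norm_eq,
          Real.norm_of_nonneg ht0.le, mul_one]
      have h5 := dist_triangle z (y - t • e) x
      have h6 := dist_triangle (y - t • e) y x
      linarith
    have hzV := hball (Metric.mem_ball.2 h4)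
    have hyV : y ∈ V := (hball (Metric.mem_ball.2 (by linarith))).2
    have hyU := (hV.mem_iff y hyV).1 hy.1
    rw [hV.mem_iff z hzV.2]
    have h7 := hL.dist_le_mul z hzV.1 _ (hball (Metric.mem_ball.2 h3)).1
    rw [sub_eq_add_neg, ← neg_smul, hV.invariant] at h7
    have h8 : inner ℝ z e ≤ inner ℝ y e - t + c * t := by
      have h9 : inner ℝ z e = inner ℝ (z - (y - t • e)) e + (inner ℝ y e - t) := by
        rw [inner_sub_left, inner_sub_left, inner_smul_left, hV.inner_self]; simp
      have h10 := real_inner_le_norm (z - (y - t • e)) e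
      rw [hV.norm_eq, mul_one, ← dist_eq_norm] at h10
      linarith
    have h11 : g y - g z ≤ L * (c * t) := by
      have h12 : g y - g z ≤ dist (g z) (g y) := by
        rw [dist_comm, Real.dist_eq]; exact le_abs_self _
      refine h12.trans (h7.trans ?_)
      rw [neg_smul, ← sub_eq_add_neg]
      gcongr
    nlinarith

/-- Approximation of functions supported in a set with the inner cone property. -/
lemma HasInnerCone.exists_approx (hU : IsOpen U) {V : Set (E d)}
    (h : HasInnerCone U V) (hVo : IsOpen V) {K : Set (E d)} (hK : IsCompact K) (hKV : K ⊆ V)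
    {F : E d → ℂ} {G : Fin d → E d → ℂ} (hFm : StronglyMeasurable F)
    (hGm : ∀ i, StronglyMeasurable (G i)) (hF : MemLp F 2 volume) (hG : ∀ i, MemLp (G i) 2 volume)
    (hF0 : ∀ x, x ∉ U ∩ K → F x = 0) (hG0 : ∀ i x, x ∉ U ∩ K → G i x = 0)
    (hw : ∀ i (φ : E d → ℝ), IsTest U φ → ∫ x, pd i φ x • F x = -∫ x, φ x • G i x) :
    ∃ φ : ℕ → E d → ℂ, (∀ n, IsCc (φ n)) ∧
      Tendsto (fun n => eLpNorm (fun x => φ n x - F x) 2 (volume.restrict U)) atTop (𝓝 0) ∧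
      ∀ i, Tendsto (fun n => eLpNorm (fun x => pd i (φ n) x - G i x) 2 (volume.restrict U))
        atTop (𝓝 0) := by
  obtain ⟨e, c, t₀, he, hc0, hc1, ht₀, hcone⟩ := h
  obtain ⟨δ, hδ0, hδ⟩ := hK.exists_thickening_subset_open hVo hKV
  -- The kernels reach at most `2 t < δ`, so at points outside `V` the mollification does not see
  -- `K`.
  set t₁ := min t₀ (δ / 2)
  have ht₁ : 0 < t₁ := lt_min ht₀ (by positivity)
  let t : ℕ → ℝ := fun n => t₁ / 2 / (n + 1)
  have ht0 : ∀ n, 0 < t n := fun n => by positivity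
  have htlt : ∀ n, t n < t₁ := fun n => by
    have : t₁ / 2 / (n + 1) ≤ t₁ / 2 := div_le_self (by positivity) (by norm_cast; omega)
    exact this.trans_lt (by linarith)
  have htt : Tendsto t atTop (𝓝 0) := by
    have := (tendsto_one_div_add_atTop_nhds_zero_nat (𝕜 := ℝ)).const_mul (t₁ / 2)
    simpa [t, div_eq_mul_inv] using this
  -- The kernel is centred at `t n • e` with radius `c * t n`: the mollification at `x` only uses
  -- values on the ball about `x - t n • e`, which lies in `U` when `x ∈ U ∩ V`.
  choose k hk hks hkts using fun n => exists_mollifier (t n • e) (mul_pos hc0 (ht0 n))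
  have hFc : HasCompactSupport F := HasCompactSupport.of_support_subset_isCompact hK fun x hx => by
    by_contra hxK
    exact hx (hF0 x fun h' => hxK h'.2)
  have hr : Tendsto (fun n => 2 * t n) atTop (𝓝 0) := by simpa using htt.const_mul 2
  have hkr : ∀ n, Function.support (k n) ⊆ Metric.ball 0 (2 * t n) := fun n x hx => by
    rw [hks n] at hx
    have h1 := mem_ball_iff_norm.1 hx
    have h2 : ‖t n • e‖ ≤ t n := by
      rw [norm_smul, Real.norm_of_nonneg (ht0 n).le]
      exact mul_le_of_le_one_right (ht0 n).le he
    have h3 : c * t n ≤ t n := mul_le_of_le_one_left (ht0 n).le hc1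
    have h4 := norm_add_le (x - t n • e) (t n • e)
    rw [sub_add_cancel] at h4
    exact mem_ball_zero_iff.2 (by linarith)
  -- For `x ∈ V` the reflected kernel is a test function in `U`, so the derivative passes to `G i`,
  -- although `F` may jump across the boundary. For `x ∉ V` both sides are zero.
  have hpd : ∀ n i, ∀ x ∈ U, pd i (mollify (k n) F) x = mollify (k n) (G i) x := by
    intro n i x hx
    rw [(hk n).pd_mollify hF, mollify, convolution_lsmul_swap]
    have hk1 : ContDiff ℝ 1 (k n) := (hk n).smooth.of_le (by norm_cast)
    set φ : E d → ℝ := fun z => k n (x - z)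
    have hφpd : ∀ z, pd i φ z = -pd i (k n) (x - z) := fun z => by
      have h1 : HasFDerivAt φ ((fderiv ℝ (k n) (x - z)).comp (-ContinuousLinearMap.id ℝ (E d))) z :=
        (hk1.differentiable one_ne_zero _).hasFDerivAt.comp z ((hasFDerivAt_id z).const_sub x)
      simp only [pd]
      rw [h1.fderiv]; simp
    have hsupp : tsupport φ ⊆ Metric.closedBall (x - t n • e) (c * t n) := by
      refine closure_minimal (fun z hz => ?_) Metric.isClosed_closedBall
      have hz' : x - z ∈ Function.support (k n) := hz
      rw [hks n, Metric.mem_ball, dist_eq_norm] at hz'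
      rw [Metric.mem_closedBall, dist_comm, dist_eq_norm]
      refine le_trans (le_of_eq ?_) hz'.le
      congr 1; abel
    have hφcs : HasCompactSupport φ :=
      HasCompactSupport.of_support_subset_isCompact (isCompact_closedBall _ _)
        ((subset_tsupport _).trans hsupp)
    by_cases hxV : x ∈ V
    · have htest : IsTest U φ := ⟨(hk n).smooth.comp (contDiff_const.sub contDiff_id), hφcs,
        hsupp.trans (hcone x ⟨hx, hxV⟩ _ (ht0 n) ((htlt n).trans_le (min_le_left _ _)))⟩
      have h1 := hw i φ htest
      simp only [hφpd, neg_smul, integral_neg, neg_inj] at h1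
      exact h1
    · have hdisj : ∀ z, z ∈ tsupport φ → z ∉ U ∩ K := by
        intro z hz hzK
        apply hxV
        apply hδ
        refine Metric.mem_thickening_iff.2 ⟨z, hzK.2, ?_⟩
        have h1 := Metric.mem_closedBall.1 (hsupp hz)
        have h2 : dist (x - t n • e) x ≤ t n := by
          rw [dist_eq_norm, sub_sub_cancel_left, norm_neg, norm_smul,
            Real.norm_of_nonneg (ht0 n).le]
          exact mul_le_of_le_one_right (ht0 n).le he
        have h3 : c * t n ≤ t n := mul_le_of_le_one_left (ht0 n).le hc1
        have h4 : t n < δ / 2 := (htlt n).trans_le (min_le_right _ _)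
        rw [dist_comm]
        exact (dist_triangle _ (x - t n • e) _).trans_lt (by linarith)
      have e1 : ∀ z, pd i (k n) (x - z) • F z = 0 := fun z => by
        by_cases hz : z ∈ tsupport φ
        · rw [hF0 z (hdisj z hz), smul_zero]
        · have : pd i φ z = 0 := by
            have hz2 : z ∉ tsupport (fderiv ℝ φ) := fun h' => hz (tsupport_fderiv_subset ℝ h')
            simp only [pd, image_eq_zero_of_notMem_tsupport hz2]; rfl
          rw [hφpd, neg_eq_zero] at this
          rw [this, zero_smul]
      have e2 : ∀ z, k n (x - z) • G i z = 0 := fun z => by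
        by_cases hz : z ∈ tsupport φ
        · rw [hG0 i z (hdisj z hz), smul_zero]
        · have : φ z = 0 := image_eq_zero_of_notMem_tsupport hz
          rw [show k n (x - z) = φ z from rfl, this, zero_smul]
      simp only [e1, e2, integral_zero]
  have hrest : ∀ {H : ℕ → E d → ℂ}, Tendsto (fun n => eLpNorm (H n) 2 volume) atTop (𝓝 0) →
      Tendsto (fun n => eLpNorm (H n) 2 (volume.restrict U)) atTop (𝓝 0) := fun hH =>
    tendsto_of_tendsto_of_tendsto_of_le_of_le tendsto_const_nhds hH (fun _ => zero_le)
      fun n => eLpNorm_mono_measure _ Measure.restrict_le_self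
  refine ⟨fun n => mollify (k n) F, fun n => (hk n).isCc_mollify hF hFc,
    hrest (tendsto_mollify hk hr hkr hFm hF), fun i => ?_⟩
  refine (hrest (tendsto_mollify hk hr hkr (hGm i) (hG i))).congr fun n => ?_
  refine eLpNorm_congr_ae ?_
  filter_upwards [ae_restrict_mem hU.measurableSet] with x hx
  rw [hpd n i x hx]

/-- `f` is a limit in `H¹(U)` of smooth functions. -/
def IsH1Limit (f : L2 U) : Prop :=
  f ∈ H1 U ∧ ∃ φ : ℕ → E d → ℂ, (∀ n, IsCc (φ n)) ∧ TendstoH1 φ f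

lemma isCc_zero : IsCc fun _ : E d => (0 : ℂ) := ⟨contDiff_const, HasCompactSupport.zero⟩

lemma isH1Limit_zero (hU : IsOpen U) : IsH1Limit (0 : L2 U) := by
  refine ⟨(H1sub U).zero_mem, fun _ _ => 0, fun _ => isCc_zero, ?_⟩
  have h0 : rL2 U (fun _ => 0) = 0 := toL2_zero
  rw [tendstoH1_iff fun _ => isCc_zero, h0]
  refine ⟨tendsto_const_nhds, fun i => ?_⟩
  rw [← h0, isCc_zero.weakPartial_eq hU]
  exact tendsto_const_nhds

lemma IsH1Limit.add (hU : IsOpen U) {f g : L2 U} (hf : IsH1Limit f) (hg : IsH1Limit g) :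
    IsH1Limit (f + g) := by
  obtain ⟨hf1, φ, hφ, hφf⟩ := hf
  obtain ⟨hg1, ψ, hψ, hψg⟩ := hg
  rw [tendstoH1_iff hφ] at hφf
  rw [tendstoH1_iff hψ] at hψg
  refine ⟨(H1sub U).add_mem hf1 hg1, fun n x => φ n x + ψ n x, fun n => (hφ n).add (hψ n), ?_⟩
  rw [tendstoH1_iff fun n => (hφ n).add (hψ n)]
  refine ⟨(hφf.1.add hψg.1).congr fun n => ?_, fun i => ?_⟩
  · rw [rL2, rL2, rL2, toL2_add ((hφ n).memLp _) ((hψ n).memLp _)]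
  · rw [weakPartial_add hU hf1 hg1]
    refine ((hφf.2 i).add (hψg.2 i)).congr fun n => ?_
    rw [rL2, rL2, rL2, (hφ n).pd_add (hψ n),
      toL2_add (((hφ n).pd i).memLp _) (((hψ n).pd i).memLp _)]

lemma toL2_sum {X ι : Type*} [MeasurableSpace X] {μ : Measure X} (s : Finset ι) {φ : ι → X → ℂ}
    (hφ : ∀ j, MemLp (φ j) 2 μ) : toL2 μ (fun x => ∑ j ∈ s, φ j x) = ∑ j ∈ s, toL2 μ (φ j) := by
  classical
  induction s using Finset.induction_on with
  | empty => simpa using toL2_zero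
  | insert a s ha ih =>
    simp only [Finset.sum_insert ha]
    rw [toL2_add (hφ a) (memLp_finsetSum s fun j _ => hφ j), ih]

/-- Smooth functions are dense in `H¹` of a bounded domain with `C²` boundary. -/
theorem HasC2Boundary.exists_tendstoH1 (h : HasC2Boundary U) (hU : IsOpen U)
    (hb : Bornology.IsBounded U) {f : L2 U} (hf : f ∈ H1 U) :
    ∃ φ : ℕ → E d → ℂ, (∀ n, IsCc (φ n)) ∧ TendstoH1 φ f := by
  obtain ⟨n, V, χ, hV, hχs, hχc, hχV, -, hχ1⟩ := exists_partition hb.isCompact_closure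
    (p := fun V => IsOpen V ∧ HasInnerCone U V) (fun x hx => by
      obtain ⟨V, h1, h2, h3, h4⟩ := h.exists_innerCone hU hx
      exact ⟨V, h1, h2, h3, h1, h4⟩)
  set g : Fin d → L2 U := fun i => weakPartial i f
  have hχcc : ∀ j, IsCc fun x => (χ j x : ℂ) := fun j => isCc_ofReal (hχs j) (hχc j)
  have hχd : ∀ j, Differentiable ℝ (χ j) := fun j => (hχs j).differentiable (by simp)
  have hbdd : ∀ {ψ : E d → ℝ} (_ : Continuous ψ) (_ : HasCompactSupport ψ) (u : L2 U),
      MemLp (fun x => ψ x • u x) 2 (volume.restrict U) := by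
    intro ψ hψ hψc u
    obtain ⟨B, hB⟩ := hψc.exists_bound_of_continuous hψ
    refine MemLp.of_le_mul (c := B) (Lp.memLp u)
      (hψ.aestronglyMeasurable.smul (Lp.aestronglyMeasurable u)) (ae_of_all _ fun x => ?_)
    rw [norm_smul]
    exact mul_le_mul_of_nonneg_right (hB x) (norm_nonneg _)
  -- the pieces
  set F : Fin n → E d → ℂ := fun j => U.indicator fun x => χ j x • f x
  set G : Fin n → Fin d → E d → ℂ := fun j i =>
    U.indicator fun x => χ j x • g i x + pd i (χ j) x • f x
  have hpdc : ∀ j i, Continuous (pd i (χ j)) := fun j i =>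
    ((((hχs j).of_le (m := 1) (by norm_cast)).continuous_fderiv
      one_ne_zero).clm_apply continuous_const)
  have hpdcs : ∀ j i, HasCompactSupport (pd i (χ j)) := fun j i =>
    (hχc j).fderiv_apply (𝕜 := ℝ) _
  have hFr : ∀ j, MemLp (fun x => χ j x • f x) 2 (volume.restrict U) := fun j =>
    hbdd (hχs j).continuous (hχc j) f
  have hGr : ∀ j i, MemLp (fun x => χ j x • g i x + pd i (χ j) x • f x) 2 (volume.restrict U) :=
    fun j i => (hbdd (hχs j).continuous (hχc j) (g i)).add (hbdd (hpdc j i) (hpdcs j i) f)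
  have hint : ∀ {ψ : E d → ℝ} (_ : Continuous ψ) (_ : HasCompactSupport ψ) (u : L2 U),
      Integrable (fun x => ψ x • u x) (volume.restrict U) := by
    intro ψ hψ hψc u
    have h1 : MemLp (fun x => (ψ x : ℂ)) 2 (volume.restrict U) :=
      (Complex.continuous_ofReal.comp hψ).memLp_of_hasCompactSupport
        (hψc.comp_left (g := Complex.ofReal) (by simp))
    exact (h1.integrable_mul (Lp.memLp u)).congr (ae_of_all _ fun x => by simp)
  -- The Leibniz rule for `χ j • f`. The zero extensions satisfy it only against test functions
  -- supported in `U`, since a jump at the boundary is allowed.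
  have hw : ∀ j i (φ : E d → ℝ), IsTest U φ →
      ∫ x, pd i φ x • F j x = -∫ x, φ x • G j i x := by
    intro j i φ hφ
    have e1 : ∀ x, pd i φ x • F j x = U.indicator (fun x => (pd i φ x * χ j x) • f x) x := by
      intro x
      by_cases hx : x ∈ U <;> simp [F, hx, mul_assoc]
    have e2 : ∀ x, φ x • G j i x =
        U.indicator (fun x => (φ x * χ j x) • g i x + (φ x * pd i (χ j) x) • f x) x := by
      intro x
      by_cases hx : x ∈ U <;> simp [G, hx, mul_assoc]
    simp only [e1, e2]
    rw [integral_indicator hU.measurableSet, integral_indicator hU.measurableSet]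
    have hprod : IsTest U fun x => φ x * χ j x := by
      refine ⟨hφ.1.mul (hχs j), hφ.2.1.mul_right, (closure_mono ?_).trans hφ.2.2⟩
      intro x hx hx'
      exact hx (by simp [hx'])
    have h1 := hasWeakPartial_weakPartial hf i _ hprod
    have hpdp : ∀ x, pd i (fun x => φ x * χ j x) x = pd i φ x * χ j x + φ x * pd i (χ j) x := by
      intro x
      simp only [pd]
      rw [fderiv_fun_mul (hφ.1.differentiable (by simp) x) (hχd j x)]
      simp; ring
    simp only [hpdp, add_smul] at h1
    have i1 : Integrable (fun x => (pd i φ x * χ j x) • f x) (volume.restrict U) :=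
      hint ((hφ.pd i).1.continuous.mul (hχs j).continuous) (hφ.pd i).2.1.mul_right f
    have i2 : Integrable (fun x => (φ x * pd i (χ j) x) • f x) (volume.restrict U) :=
      hint (hφ.1.continuous.mul (hpdc j i)) hφ.2.1.mul_right f
    have i3 : Integrable (fun x => (φ x * χ j x) • g i x) (volume.restrict U) :=
      hint (hφ.1.continuous.mul (hχs j).continuous) hφ.2.1.mul_right (g i)
    rw [integral_add i1 i2] at h1
    rw [integral_add i3 i2, neg_add, ← h1]
    ring
  have hsm : ∀ u : L2 U, StronglyMeasurable u := fun u => Lp.stronglyMeasurable u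
  have happ : ∀ j, IsH1Limit (rL2 U fun x => χ j x • f x) := by
    intro j
    have hz : ∀ x, x ∉ tsupport (χ j) → χ j x = 0 := fun x hx => image_eq_zero_of_notMem_tsupport hx
    obtain ⟨φ, hφ, h1, h2⟩ := (hV j).2.exists_approx (F := F j) (G := G j) hU (hV j).1
      (hχc j).isCompact (hχV j)
      (((hχs j).continuous.stronglyMeasurable.smul (hsm f)).indicator hU.measurableSet)
      (fun i => (((hχs j).continuous.stronglyMeasurable.smul (hsm (g i))).add
        ((hpdc j i).stronglyMeasurable.smul (hsm f))).indicator hU.measurableSet)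
      ((memLp_indicator_iff_restrict hU.measurableSet).2 (hFr j))
      (fun i => (memLp_indicator_iff_restrict hU.measurableSet).2 (hGr j i))
      (fun x hx => by
        by_cases hxU : x ∈ U
        · simp [F, hxU, hz x fun h' => hx ⟨hxU, h'⟩]
        · simp [F, hxU])
      (fun i x hx => by
        by_cases hxU : x ∈ U
        · have hx' : x ∉ tsupport (χ j) := fun h' => hx ⟨hxU, h'⟩
          have hx2 : x ∉ tsupport (fderiv ℝ (χ j)) := fun h' => hx' (tsupport_fderiv_subset ℝ h')
          have : pd i (χ j) x = 0 := by
            simp only [pd, image_eq_zero_of_notMem_tsupport hx2]; rfl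
          simp [G, hxU, hz x hx', this]
        · simp [G, hxU])
      (hw j)
    have hFe : F j =ᵐ[volume.restrict U] rL2 U fun x => χ j x • f x := by
      filter_upwards [coeFn_toL2 (hFr j), ae_restrict_mem hU.measurableSet] with x hx hxU
      rw [hx]; simp [F, hxU]
    have hGe : ∀ i, G j i =ᵐ[volume.restrict U]
        rL2 U fun x => χ j x • g i x + pd i (χ j) x • f x := fun i => by
      filter_upwards [coeFn_toL2 (hGr j i), ae_restrict_mem hU.measurableSet] with x hx hxU
      rw [hx]; simp [G, hxU]
    have hwp : ∀ i, HasWeakPartial i (rL2 U fun x => χ j x • f x)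
        (rL2 U fun x => χ j x • g i x + pd i (χ j) x • f x) := fun i ψ hψ => by
      have h3 := hw j i ψ hψ
      have aux : ∀ (a : E d → ℝ) (H : E d → ℂ), (∀ x ∉ U, H x = 0) →
          ∫ x, a x • H x = ∫ x in U, a x • H x := fun a H hH =>
        (setIntegral_eq_integral_of_forall_compl_eq_zero fun x hx => by rw [hH x hx, smul_zero]).symm
      rw [aux _ _ fun x hx => by simp [F, hx], aux _ _ fun x hx => by simp [G, hx]] at h3
      have a1 : ∫ x in U, pd i ψ x • (rL2 U fun x => χ j x • f x) x = ∫ x in U, pd i ψ x • F j x :=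
        integral_congr_ae (hFe.symm.mono fun x hx => by simp only [hx])
      have a2 : ∫ x in U, ψ x • (rL2 U fun x => χ j x • g i x + pd i (χ j) x • f x) x =
          ∫ x in U, ψ x • G j i x :=
        integral_congr_ae ((hGe i).symm.mono fun x hx => by simp only [hx])
      rw [a1, a2]
      exact h3
    refine ⟨fun i => ⟨_, hwp i⟩, φ, hφ, h1.congr fun m => eLpNorm_congr_ae (hFe.mono fun x hx => by simp only [hx]), fun i => ?_⟩
    rw [weakPartial_eq hU (hwp i)]
    exact (h2 i).congr fun m => eLpNorm_congr_ae ((hGe i).mono fun x hx => by simp only [hx])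
  have hsum : f = ∑ j, rL2 U fun x => χ j x • f x := by
    rw [← toL2_sum _ fun j => hFr j]
    conv_lhs => rw [← toL2_coeFn f]
    refine toL2_congr ?_
    filter_upwards [ae_restrict_mem hU.measurableSet] with x hx
    rw [← Finset.sum_smul, hχ1 x (subset_closure hx), one_smul]
  have : IsH1Limit f := by
    rw [hsum]
    exact Finset.sum_induction _ IsH1Limit (fun _ _ h1 h2 => h1.add hU h2) (isH1Limit_zero hU)
      fun j _ => happ j
  exact this.2

end Density

/-! ### Traces -/

section Trace

variable {d : ℕ} {U : Set (E d)}

/-- Bounded open sets with `C²` boundary. -/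
structure IsC2Domain (U : Set (E d)) : Prop where
  isOpen : IsOpen U
  bounded : Bornology.IsBounded U
  c2 : HasC2Boundary U

/-- The class in `L²(∂U)` of a function on the whole space. -/
abbrev bL2 (U : Set (E d)) (φ : E d → ℂ) : L2Bdry U := toL2 (surfaceMeasure U) φ

/-- The restriction of a smooth function to `U` and those of its partial derivatives. -/
def jet (U : Set (E d)) (φ : E d → ℂ) : L2 U × (Fin d → L2 U) := (rL2 U φ, fun i => rL2 U (pd i φ))

/-- A function and its weak partial derivatives. -/
def wjet (f : L2 U) : L2 U × (Fin d → L2 U) := (f, fun i => weakPartial i f)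

lemma jet_sub {φ ψ : E d → ℂ} (hφ : IsCc φ) (hψ : IsCc ψ) :
    jet U (fun x => φ x - ψ x) = jet U φ - jet U ψ := by
  refine Prod.ext (toL2_sub (hφ.memLp _) (hψ.memLp _)) (funext fun i => ?_)
  simp only [jet, hφ.pd_sub hψ, Prod.snd_sub, Pi.sub_apply]
  exact toL2_sub ((hφ.pd i).memLp _) ((hψ.pd i).memLp _)

lemma wjet_rL2 (hU : IsOpen U) {φ : E d → ℂ} (hφ : IsCc φ) : wjet (rL2 U φ) = jet U φ :=
  Prod.ext rfl (funext fun i => hφ.weakPartial_eq hU i)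

lemma tendstoH1_iff_jet {φ : ℕ → E d → ℂ} (hφ : ∀ n, IsCc (φ n)) {f : L2 U} :
    TendstoH1 φ f ↔ Tendsto (fun n => jet U (φ n)) atTop (𝓝 (wjet f)) := by
  rw [tendstoH1_iff hφ, Prod.tendsto_iff, tendsto_pi_nhds]
  rfl

lemma wjet_add (hU : IsOpen U) {f g : L2 U} (hf : f ∈ H1 U) (hg : g ∈ H1 U) :
    wjet (f + g) = wjet f + wjet g :=
  Prod.ext rfl (funext fun i => weakPartial_add hU hf hg i)

lemma wjet_smul (hU : IsOpen U) {f : L2 U} (hf : f ∈ H1 U) (c : ℂ) :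
    wjet (c • f) = c • wjet f :=
  Prod.ext rfl (funext fun i => weakPartial_smul hU hf c i)

namespace IsC2Domain

variable (h : IsC2Domain U)
include h

lemma memLp {φ : E d → ℂ} (hφ : IsCc φ) : MemLp φ 2 (surfaceMeasure U) := by
  have := h.c2.isFiniteMeasure h.bounded
  exact hφ.memLp _

/-- The trace inequality rewritten for the maximum norm of the jet, which dominates each of the `1 +
d` terms. -/
lemma exists_bound_jet : ∃ K : ℝ, 0 ≤ K ∧ ∀ φ : E d → ℂ, IsCc φ → ‖bL2 U φ‖ ≤ K * ‖jet U φ‖ := by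
  obtain ⟨C, hC, hb⟩ := h.c2.exists_trace_bound h.isOpen h.bounded
  refine ⟨√(C * (1 + d)), Real.sqrt_nonneg _, fun φ hφ => ?_⟩
  refine le_of_sq_le_sq ?_ (by positivity)
  rw [mul_pow, Real.sq_sqrt (by positivity), norm_toL2_sq (h.memLp hφ)]
  refine (hb φ hφ.contDiff_one hφ.compact).trans ?_
  rw [mul_assoc]
  refine mul_le_mul_of_nonneg_left ?_ hC
  rw [← norm_toL2_sq (hφ.memLp _)]
  have h1 : ‖rL2 U φ‖ ≤ ‖jet U φ‖ := norm_fst_le (jet U φ)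
  have h2 : ∀ i, ∫ x in U, ‖pd i φ x‖ ^ 2 ≤ ‖jet U φ‖ ^ 2 := fun i => by
    rw [← norm_toL2_sq ((hφ.pd i).memLp _)]
    have : ‖rL2 U (pd i φ)‖ ≤ ‖jet U φ‖ :=
      (norm_le_pi_norm (jet U φ).2 i).trans (norm_snd_le (jet U φ))
    gcongr
  calc _ ≤ ‖jet U φ‖ ^ 2 + ∑ _i : Fin d, ‖jet U φ‖ ^ 2 := by
        gcongr with i
        exact h2 i
    _ = _ := by simp; ring

lemma bL2_sub {φ ψ : E d → ℂ} (hφ : IsCc φ) (hψ : IsCc ψ) :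
    bL2 U (fun x => φ x - ψ x) = bL2 U φ - bL2 U ψ := toL2_sub (h.memLp hφ) (h.memLp hψ)

lemma isTrace_iff {f : L2 U} {t : L2Bdry U} : IsTrace f t ↔ f ∈ H1 U ∧ ∃ φ : ℕ → E d → ℂ,
    (∀ n, IsCc (φ n)) ∧ Tendsto (fun n => jet U (φ n)) atTop (𝓝 (wjet f)) ∧
      Tendsto (fun n => bL2 U (φ n)) atTop (𝓝 t) := by
  refine and_congr_right fun _ => exists_congr fun φ => ?_
  constructor
  · rintro ⟨h1, h2, h3⟩
    have h1' : ∀ n, IsCc (φ n) := fun n => ⟨(h1 n).1, (h1 n).2⟩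
    exact ⟨h1', (tendstoH1_iff_jet h1').1 h2, (tendsto_toL2_iff (fun n => h.memLp (h1' n)) t).1 h3⟩
  · rintro ⟨h1, h2, h3⟩
    exact ⟨fun n => ⟨(h1 n).1, (h1 n).2⟩, (tendstoH1_iff_jet h1).2 h2,
      (tendsto_toL2_iff (fun n => h.memLp (h1 n)) t).2 h3⟩

/-- The difference of two approximating sequences tends to zero in `H¹`, so by the trace bound its
boundary values tend to zero as well. -/
lemma isTrace_unique {f : L2 U} {t s : L2Bdry U} (ht : IsTrace f t) (hs : IsTrace f s) : s = t := by
  obtain ⟨K, hK, hb⟩ := h.exists_bound_jet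
  obtain ⟨-, φ, hφ, h1, h2⟩ := h.isTrace_iff.1 ht
  obtain ⟨-, ψ, hψ, h3, h4⟩ := h.isTrace_iff.1 hs
  have h5 := (h3.sub h1).norm.const_mul K
  rw [sub_self, norm_zero, mul_zero] at h5
  have h6 := le_of_tendsto_of_tendsto' (h4.sub h2).norm h5 fun n => by
    rw [← jet_sub (hψ n) (hφ n), ← h.bL2_sub (hψ n) (hφ n)]
    exact hb _ ((hψ n).sub (hφ n))
  exact sub_eq_zero.1 (norm_le_zero_iff.1 h6)

lemma trace_eq {f : L2 U} {t : L2Bdry U} (ht : IsTrace f t) : trace f = t :=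
  theObj_eq ht fun _ hs => h.isTrace_unique ht hs

/-- Any approximating sequence computes the trace: the trace bound makes its boundary values Cauchy.
For `H¹₀` this permits a sequence of test functions, whose boundary values vanish. -/
lemma tendsto_bL2 {f : L2 U} (hf : f ∈ H1 U) {φ : ℕ → E d → ℂ} (hφ : ∀ n, IsCc (φ n))
    (hl : Tendsto (fun n => jet U (φ n)) atTop (𝓝 (wjet f))) :
    Tendsto (fun n => bL2 U (φ n)) atTop (𝓝 (trace f)) := by
  obtain ⟨K, hK, hb⟩ := h.exists_bound_jet
  have hc : CauchySeq fun n => bL2 U (φ n) := by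
    have hu := hl.cauchySeq
    rw [Metric.cauchySeq_iff] at hu ⊢
    intro ε hε
    obtain ⟨N, hN⟩ := hu (ε / (K + 1)) (by positivity)
    refine ⟨N, fun m hm n hn => ?_⟩
    have h1 := hN m hm n hn
    rw [dist_eq_norm, ← jet_sub (hφ m) (hφ n), lt_div_iff₀ (by positivity)] at h1
    rw [dist_eq_norm, ← h.bL2_sub (hφ m) (hφ n)]
    refine (hb _ ((hφ m).sub (hφ n))).trans_lt (lt_of_le_of_lt ?_ h1)
    nlinarith [norm_nonneg (jet U fun x => φ m x - φ n x)]
  obtain ⟨t, ht⟩ := cauchySeq_tendsto_of_complete hc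
  rwa [h.trace_eq (h.isTrace_iff.2 ⟨hf, φ, hφ, hl, ht⟩)]

lemma exists_seq {f : L2 U} (hf : f ∈ H1 U) : ∃ φ : ℕ → E d → ℂ, (∀ n, IsCc (φ n)) ∧
    Tendsto (fun n => jet U (φ n)) atTop (𝓝 (wjet f)) ∧
      Tendsto (fun n => bL2 U (φ n)) atTop (𝓝 (trace f)) := by
  obtain ⟨φ, hφ, h1⟩ := h.c2.exists_tendstoH1 h.isOpen h.bounded hf
  rw [tendstoH1_iff_jet hφ] at h1
  exact ⟨φ, hφ, h1, h.tendsto_bL2 hf hφ h1⟩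

lemma trace_rL2 {φ : E d → ℂ} (hφ : IsCc φ) : trace (rL2 U φ) = bL2 U φ :=
  tendsto_nhds_unique (h.tendsto_bL2 (φ := fun _ => φ) hφ.mem_H1 (fun _ => hφ)
    (by rw [wjet_rL2 h.isOpen hφ]; exact tendsto_const_nhds)) tendsto_const_nhds

lemma trace_add {f g : L2 U} (hf : f ∈ H1 U) (hg : g ∈ H1 U) :
    trace (f + g) = trace f + trace g := by
  obtain ⟨φ, hφ, h1, h2⟩ := h.exists_seq hf
  obtain ⟨ψ, hψ, h3, h4⟩ := h.exists_seq hg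
  refine h.trace_eq (h.isTrace_iff.2 ⟨(H1sub U).add_mem hf hg, fun n x => φ n x + ψ n x,
    fun n => (hφ n).add (hψ n), ?_, ?_⟩)
  · rw [wjet_add h.isOpen hf hg]
    refine (h1.add h3).congr fun n => ?_
    refine Prod.ext (toL2_add ((hφ n).memLp _) ((hψ n).memLp _)).symm (funext fun i => ?_)
    simp only [jet, (hφ n).pd_add (hψ n), Prod.snd_add, Pi.add_apply]
    exact (toL2_add (((hφ n).pd i).memLp _) (((hψ n).pd i).memLp _)).symm
  · exact (h2.add h4).congr fun n => (toL2_add (h.memLp (hφ n)) (h.memLp (hψ n))).symm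

lemma trace_smul {f : L2 U} (hf : f ∈ H1 U) (c : ℂ) : trace (c • f) = c • trace f := by
  obtain ⟨φ, hφ, h1, h2⟩ := h.exists_seq hf
  refine h.trace_eq (h.isTrace_iff.2 ⟨(H1sub U).smul_mem c hf, fun n x => c * φ n x,
    fun n => (hφ n).const_mul c, ?_, ?_⟩)
  · rw [wjet_smul h.isOpen hf]
    refine (h1.const_smul c).congr fun n => ?_
    refine Prod.ext (toL2_smul ((hφ n).memLp _) c).symm (funext fun i => ?_)
    simp only [jet, (hφ n).pd_const_mul, Prod.smul_snd, Pi.smul_apply]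
    exact (toL2_smul (((hφ n).pd i).memLp _) c).symm
  · exact (h2.const_smul c).congr fun n => (toL2_smul (h.memLp (hφ n)) c).symm

/-- The Sobolev trace inequality. -/
lemma exists_bound_trace : ∃ K : ℝ, 0 ≤ K ∧ ∀ f ∈ H1 U, ‖trace f‖ ≤ K * ‖wjet f‖ := by
  obtain ⟨K, hK, hb⟩ := h.exists_bound_jet
  refine ⟨K, hK, fun f hf => ?_⟩
  obtain ⟨φ, hφ, h1, h2⟩ := h.exists_seq hf
  exact le_of_tendsto_of_tendsto' h2.norm (h1.norm.const_mul K) fun n => hb _ (hφ n)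

lemma trace_eq_zero {f : L2 U} (hf : f ∈ H10 U) : trace f = 0 := by
  obtain ⟨hf, φ, hφ, h1⟩ := hf
  rw [tendstoH1_iff_jet fun n => (hφ n).isCc] at h1
  refine tendsto_nhds_unique (h.tendsto_bL2 hf (fun n => (hφ n).isCc) h1) ?_
  refine tendsto_const_nhds.congr fun n => ?_
  rw [← toL2_zero]
  refine toL2_congr ?_
  filter_upwards [ae_mem_frontier] with x hx
  exact ((hφ n).eq_zero fun hxU => (h.isOpen.inter_frontier_eq ▸ ⟨hxU, hx⟩ : x ∈ (∅ : Set (E d)))).symm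

end IsC2Domain

lemma IsTest.mem_H10 (hU : IsOpen U) {φ : E d → ℂ} (hφ : IsTest U φ) : rL2 U φ ∈ H10 U :=
  ⟨hφ.isCc.mem_H1, fun _ => φ, fun _ => hφ, (tendstoH1_iff_jet fun _ => hφ.isCc).2
    (by rw [wjet_rL2 hU hφ.isCc]; exact tendsto_const_nhds)⟩

/-- Multiplication by the `i`-th component of the outer normal. -/
def mulNormal (i : Fin d) (t : L2Bdry U) : L2Bdry U :=
  toL2 (surfaceMeasure U) fun x => ((outerNormal U x i : ℝ) : ℂ) * t x

/-- The normal derivative as an element of `L²(∂U)`. -/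
def normalL2 (f : L2 U) : L2Bdry U := ∑ i, mulNormal i (trace (weakPartial i f))

namespace IsC2Domain

variable (h : IsC2Domain U)
include h

lemma memLp_mulNormal (i : Fin d) {u : E d → ℂ} (hu : MemLp u 2 (surfaceMeasure U)) :
    MemLp (fun x => ((outerNormal U x i : ℝ) : ℂ) * u x) 2 (surfaceMeasure U) := by
  refine hu.of_le_mul (c := 1) ?_ ?_
  · refine AEStronglyMeasurable.mul ?_ hu.1
    have h1 : Continuous fun y : E d => ((y i : ℝ) : ℂ) := by fun_prop
    exact h1.comp_aestronglyMeasurable h.c2.aestronglyMeasurable_outerNormal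
  · filter_upwards [h.c2.ae_norm_outerNormal] with x hx
    rw [norm_mul, Complex.norm_real]
    have := PiLp.norm_apply_le (outerNormal U x) i
    rw [hx] at this
    gcongr

lemma mulNormal_add (i : Fin d) (t s : L2Bdry U) :
    mulNormal i (t + s) = mulNormal i t + mulNormal i s := by
  rw [mulNormal, mulNormal, mulNormal, ← toL2_add (h.memLp_mulNormal i (Lp.memLp t))
    (h.memLp_mulNormal i (Lp.memLp s))]
  refine toL2_congr ?_
  filter_upwards [Lp.coeFn_add t s] with x hx
  rw [hx, Pi.add_apply, mul_add]

lemma mulNormal_smul (i : Fin d) (c : ℂ) (t : L2Bdry U) :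
    mulNormal i (c • t) = c • mulNormal i t := by
  rw [mulNormal, mulNormal, ← toL2_smul (h.memLp_mulNormal i (Lp.memLp t))]
  refine toL2_congr ?_
  filter_upwards [Lp.coeFn_smul c t] with x hx
  rw [hx, Pi.smul_apply, smul_eq_mul, mul_left_comm]

lemma norm_mulNormal_le (i : Fin d) (t : L2Bdry U) : ‖mulNormal i t‖ ≤ ‖t‖ := by
  refine Lp.norm_le_norm_of_ae_le ?_
  filter_upwards [h.c2.ae_norm_outerNormal, coeFn_toL2 (h.memLp_mulNormal i (Lp.memLp t))]
    with x hx h2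
  rw [mulNormal, h2, norm_mul, Complex.norm_real]
  have := PiLp.norm_apply_le (outerNormal U x) i
  rw [hx] at this
  exact mul_le_of_le_one_left (norm_nonneg _) this

lemma continuous_mulNormal (i : Fin d) : Continuous (mulNormal (U := U) i) := by
  have : LipschitzWith 1 (mulNormal (U := U) i) := LipschitzWith.of_dist_le_mul fun t s => by
    rw [dist_eq_norm, dist_eq_norm, NNReal.coe_one, one_mul]
    have h1 : mulNormal i t - mulNormal i s = mulNormal i (t - s) := by
      rw [sub_eq_iff_eq_add, ← h.mulNormal_add, sub_add_cancel]
    rw [h1]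
    exact h.norm_mulNormal_le i _
  exact this.continuous

lemma coeFn_normalL2 (f : L2 U) : normalL2 f =ᵐ[surfaceMeasure U] normalDeriv f := by
  have h1 : ∀ s : Finset (Fin d), (∑ i ∈ s, mulNormal i (trace (weakPartial i f)) : L2Bdry U)
      =ᵐ[surfaceMeasure U] fun x => ∑ i ∈ s, ((outerNormal U x i : ℝ) : ℂ) *
        trace (weakPartial i f) x := fun s => by
    induction s using Finset.cons_induction with
    | empty =>
      simp only [Finset.sum_empty]
      exact Lp.coeFn_zero ℂ 2 (surfaceMeasure U)
    | cons a s ha ih =>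
      simp only [Finset.sum_cons]
      refine (Lp.coeFn_add _ _).trans ?_
      filter_upwards [ih, coeFn_toL2 (h.memLp_mulNormal a (Lp.memLp (trace (weakPartial a f))))]
        with x h1 h2
      rw [Pi.add_apply, h1, mulNormal, h2]
  exact h1 Finset.univ

lemma inner_normalL2 (f : L2 U) (t : L2Bdry U) :
    inner ℂ (normalL2 f) t = ∫ x, t x * conj (normalDeriv f x) ∂surfaceMeasure U := by
  rw [inner_eq_integral]
  exact integral_congr_ae ((h.coeFn_normalL2 f).mono fun x hx => by simp only [hx])

lemma normalL2_add {f g : L2 U} (hf : f ∈ H2 U) (hg : g ∈ H2 U) :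
    normalL2 (f + g) = normalL2 f + normalL2 g := by
  simp only [normalL2, ← Finset.sum_add_distrib]
  refine Finset.sum_congr rfl fun i _ => ?_
  rw [weakPartial_add h.isOpen hf.1 hg.1, h.trace_add (hf.2 i) (hg.2 i), h.mulNormal_add]

lemma normalL2_smul {f : L2 U} (hf : f ∈ H2 U) (c : ℂ) : normalL2 (c • f) = c • normalL2 f := by
  simp only [normalL2, Finset.smul_sum]
  refine Finset.sum_congr rfl fun i _ => ?_
  rw [weakPartial_smul h.isOpen hf.1, h.trace_smul (hf.2 i), h.mulNormal_smul]

lemma normalL2_test {φ : E d → ℂ} (hφ : IsTest U φ) : normalL2 (rL2 U φ) = 0 := by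
  refine Finset.sum_eq_zero fun i _ => ?_
  rw [hφ.isCc.weakPartial_eq h.isOpen, h.trace_eq_zero ((hφ.pd i).mem_H10 h.isOpen)]
  simpa using h.mulNormal_smul i 0 0

/-- Integration by parts for smooth functions. -/
lemma ip_pd_add {φ ψ : E d → ℂ} (hφ : IsCc φ) (hψ : IsCc ψ) (i : Fin d) :
    ip (rL2 U (pd i φ)) (rL2 U ψ) + ip (rL2 U φ) (rL2 U (pd i ψ)) =
      inner ℂ (bL2 U ψ) (mulNormal i (bL2 U φ)) := by
  have hp := hφ.mul hψ.star
  have h1 := h.c2.setIntegral_fderiv h.isOpen h.bounded hp.contDiff_one hp.compact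
    (EuclideanSpace.single i 1)
  have h2 : ∀ x, fderiv ℝ (fun x => φ x * conj (ψ x)) x (EuclideanSpace.single i 1) =
      pd i φ x * conj (ψ x) + φ x * conj (pd i ψ x) := fun x => by
    have := congrFun (hφ.pd_mul hψ.star i) x
    rw [hψ.pd_conj] at this
    rw [← pd, this]; ring
  simp only [h2] at h1
  rw [integral_add] at h1
  · rw [ip, ip, inner_toL2_toL2 ((hφ.pd i).memLp _) (hψ.memLp _),
      inner_toL2_toL2 (hφ.memLp _) ((hψ.pd i).memLp _), h1, mulNormal,
      inner_toL2_toL2 (h.memLp_mulNormal i (Lp.memLp _)) (h.memLp hψ)]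
    refine integral_congr_ae ?_
    filter_upwards [coeFn_toL2 (h.memLp hφ)] with x hx
    rw [hx, EuclideanSpace.inner_single_left]
    simp [mul_assoc]
  · exact (((hφ.pd i).mul hψ.star).contDiff_one.continuous.integrable_of_hasCompactSupport
      ((hφ.pd i).mul hψ.star).compact).integrableOn
  · exact ((hφ.mul (hψ.pd i).star).contDiff_one.continuous.integrable_of_hasCompactSupport
      (hφ.mul (hψ.pd i).star).compact).integrableOn

/-- Integration by parts in `H¹`. -/
lemma ip_weakPartial_add {f g : L2 U} (hf : f ∈ H1 U) (hg : g ∈ H1 U) (i : Fin d) :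
    ip (weakPartial i f) g + ip f (weakPartial i g) =
      inner ℂ (trace g) (mulNormal i (trace f)) := by
  obtain ⟨φ, hφ, h1, h2⟩ := h.exists_seq hf
  obtain ⟨ψ, hψ, h3, h4⟩ := h.exists_seq hg
  have hip : ∀ {u v : ℕ → L2 U} {u₀ v₀ : L2 U}, Tendsto u atTop (𝓝 u₀) → Tendsto v atTop (𝓝 v₀) →
      Tendsto (fun n => ip (u n) (v n)) atTop (𝓝 (ip u₀ v₀)) := fun hu hv =>
    (continuous_ip.tendsto _).comp (hu.prodMk_nhds hv)
  have e1 := (continuous_fst.tendsto _).comp h1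
  have e2 := (((continuous_apply i).comp continuous_snd).tendsto _).comp h1
  have e3 := (continuous_fst.tendsto _).comp h3
  have e4 := (((continuous_apply i).comp continuous_snd).tendsto _).comp h3
  refine tendsto_nhds_unique ((hip e2 e3).add (hip e1 e4)) ?_
  have e5 := h4.inner (𝕜 := ℂ) (((h.continuous_mulNormal i).tendsto _).comp h2)
  exact e5.congr fun n => (h.ip_pd_add (hφ n) (hψ n) i).symm

/-- Green's formula. -/
lemma ip_laplacian_add {f g : L2 U} (hf : f ∈ H2 U) (hg : g ∈ H1 U) :
    ip (laplacian f) g + gradIp f g = inner ℂ (trace g) (normalL2 f) := by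
  rw [laplacian_of_mem_H2 h.isOpen hf, ip_sum_left, gradIp, ← Finset.sum_add_distrib, normalL2,
    inner_sum]
  exact Finset.sum_congr rfl fun i _ => h.ip_weakPartial_add (hf.2 i) hg i

end IsC2Domain

end Trace

/-! ### Existence of weak solutions -/

/-- The Riesz representation theorem on a subspace `S` with the (possibly non-Hausdorff) inner
product pulled back along a map `T` that is linear on `S` and has closed range, for functionals
which are defined and bounded on a smaller subspace `S₀`. -/
theorem exists_riesz {V H : Type*} [AddCommGroup V] [Module ℂ V] [NormedAddCommGroup H]
    [InnerProductSpace ℂ H] [CompleteSpace H] {S S₀ : Submodule ℂ V} (hS : S₀ ≤ S) {T : V → H}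
    (hadd : ∀ x ∈ S, ∀ y ∈ S, T (x + y) = T x + T y) (hsmul : ∀ c : ℂ, ∀ x ∈ S, T (c • x) = c • T x)
    (hcl : ∀ u : ℕ → V, (∀ n, u n ∈ S) → ∀ y, Tendsto (fun n => T (u n)) atTop (𝓝 y) →
      ∃ p ∈ S, T p = y)
    {ℓ : V → ℂ} (ladd : ∀ x ∈ S₀, ∀ y ∈ S₀, ℓ (x + y) = ℓ x + ℓ y)
    (lsmul : ∀ c : ℂ, ∀ x ∈ S₀, ℓ (c • x) = conj c * ℓ x) {K : ℝ}
    (hK : ∀ x ∈ S₀, ‖ℓ x‖ ≤ K * ‖T x‖) : ∃ p ∈ S, ∀ x ∈ S₀, inner ℂ (T x) (T p) = ℓ x := by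
  let T₁ : S →ₗ[ℂ] H :=
    { toFun := fun x => T x
      map_add' := fun x y => hadd x x.2 y y.2
      map_smul' := fun c x => hsmul c x x.2 }
  let T₀ : S₀ →ₗ[ℂ] H := T₁.comp (Submodule.inclusion hS)
  let ℓ₀ : S₀ →ₗ[ℂ] ℂ :=
    { toFun := fun x => conj (ℓ x)
      map_add' := fun x y => by simp [ladd x x.2 y y.2]
      map_smul' := fun c x => by simp [lsmul c x x.2] }
  -- The bound forces the functional to vanish where `T` does, so it descends to the range of `T` on
  -- `S₀`.
  have hker : LinearMap.ker T₀ ≤ LinearMap.ker ℓ₀ := fun x hx => by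
    have h1 : T x = 0 := hx
    have h2 := hK x x.2
    rw [h1, norm_zero, mul_zero] at h2
    have h3 : ℓ x = 0 := norm_le_zero_iff.1 h2
    simp [ℓ₀, h3]
  let f : LinearMap.range T₀ →ₗ[ℂ] ℂ :=
    ((LinearMap.ker T₀).liftQ ℓ₀ hker).comp T₀.quotKerEquivRange.symm.toLinearMap
  have hf : ∀ x : S₀, f ⟨T₀ x, LinearMap.mem_range_self T₀ x⟩ = ℓ₀ x := fun x => by
    have : T₀.quotKerEquivRange.symm ⟨T₀ x, LinearMap.mem_range_self T₀ x⟩ =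
      (LinearMap.ker T₀).mkQ x := LinearMap.quotKerEquivRange_symm_apply_image T₀ x _
    simp [f, this]
  let fc : LinearMap.range T₀ →L[ℂ] ℂ := f.mkContinuous K fun y => by
    obtain ⟨y, x, rfl⟩ := y
    rw [hf x]
    have h1 : ‖ℓ₀ x‖ = ‖ℓ x‖ := RCLike.norm_conj (K := ℂ) _
    rw [h1]
    exact hK x x.2
  -- After extension to all of `H` the functional has a Riesz vector `q`. Projecting `q` onto the
  -- closed range of `T₁` does not change its pairings with the vectors `T x`, and makes it of the
  -- form `T p`.
  obtain ⟨g, hg, -⟩ := exists_extension_norm_eq (LinearMap.range T₀) fc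
  set q := (InnerProductSpace.toDual ℂ H).symm g with hq
  have hclosed : IsClosed (LinearMap.range T₁ : Set H) := by
    refine IsSeqClosed.isClosed fun v y hv hy => ?_
    choose x hx using hv
    obtain ⟨p, hp, hpy⟩ := hcl (fun n => x n) (fun n => (x n).2) y
      (hy.congr fun n => (hx n).symm)
    exact ⟨⟨p, hp⟩, hpy⟩
  have : CompleteSpace (LinearMap.range T₁) := hclosed.completeSpace_coe
  obtain ⟨p, hp⟩ := ((LinearMap.range T₁).orthogonalProjectionOnto q).2
  refine ⟨p, p.2, fun x hx => ?_⟩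
  have h1 : inner ℂ (T p) (T x) = inner ℂ q (T x) := by
    have h2 := Submodule.starProjection_inner_eq_zero (K := LinearMap.range T₁) q (T x)
      ⟨⟨x, hS hx⟩, rfl⟩
    rw [inner_sub_left, sub_eq_zero] at h2
    rw [h2]
    exact congrArg (fun z => inner ℂ z (T x)) hp
  rw [← inner_conj_symm, h1, hq, InnerProductSpace.toDual_symm_apply]
  have h3 := hg ⟨T₀ ⟨x, hx⟩, LinearMap.mem_range_self _ _⟩
  have h4 : fc ⟨T₀ ⟨x, hx⟩, LinearMap.mem_range_self _ _⟩ = ℓ₀ ⟨x, hx⟩ := hf _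
  rw [h4] at h3
  have h5 : g (T x) = conj (ℓ x) := h3
  rw [h5, Complex.conj_conj]

/-! ### Completeness of `H¹` and `H¹₀` -/

section H10

variable {d : ℕ} {U : Set (E d)}

lemma tendsto_wjet_mem_H1 (hU : IsOpen U) {u : ℕ → L2 U} (hu : ∀ n, u n ∈ H1 U)
    {y : L2 U × (Fin d → L2 U)} (hy : Tendsto (fun n => wjet (u n)) atTop (𝓝 y)) :
    y.1 ∈ H1 U ∧ wjet y.1 = y := by
  have h1 : ∀ i, HasWeakPartial i y.1 (y.2 i) := fun i =>
    .of_tendsto (fun n => hasWeakPartial_weakPartial (hu n) i) ((continuous_fst.tendsto _).comp hy)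
      ((((continuous_apply i).comp continuous_snd).tendsto _).comp hy)
  exact ⟨fun i => ⟨_, h1 i⟩, Prod.ext rfl (funext fun i => weakPartial_eq hU (h1 i))⟩

/-- Written as a closure, membership in `H¹₀` visibly survives limits in `H¹`. -/
lemma mem_H10_iff {f : L2 U} :
    f ∈ H10 U ↔ f ∈ H1 U ∧ wjet f ∈ closure (jet U '' {φ | IsTest U φ}) := by
  refine and_congr_right fun _ => ?_
  rw [mem_closure_iff_seq_limit]
  constructor
  · rintro ⟨φ, hφ, h1⟩
    exact ⟨fun n => jet U (φ n), fun n => ⟨_, hφ n, rfl⟩,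
      (tendstoH1_iff_jet fun n => (hφ n).isCc).1 h1⟩
  · rintro ⟨v, hv, h1⟩
    choose φ hφ hv using hv
    refine ⟨φ, hφ, (tendstoH1_iff_jet fun n => (hφ n).isCc).2 ?_⟩
    exact h1.congr fun n => (hv n).symm

lemma tendsto_wjet_mem_H10 (hU : IsOpen U) {u : ℕ → L2 U} (hu : ∀ n, u n ∈ H10 U)
    {y : L2 U × (Fin d → L2 U)} (hy : Tendsto (fun n => wjet (u n)) atTop (𝓝 y)) :
    y.1 ∈ H10 U ∧ wjet y.1 = y := by
  obtain ⟨h1, h2⟩ := tendsto_wjet_mem_H1 hU (fun n => (hu n).1) hy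
  refine ⟨mem_H10_iff.2 ⟨h1, ?_⟩, h2⟩
  rw [h2]
  exact isClosed_closure.mem_of_tendsto hy (Eventually.of_forall fun n => (mem_H10_iff.1 (hu n)).2)

lemma isTest_zero : IsTest U fun _ : E d => (0 : ℂ) :=
  ⟨isCc_zero.1, isCc_zero.2, by simp [tsupport, Function.support]⟩

lemma IsTest.add {φ ψ : E d → ℂ} (hφ : IsTest U φ) (hψ : IsTest U ψ) :
    IsTest U fun x => φ x + ψ x :=
  ⟨hφ.1.add hψ.1, hφ.2.1.add hψ.2.1, (tsupport_add φ ψ).trans (union_subset hφ.2.2 hψ.2.2)⟩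

lemma IsTest.const_mul {φ : E d → ℂ} (hφ : IsTest U φ) (c : ℂ) : IsTest U fun x => c * φ x :=
  ⟨contDiff_const.mul hφ.1, hφ.2.1.mul_left, (tsupport_mul_subset_right).trans hφ.2.2⟩

lemma jet_add {φ ψ : E d → ℂ} (hφ : IsCc φ) (hψ : IsCc ψ) :
    jet U (fun x => φ x + ψ x) = jet U φ + jet U ψ := by
  refine Prod.ext (toL2_add (hφ.memLp _) (hψ.memLp _)) (funext fun i => ?_)
  simp only [jet, hφ.pd_add hψ, Prod.snd_add, Pi.add_apply]
  exact toL2_add ((hφ.pd i).memLp _) ((hψ.pd i).memLp _)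

lemma jet_const_mul {φ : E d → ℂ} (hφ : IsCc φ) (c : ℂ) :
    jet U (fun x => c * φ x) = c • jet U φ := by
  refine Prod.ext (toL2_smul (hφ.memLp _) c) (funext fun i => ?_)
  simp only [jet, hφ.pd_const_mul, Prod.smul_snd, Pi.smul_apply]
  exact toL2_smul ((hφ.pd i).memLp _) c

/-- `H¹₀(U)` as a subspace of `L²(U)`. -/
def H10sub (hU : IsOpen U) : Submodule ℂ (L2 U) where
  carrier := H10 U
  zero_mem' := by
    have := isTest_zero.mem_H10 (U := U) hU
    rwa [rL2, toL2_zero] at this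
  add_mem' := by
    rintro f g ⟨hf, φ, hφ, h1⟩ ⟨hg, ψ, hψ, h2⟩
    rw [tendstoH1_iff_jet fun n => (hφ n).isCc] at h1
    rw [tendstoH1_iff_jet fun n => (hψ n).isCc] at h2
    refine ⟨(H1sub U).add_mem hf hg, _, fun n => (hφ n).add (hψ n),
      (tendstoH1_iff_jet fun n => ((hφ n).add (hψ n)).isCc).2 ?_⟩
    rw [wjet_add hU hf hg]
    exact (h1.add h2).congr fun n => (jet_add (hφ n).isCc (hψ n).isCc).symm
  smul_mem' := by
    rintro c f ⟨hf, φ, hφ, h1⟩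
    rw [tendstoH1_iff_jet fun n => (hφ n).isCc] at h1
    refine ⟨(H1sub U).smul_mem c hf, _, fun n => (hφ n).const_mul c,
      (tendstoH1_iff_jet fun n => ((hφ n).const_mul c).isCc).2 ?_⟩
    rw [wjet_smul hU hf]
    exact (h1.const_smul c).congr fun n => (jet_const_mul (hφ n).isCc c).symm

/-- The jet of a function with weighted derivatives, in the Hilbert space `L²(U)^(d+1)`. -/
def hjet (c : ℝ) (f : L2 U) : PiLp 2 fun _ : Fin (d + 1) => L2 U :=
  WithLp.toLp 2 (Fin.cons f fun i => (c : ℂ) • weakPartial i f)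

/-- With `c = 1` this is the form of `I - Δ` with Neumann data, with `c = √γ` the form of `P_γ`;
both equations thus become instances of `exists_riesz`. -/
lemma inner_hjet (c : ℝ) (f g : L2 U) :
    inner ℂ (hjet c g) (hjet c f) = ip f g + ((c ^ 2 : ℝ) : ℂ) * gradIp f g := by
  rw [PiLp.inner_apply, Fin.sum_univ_succ]
  simp only [hjet, Fin.cons_zero, Fin.cons_succ, inner_smul_left, inner_smul_right, gradIp,
    Finset.mul_sum, Complex.conj_ofReal]
  congr 1
  refine Finset.sum_congr rfl fun i _ => ?_
  rw [ip]; push_cast; ring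

lemma gradIp_self (f : L2 U) : gradIp f f = ((gradNormSq f : ℝ) : ℂ) := by
  simp only [gradIp, gradNormSq, ip_self]; push_cast; rfl

lemma norm_hjet_sq (c : ℝ) (f : L2 U) : ‖hjet c f‖ ^ 2 = ‖f‖ ^ 2 + c ^ 2 * gradNormSq f := by
  have h := inner_hjet c f f
  rw [inner_self_eq_norm_sq_to_K, ip_self, gradIp_self] at h
  refine Complex.ofReal_injective ?_
  push_cast at h ⊢
  exact h

lemma hjet_add (hU : IsOpen U) (c : ℝ) {f g : L2 U} (hf : f ∈ H1 U) (hg : g ∈ H1 U) :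
    hjet c (f + g) = hjet c f + hjet c g := by
  refine PiLp.ext fun j => Fin.cases rfl (fun i => ?_) j
  simp [hjet, weakPartial_add hU hf hg]

lemma hjet_smul (hU : IsOpen U) (c : ℝ) {f : L2 U} (hf : f ∈ H1 U) (a : ℂ) :
    hjet c (a • f) = a • hjet c f := by
  refine PiLp.ext fun j => Fin.cases rfl (fun i => ?_) j
  simp only [hjet, PiLp.smul_apply, Fin.cons_succ, weakPartial_smul hU hf]
  exact smul_comm _ _ _

lemma tendsto_wjet_of_hjet {c : ℝ} (hc : c ≠ 0) {u : ℕ → L2 U}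
    {y : PiLp 2 fun _ : Fin (d + 1) => L2 U} (hy : Tendsto (fun n => hjet c (u n)) atTop (𝓝 y)) :
    Tendsto (fun n => wjet (u n)) atTop (𝓝 (y 0, fun i => (c : ℂ)⁻¹ • y i.succ)) := by
  have h1 : ∀ j, Tendsto (fun n => hjet c (u n) j) atTop (𝓝 (y j)) := fun j =>
    ((PiLp.continuous_apply 2 _ j).tendsto y).comp hy
  refine (h1 0).prodMk_nhds (tendsto_pi_nhds.2 fun i => ?_)
  refine ((h1 i.succ).const_smul (c : ℂ)⁻¹).congr fun n => ?_
  simp only [hjet, Fin.cons_succ, smul_smul, inv_mul_cancel₀ (Complex.ofReal_ne_zero.2 hc),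
    one_smul]

lemma hjet_eq {c : ℝ} (hc : c ≠ 0) {f : L2 U} {y : PiLp 2 fun _ : Fin (d + 1) => L2 U}
    (h : wjet f = (y 0, fun i => (c : ℂ)⁻¹ • y i.succ)) : hjet c f = y := by
  have h1 : f = y 0 := congrArg Prod.fst h
  have h2 : ∀ i, weakPartial i f = (c : ℂ)⁻¹ • y i.succ := fun i => congrFun (congrArg Prod.snd h) i
  refine PiLp.ext fun j => Fin.cases ?_ (fun i => ?_) j
  · simpa [hjet] using h1
  · simp only [hjet, Fin.cons_succ, h2, smul_smul, mul_inv_cancel₀ (Complex.ofReal_ne_zero.2 hc),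
      one_smul]

lemma norm_le_norm_hjet (c : ℝ) (f : L2 U) : ‖f‖ ≤ ‖hjet c f‖ := by
  refine le_of_sq_le_sq ?_ (norm_nonneg _)
  rw [norm_hjet_sq]
  have : 0 ≤ gradNormSq f := Finset.sum_nonneg fun i _ => by positivity
  nlinarith [sq_nonneg c]

lemma norm_wjet_le (f : L2 U) : ‖wjet f‖ ≤ ‖hjet 1 f‖ := by
  refine max_le (norm_le_norm_hjet 1 f) ((pi_norm_le_iff_of_nonneg (norm_nonneg _)).2 fun i => ?_)
  refine le_of_sq_le_sq ?_ (norm_nonneg _)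
  rw [norm_hjet_sq, gradNormSq, one_pow, one_mul]
  have := Finset.single_le_sum (f := fun i => ‖weakPartial i f‖ ^ 2) (fun i _ => by positivity)
    (Finset.mem_univ i)
  exact this.trans (le_add_of_nonneg_left (by positivity))

end H10

/-! ### Poincaré inequality and control by the Laplacian -/

section Poincare

variable {d : ℕ} {U : Set (E d)}

/-- The Poincaré inequality for test functions. -/
lemma IsC2Domain.norm_le_of_isTest (h : IsC2Domain U) (i : Fin d) {R : ℝ} (hR : ∀ x ∈ U, |x i| ≤ R)
    (hR₀ : 0 ≤ R) {φ : E d → ℂ} (hφ : IsTest U φ) : ‖rL2 U φ‖ ≤ 2 * R * ‖rL2 U (pd i φ)‖ := by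
  have hc := hφ.isCc
  have hX : ∀ {ψ : E d → ℂ}, IsCc ψ → IsCc fun x => ((x i : ℝ) : ℂ) * ψ x := fun hψ =>
    ⟨ContDiff.mul (Complex.ofRealCLM.contDiff.comp
      (EuclideanSpace.proj (𝕜 := ℝ) i : E d →L[ℝ] ℝ).contDiff) hψ.1, hψ.2.mul_left⟩
  have hn : ∀ {ψ : E d → ℂ}, IsCc ψ → ‖rL2 U fun x => ((x i : ℝ) : ℂ) * ψ x‖ ≤ R * ‖rL2 U ψ‖ :=
    fun {ψ} hψ => by
      refine Lp.norm_le_mul_norm_of_ae_le_mul ?_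
      filter_upwards [coeFn_toL2 ((hX hψ).memLp (volume.restrict U)),
        coeFn_toL2 (hψ.memLp (volume.restrict U)), ae_restrict_mem h.isOpen.measurableSet]
        with x h1 h2 hx
      rw [h1, h2, norm_mul, Complex.norm_real]
      exact mul_le_mul_of_nonneg_right (hR x hx) (norm_nonneg _)
  have hpd : pd i (fun x => ((x i : ℝ) : ℂ) * φ x) = fun x => ((x i : ℝ) : ℂ) * pd i φ x + φ x := by
    ext x
    have h1 : HasFDerivAt (fun x : E d => ((x i : ℝ) : ℂ))
        (Complex.ofRealCLM.comp (EuclideanSpace.proj (𝕜 := ℝ) i : E d →L[ℝ] ℝ)) x :=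
      (Complex.ofRealCLM.comp (EuclideanSpace.proj (𝕜 := ℝ) i : E d →L[ℝ] ℝ)).hasFDerivAt
    have h2 := h1.mul (hc.differentiable x).hasFDerivAt
    change (fderiv ℝ ((fun x : E d => ((x i : ℝ) : ℂ)) * φ) x) _ = _
    rw [h2.fderiv]
    simp [pd]
  -- Integrating `∂_i` by parts between `φ` and `x_i φ` isolates `‖φ‖²`, because `∂_i (x_i φ) = φ +
  -- x_i ∂_i φ`; the other two terms carry a factor at most `R`.
  have h1 := h.ip_pd_add hc (hX hc) i
  have h0 : bL2 U φ = 0 := by rw [← h.trace_rL2 hc, h.trace_eq_zero (hφ.mem_H10 h.isOpen)]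
  have h2 : mulNormal i (0 : L2Bdry U) = 0 := by simpa using h.mulNormal_smul i 0 0
  rw [h0, h2, inner_zero_right, hpd, rL2, rL2, rL2, rL2,
    toL2_add ((hX (hc.pd i)).memLp _) (hc.memLp _), ip_add_right, ip_self] at h1
  have h3 : ((‖rL2 U φ‖ ^ 2 : ℝ) : ℂ) =
      -(ip (rL2 U (pd i φ)) (rL2 U fun x => ((x i : ℝ) : ℂ) * φ x) +
        ip (rL2 U φ) (rL2 U fun x => ((x i : ℝ) : ℂ) * pd i φ x)) := by
    linear_combination h1
  have h4 : ‖rL2 U φ‖ ^ 2 ≤ 2 * R * ‖rL2 U (pd i φ)‖ * ‖rL2 U φ‖ := by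
    calc ‖rL2 U φ‖ ^ 2 = ‖((‖rL2 U φ‖ ^ 2 : ℝ) : ℂ)‖ := by
          rw [Complex.norm_real, Real.norm_of_nonneg (by positivity)]
      _ ≤ ‖rL2 U (pd i φ)‖ * (R * ‖rL2 U φ‖) + ‖rL2 U φ‖ * (R * ‖rL2 U (pd i φ)‖) := by
          rw [h3, norm_neg]
          refine (norm_add_le _ _).trans (add_le_add ?_ ?_)
          · exact (norm_ip_le _ _).trans (by gcongr; exact hn hc)
          · exact (norm_ip_le _ _).trans (by gcongr; exact hn (hc.pd i))
      _ = _ := by ring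
  rcases (norm_nonneg (rL2 U φ)).eq_or_lt with h5 | h5
  · rw [← h5]; positivity
  · rw [sq] at h4
    exact le_of_mul_le_mul_right h4 h5

/-- The Poincaré inequality. -/
lemma IsC2Domain.exists_poincare (h : IsC2Domain U) (i : Fin d) :
    ∃ R : ℝ, 0 ≤ R ∧ ∀ f ∈ H10 U, ‖f‖ ≤ R * ‖weakPartial i f‖ := by
  obtain ⟨R, hR⟩ := h.bounded.exists_norm_le
  have hR' : ∀ x ∈ U, |x i| ≤ |R| := fun x hx =>
    (PiLp.norm_apply_le x i).trans ((hR x hx).trans (le_abs_self R))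
  refine ⟨2 * |R|, by positivity, ?_⟩
  rintro f ⟨hf, φ, hφ, h1⟩
  rw [tendstoH1_iff fun n => (hφ n).isCc] at h1
  exact le_of_tendsto_of_tendsto' h1.1.norm ((h1.2 i).norm.const_mul _) fun n =>
    h.norm_le_of_isTest i hR' (abs_nonneg R) (hφ n)

lemma IsC2Domain.gradNormSq_eq (h : IsC2Domain U) {f : L2 U} (hf : f ∈ H2 U) (hf0 : f ∈ H10 U) :
    ((gradNormSq f : ℝ) : ℂ) = -ip (laplacian f) f := by
  have h1 := h.ip_laplacian_add hf hf.1
  rw [h.trace_eq_zero hf0, inner_zero_left, gradIp_self] at h1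
  linear_combination h1

/-- On `H² ∩ H¹₀`, the `H¹` norm is controlled by the Laplacian. -/
lemma IsC2Domain.exists_norm_wjet_le (h : IsC2Domain U) (i : Fin d) : ∃ K : ℝ, 0 ≤ K ∧
    ∀ f ∈ H2 U ∩ H10 U, ‖wjet f‖ ≤ K * ‖laplacian f‖ := by
  obtain ⟨R, hR, hP⟩ := h.exists_poincare i
  refine ⟨R ^ 2 + R, by positivity, fun f hf => ?_⟩
  -- Green's formula for `f` against itself. With `‖f‖ ≤ R‖∂_i f‖` it gives `‖∂_i f‖ ≤ R‖Δf‖`, then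
  -- `‖f‖ ≤ R²‖Δf‖`, and then the bound for all the derivatives.
  have h1 : gradNormSq f ≤ ‖laplacian f‖ * ‖f‖ := by
    have := congrArg norm (h.gradNormSq_eq hf.1 hf.2)
    rw [Complex.norm_real, norm_neg] at this
    exact (le_abs_self _).trans (this.le.trans (norm_ip_le _ _))
  have h2 : ∀ j, ‖weakPartial j f‖ ^ 2 ≤ gradNormSq f := fun j =>
    Finset.single_le_sum (f := fun i => ‖weakPartial i f‖ ^ 2) (fun i _ => by positivity)
      (Finset.mem_univ j)
  have h3 := hP f hf.2
  have hL := norm_nonneg (laplacian f)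
  have hn := norm_nonneg f
  have h4 : ‖weakPartial i f‖ ≤ R * ‖laplacian f‖ := by
    rcases (norm_nonneg (weakPartial i f)).eq_or_lt with h5 | h5
    · rw [← h5]; positivity
    · refine le_of_mul_le_mul_right ?_ h5
      nlinarith [h2 i]
  have h6 : ‖f‖ ≤ R ^ 2 * ‖laplacian f‖ := by nlinarith
  refine max_le ?_ ((pi_norm_le_iff_of_nonneg (by positivity)).2 fun j => ?_)
  · change ‖f‖ ≤ _
    nlinarith
  · change ‖weakPartial j f‖ ≤ _
    have h7 : ‖weakPartial j f‖ ≤ R * ‖laplacian f‖ := by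
      refine le_of_sq_le_sq ?_ (by positivity)
      nlinarith [h2 j]
    nlinarith [sq_nonneg R]

end Poincare

/-! ### The plate -/

section Plate

variable {G : Set (E 2)} {μ : ℝ}

/-- `H²(U)` as a subspace of `L²(U)`. -/
def H2sub {d : ℕ} {U : Set (E d)} (hU : IsOpen U) : Submodule ℂ (L2 U) where
  carrier := H2 U
  zero_mem' := by
    refine ⟨(H1sub U).zero_mem, fun i => ?_⟩
    have := weakPartial_smul hU (H1sub U).zero_mem 0 i
    rw [zero_smul, zero_smul] at this
    rw [this]
    exact (H1sub U).zero_mem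
  add_mem' := fun hf hg => ⟨(H1sub U).add_mem hf.1 hg.1, fun i => by
    rw [weakPartial_add hU hf.1 hg.1]
    exact (H1sub U).add_mem (hf.2 i) (hg.2 i)⟩
  smul_mem' := fun c f hf => ⟨(H1sub U).smul_mem c hf.1, fun i => by
    rw [weakPartial_smul hU hf.1]
    exact (H1sub U).smul_mem c (hf.2 i)⟩

/-- `H²(Γ₀) ∩ H¹₀(Γ₀)` as a subspace of `L²(Γ₀)`. -/
def H2H10sub (hG : IsOpen G) : Submodule ℂ (L2 G) := H2sub hG ⊓ H10sub hG

lemma laplacian_sub {d : ℕ} {U : Set (E d)} (hU : IsOpen U) {f g : L2 U} (hf : f ∈ H2 U)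
    (hg : g ∈ H2 U) : laplacian (f - g) = laplacian f - laplacian g := by
  rw [laplacian_of_mem_H2 hU hf, laplacian_of_mem_H2 hU hg,
    laplacian_of_mem_H2 hU ((H2sub hU).sub_mem hf hg), ← Finset.sum_sub_distrib]
  refine Finset.sum_congr rfl fun i _ => ?_
  rw [weakPartial_sub hU hf.1 hg.1, weakPartial_sub hU (hf.2 i) (hg.2 i)]

lemma wjet_sub {d : ℕ} {U : Set (E d)} (hU : IsOpen U) {f g : L2 U} (hf : f ∈ H1 U)
    (hg : g ∈ H1 U) : wjet (f - g) = wjet f - wjet g :=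
  Prod.ext rfl (funext fun i => weakPartial_sub hU hf hg i)

/-- The combinations of second derivatives whose norms add up to the plate form. -/
def plateJet (μ : ℝ) (w : L2 G) : PiLp 2 fun _ : Fin 4 => L2 G :=
  WithLp.toLp 2 ![((√μ : ℝ) : ℂ) • (weakPartial 0 (weakPartial 0 w) + weakPartial 1 (weakPartial 1 w)),
    ((√(1 - μ) : ℝ) : ℂ) • weakPartial 0 (weakPartial 0 w),
    ((√(1 - μ) : ℝ) : ℂ) • weakPartial 1 (weakPartial 1 w),
    ((√(2 * (1 - μ)) : ℝ) : ℂ) • weakPartial 0 (weakPartial 1 w)]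

/-- The form equals `μ (Δφ, Δψ)` plus `1 - μ` times the pairings of pure second derivatives plus `2
(1 - μ)` times the mixed one. All weights are positive for `0 < μ < 1`, so it is a Hilbert space
pairing. -/
lemma inner_plateJet (hμ₀ : 0 < μ) (hμ₁ : μ < 1) (φ ψ : L2 G) :
    inner ℂ (plateJet μ ψ) (plateJet μ φ) = plateForm μ φ ψ := by
  have h1 : ∀ {c : ℝ}, 0 ≤ c → ∀ f g : L2 G, inner ℂ (((√c : ℝ) : ℂ) • g) (((√c : ℝ) : ℂ) • f) =
      (c : ℂ) * ip f g := fun {c} hc f g => by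
    have h2 : ((√c : ℝ) : ℂ) * ((√c : ℝ) : ℂ) = c := by
      rw [← Complex.ofReal_mul, Real.mul_self_sqrt hc]
    rw [inner_smul_left, inner_smul_right, Complex.conj_ofReal, ← mul_assoc, h2, ip]
  rw [PiLp.inner_apply, Fin.sum_univ_four]
  have e1 := h1 hμ₀.le (weakPartial 0 (weakPartial 0 φ) + weakPartial 1 (weakPartial 1 φ))
    (weakPartial 0 (weakPartial 0 ψ) + weakPartial 1 (weakPartial 1 ψ))
  have e2 := h1 (sub_nonneg.2 hμ₁.le) (weakPartial 0 (weakPartial 0 φ))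
    (weakPartial 0 (weakPartial 0 ψ))
  have e3 := h1 (sub_nonneg.2 hμ₁.le) (weakPartial 1 (weakPartial 1 φ))
    (weakPartial 1 (weakPartial 1 ψ))
  have e4 := h1 (mul_nonneg zero_le_two (sub_nonneg.2 hμ₁.le)) (weakPartial 0 (weakPartial 1 φ))
    (weakPartial 0 (weakPartial 1 ψ))
  refine (congrArg₂ (· + ·) (congrArg₂ (· + ·) (congrArg₂ (· + ·) e1 e2) e3) e4).trans ?_
  simp only [plateForm, ip_add_left, ip_add_right]
  push_cast
  ring

lemma weakPartial_weakPartial_add (hG : IsOpen G) {f g : L2 G} (hf : f ∈ H2 G) (hg : g ∈ H2 G)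
    (i j : Fin 2) : weakPartial i (weakPartial j (f + g)) =
      weakPartial i (weakPartial j f) + weakPartial i (weakPartial j g) := by
  rw [weakPartial_add hG hf.1 hg.1, weakPartial_add hG (hf.2 j) (hg.2 j)]

lemma weakPartial_weakPartial_smul (hG : IsOpen G) {f : L2 G} (hf : f ∈ H2 G) (c : ℂ)
    (i j : Fin 2) : weakPartial i (weakPartial j (c • f)) =
      c • weakPartial i (weakPartial j f) := by
  rw [weakPartial_smul hG hf.1, weakPartial_smul hG (hf.2 j)]

lemma plateJet_add (hG : IsOpen G) {f g : L2 G} (hf : f ∈ H2 G) (hg : g ∈ H2 G) :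
    plateJet μ (f + g) = plateJet μ f + plateJet μ g := by
  simp only [plateJet, weakPartial_weakPartial_add hG hf hg]
  refine PiLp.ext fun j => ?_
  fin_cases j
  · have h1 : ∀ (c : ℂ) (a a' b b' : L2 G), c • (a + a' + (b + b')) =
        c • (a + b) + c • (a' + b') := fun c a a' b b' => by rw [← smul_add, add_add_add_comm]
    exact h1 _ _ _ _ _
  all_goals exact smul_add _ _ _

lemma plateJet_smul (hG : IsOpen G) {f : L2 G} (hf : f ∈ H2 G) (c : ℂ) :
    plateJet μ (c • f) = c • plateJet μ f := by
  simp only [plateJet, weakPartial_weakPartial_smul hG hf]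
  refine PiLp.ext fun j => ?_
  fin_cases j
  · have h1 : ∀ (k : ℂ) (a b : L2 G), k • (c • a + c • b) = c • k • (a + b) := fun k a b => by
      rw [← smul_add, smul_comm]
    exact h1 _ _ _
  all_goals exact smul_comm _ _ _

lemma norm_plateJet_sq (hμ₀ : 0 < μ) (hμ₁ : μ < 1) (w : L2 G) :
    ((‖plateJet μ w‖ ^ 2 : ℝ) : ℂ) = plateForm μ w w := by
  rw [← inner_plateJet hμ₀ hμ₁, inner_self_eq_norm_sq_to_K]
  push_cast; rfl

lemma norm_laplacian_le_plateJet (hG : IsOpen G) (hμ₀ : 0 < μ) {w : L2 G} (hw : w ∈ H2 G) :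
    ‖laplacian w‖ ≤ (√μ)⁻¹ * ‖plateJet μ w‖ := by
  have h1 := PiLp.norm_apply_le (plateJet μ w) 0
  have h2 : plateJet μ w 0 = ((√μ : ℝ) : ℂ) • laplacian w := by
    rw [laplacian_of_mem_H2 hG hw, Fin.sum_univ_two]; rfl
  have h3 : 0 < √μ := Real.sqrt_pos.2 hμ₀
  rw [h2, norm_smul, Complex.norm_real, Real.norm_of_nonneg h3.le] at h1
  rwa [le_inv_mul_iff₀ h3]

variable (h : IsC2Domain G)
include h

/-- Closed range of `plateJet`. Convergence of the jets gives convergence of the second derivatives,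
in particular of the Laplacians, and these control the `H¹` norm on `H² ∩ H¹₀`. The `H¹` limit lies
in `H¹₀`, and closedness of weak derivatives puts it in `H²`. -/
lemma IsC2Domain.exists_plateJet_eq (hμ₁ : μ < 1) (u : ℕ → L2 G)
    (hu : ∀ n, u n ∈ H2H10 G) (y : PiLp 2 fun _ : Fin 4 => L2 G)
    (hy : Tendsto (fun n => plateJet μ (u n)) atTop (𝓝 y)) : ∃ p ∈ H2H10 G, plateJet μ p = y := by
  have hG := h.isOpen
  have hs1 : 0 < √(1 - μ) := Real.sqrt_pos.2 (sub_pos.2 hμ₁)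
  have hs2 : 0 < √(2 * (1 - μ)) := Real.sqrt_pos.2 (mul_pos two_pos (sub_pos.2 hμ₁))
  have hyj : ∀ j, Tendsto (fun n => plateJet μ (u n) j) atTop (𝓝 (y j)) := fun j =>
    ((PiLp.continuous_apply 2 _ j).tendsto y).comp hy
  have hcancel : ∀ {c : ℝ}, 0 < c → ∀ {a : ℕ → L2 G} {b : L2 G},
      Tendsto (fun n => (c : ℂ) • a n) atTop (𝓝 b) → Tendsto a atTop (𝓝 ((c : ℂ)⁻¹ • b)) :=
    fun {c} hc {a b} hab => (hab.const_smul (c : ℂ)⁻¹).congr fun n => by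
      rw [smul_smul, inv_mul_cancel₀ (Complex.ofReal_ne_zero.2 hc.ne'), one_smul]
  have hxx := hcancel hs1 (hyj 1)
  have hyy := hcancel hs1 (hyj 2)
  have hxy := hcancel hs2 (hyj 3)
  have hlap : Tendsto (fun n => laplacian (u n)) atTop
      (𝓝 (((√(1 - μ) : ℝ) : ℂ)⁻¹ • y 1 + ((√(1 - μ) : ℝ) : ℂ)⁻¹ • y 2)) :=
    (hxx.add hyy).congr fun n => by rw [laplacian_of_mem_H2 hG (hu n).1, Fin.sum_univ_two]
  obtain ⟨K, hK, hb⟩ := h.exists_norm_wjet_le 0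
  have hcauchy : CauchySeq fun n => wjet (u n) := by
    have hu' := hlap.cauchySeq
    rw [Metric.cauchySeq_iff] at hu' ⊢
    intro ε hε
    obtain ⟨N, hN⟩ := hu' (ε / (K + 1)) (by positivity)
    refine ⟨N, fun m hm n hn => ?_⟩
    have h1 := hN m hm n hn
    rw [dist_eq_norm, ← laplacian_sub hG (hu m).1 (hu n).1, lt_div_iff₀ (by positivity)] at h1
    rw [dist_eq_norm, ← wjet_sub hG (hu m).1.1 (hu n).1.1]
    refine (hb _ ((H2H10sub hG).sub_mem (hu m) (hu n))).trans_lt (lt_of_le_of_lt ?_ h1)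
    nlinarith [norm_nonneg (laplacian (u m - u n))]
  obtain ⟨z, hz⟩ := cauchySeq_tendsto_of_complete hcauchy
  obtain ⟨h1, h2⟩ := tendsto_wjet_mem_H10 hG (fun n => (hu n).2) hz
  have hz' : ∀ i, Tendsto (fun n => weakPartial i (u n)) atTop (𝓝 (weakPartial i z.1)) := fun i => by
    have h3 : weakPartial i z.1 = z.2 i := congrFun (congrArg Prod.snd h2) i
    rw [h3]
    exact (((continuous_apply i).comp continuous_snd).tendsto _).comp hz
  have d00 : HasWeakPartial 0 (weakPartial 0 z.1) _ := .of_tendsto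
    (fun n => hasWeakPartial_weakPartial ((hu n).1.2 0) 0) (hz' 0) hxx
  have d11 : HasWeakPartial 1 (weakPartial 1 z.1) _ := .of_tendsto
    (fun n => hasWeakPartial_weakPartial ((hu n).1.2 1) 1) (hz' 1) hyy
  have d01 : HasWeakPartial 0 (weakPartial 1 z.1) _ := .of_tendsto
    (fun n => hasWeakPartial_weakPartial ((hu n).1.2 1) 0) (hz' 1) hxy
  -- The jet carries only one of the two mixed derivatives; the other exists by symmetry.
  have d10 : HasWeakPartial 1 (weakPartial 0 z.1) _ :=
    (hasWeakPartial_weakPartial h1.1 1).comm d01 (hasWeakPartial_weakPartial h1.1 0)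
  have hH2 : z.1 ∈ H2 G := ⟨h1.1, fun i => by
    fin_cases i
    · exact fun j => by
        fin_cases j
        · exact ⟨_, d00⟩
        · exact ⟨_, d10⟩
    · exact fun j => by
        fin_cases j
        · exact ⟨_, d01⟩
        · exact ⟨_, d11⟩⟩
  refine ⟨z.1, ⟨hH2, h1⟩, ?_⟩
  refine tendsto_nhds_unique ?_ hy
  rw [← weakPartial_eq hG d00] at hxx
  rw [← weakPartial_eq hG d11] at hyy
  rw [← weakPartial_eq hG d01] at hxy
  refine ((PiLp.continuous_toLp 2 _).tendsto _).comp (tendsto_pi_nhds.2 fun j => ?_)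
  fin_cases j
  · exact (hxx.add hyy).const_smul _
  · exact hxx.const_smul _
  · exact hyy.const_smul _
  · exact hxy.const_smul _

/-- The normal derivative is bounded on `H² ∩ H¹₀` in the energy norm of the plate. -/
lemma IsC2Domain.exists_norm_normalL2_le (hμ₀ : 0 < μ) (hμ₁ : μ < 1) : ∃ K : ℝ, 0 ≤ K ∧
    ∀ w ∈ H2H10 G, ‖normalL2 w‖ ≤ K * ‖plateJet μ w‖ := by
  have hG := h.isOpen
  obtain ⟨K₁, hK₁, hb₁⟩ := h.exists_norm_wjet_le 0
  obtain ⟨K₂, hK₂, hb₂⟩ := h.exists_bound_trace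
  have hs0 : 0 < √μ := Real.sqrt_pos.2 hμ₀
  have hs1 : 0 < √(1 - μ) := Real.sqrt_pos.2 (sub_pos.2 hμ₁)
  have hs2 : 0 < √(2 * (1 - μ)) := Real.sqrt_pos.2 (mul_pos two_pos (sub_pos.2 hμ₁))
  -- `M` bounds the `H¹` norm of each first derivative of `w`: the first summand handles the
  -- derivative itself through the Laplacian, the others its gradient through the entries of
  -- `plateJet`.
  set M := K₁ * (√μ)⁻¹ + (√(1 - μ))⁻¹ + (√(2 * (1 - μ)))⁻¹ with hM
  have hM0 : 0 ≤ M := by positivity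
  refine ⟨2 * (K₂ * M), by positivity, fun w hw => ?_⟩
  set P := ‖plateJet μ w‖ with hP
  have hP0 : 0 ≤ P := norm_nonneg _
  have hent : ∀ {c : ℝ}, 0 < c → ∀ {a : L2 G} (j : Fin 4), plateJet μ w j = (c : ℂ) • a →
      ‖a‖ ≤ c⁻¹ * P := fun {c} hc {a} j hj => by
    have h1 := PiLp.norm_apply_le (plateJet μ w) j
    rw [hj, norm_smul, Complex.norm_real, Real.norm_of_nonneg hc.le] at h1
    rwa [le_inv_mul_iff₀ hc]
  have h10 : weakPartial 1 (weakPartial 0 w) = weakPartial 0 (weakPartial 1 w) :=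
    weakPartial_eq hG ((hasWeakPartial_weakPartial hw.1.1 1).comm
      (hasWeakPartial_weakPartial (hw.1.2 1) 0) (hasWeakPartial_weakPartial hw.1.1 0))
  have hsecond : ∀ i j, ‖weakPartial i (weakPartial j w)‖ ≤
      ((√(1 - μ))⁻¹ + (√(2 * (1 - μ)))⁻¹) * P := fun i j => by
    have e1 := hent hs1 (a := weakPartial 0 (weakPartial 0 w)) 1 rfl
    have e2 := hent hs1 (a := weakPartial 1 (weakPartial 1 w)) 2 rfl
    have e3 := hent hs2 (a := weakPartial 0 (weakPartial 1 w)) 3 rfl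
    have e4 : 0 ≤ (√(1 - μ))⁻¹ * P := by positivity
    have e5 : 0 ≤ (√(2 * (1 - μ)))⁻¹ * P := by positivity
    rw [add_mul]
    fin_cases i <;> fin_cases j
    · exact e1.trans (le_add_of_nonneg_right e5)
    · exact e3.trans (le_add_of_nonneg_left e4)
    · change ‖weakPartial 1 (weakPartial 0 w)‖ ≤ _
      rw [h10]
      exact e3.trans (le_add_of_nonneg_left e4)
    · exact e2.trans (le_add_of_nonneg_right e5)
  have hfirst : ∀ j, ‖weakPartial j w‖ ≤ K₁ * (√μ)⁻¹ * P := fun j => by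
    refine ((norm_le_pi_norm (wjet w).2 j).trans (norm_snd_le (wjet w))).trans ((hb₁ w hw).trans ?_)
    rw [mul_assoc]
    exact mul_le_mul_of_nonneg_left (norm_laplacian_le_plateJet hG hμ₀ hw.1) hK₁
  have hjet : ∀ j, ‖wjet (weakPartial j w)‖ ≤ M * P := fun j => by
    have e1 : 0 ≤ K₁ * (√μ)⁻¹ * P := by positivity
    have e2 : 0 ≤ ((√(1 - μ))⁻¹ + (√(2 * (1 - μ)))⁻¹) * P := by positivity
    have e3 : M * P = K₁ * (√μ)⁻¹ * P + ((√(1 - μ))⁻¹ + (√(2 * (1 - μ)))⁻¹) * P := by rw [hM]; ring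
    rw [e3]
    refine max_le ((hfirst j).trans (le_add_of_nonneg_right e2)) ?_
    exact (pi_norm_le_iff_of_nonneg (by positivity)).2 fun i =>
      (hsecond i j).trans (le_add_of_nonneg_left e1)
  have hterm : ∀ j, ‖mulNormal j (trace (weakPartial j w))‖ ≤ K₂ * (M * P) := fun j =>
    (h.norm_mulNormal_le j _).trans ((hb₂ _ (hw.1.2 j)).trans
      (mul_le_mul_of_nonneg_left (hjet j) hK₂))
  rw [normalL2, Fin.sum_univ_two]
  calc _ ≤ K₂ * (M * P) + K₂ * (M * P) := (norm_add_le _ _).trans (add_le_add (hterm 0) (hterm 1))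
    _ = _ := by ring

/-- Riesz representation in the plate inner product. The boundary functional is bounded because
traces of first derivatives are controlled by the plate energy. -/
lemma IsC2Domain.isGreenExt_opG (hμ₀ : 0 < μ) (hμ₁ : μ < 1) (t : L2Bdry G) :
    IsGreenExt μ t (opG μ t) := by
  have hG := h.isOpen
  refine theObj_spec ?_
  obtain ⟨K, hK, hb⟩ := h.exists_norm_normalL2_le hμ₀ hμ₁
  obtain ⟨p, hp, h1⟩ := exists_riesz (le_refl (H2H10sub hG)) (T := plateJet μ)
    (fun x hx y hy => plateJet_add hG hx.1 hy.1) (fun c x hx => plateJet_smul hG hx.1 c)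
    (h.exists_plateJet_eq hμ₁) (ℓ := fun w => inner ℂ (normalL2 w) t)
    (fun x hx y hy => by rw [h.normalL2_add hx.1 hy.1, inner_add_left])
    (fun c x hx => by rw [h.normalL2_smul hx.1, inner_smul_left]) (K := ‖t‖ * K) (fun x hx => by
      refine (norm_inner_le_norm _ _).trans ?_
      rw [mul_comm, mul_assoc]
      exact mul_le_mul_of_nonneg_left (hb x hx) (norm_nonneg t))
  exact ⟨p, hp, fun ϖ hϖ => by
    rw [← inner_plateJet hμ₀ hμ₁, h1 ϖ hϖ, h.inner_normalL2]⟩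

/-- Riesz representation for a functional known only on `H² ∩ H¹₀`. The equation is tested only
there, and this is enough because the energy balance uses it with `ϖ = w₂`. -/
lemma IsC2Domain.opPinv_spec {γ : ℝ} (hγ : 0 ≤ γ) {ℓ : L2 G → ℂ}
    (ladd : ∀ x ∈ H2H10 G, ∀ y ∈ H2H10 G, ℓ (x + y) = ℓ x + ℓ y)
    (lsmul : ∀ c : ℂ, ∀ x ∈ H2H10 G, ℓ (c • x) = conj c * ℓ x) (hℓ : MemDualγ γ ℓ) :
    opPinv γ ℓ ∈ H10γ G γ ∧
      ∀ ϖ ∈ H2H10 G, ip (opPinv γ ℓ) ϖ + (γ : ℂ) * gradIp (opPinv γ ℓ) ϖ = ℓ ϖ := by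
  have hG := h.isOpen
  refine theObj_spec (P := fun p => p ∈ H10γ G γ ∧ ∀ ϖ ∈ H2H10 G,
    ip p ϖ + (γ : ℂ) * gradIp p ϖ = ℓ ϖ) ?_
  obtain ⟨K, hK⟩ := hℓ
  -- For `γ = 0` the weighted jet no longer sees the derivatives, so the representation takes place
  -- in `L²` with `T` the identity.
  rcases hγ.eq_or_lt with rfl | hγ
  · obtain ⟨p, -, h1⟩ := exists_riesz (S := ⊤) (S₀ := H2H10sub hG) le_top (T := fun f : L2 G => f)
      (fun _ _ _ _ => rfl) (fun _ _ _ => rfl) (fun _ _ y _ => ⟨y, trivial, rfl⟩) ladd lsmul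
      (K := K) (fun x hx => (hK x hx).trans_eq (by
        rw [normSqγ, zero_mul, add_zero, Real.sqrt_sq (norm_nonneg x)]))
    refine ⟨p, by simp [H10γ], fun ϖ hϖ => ?_⟩
    rw [Complex.ofReal_zero, zero_mul, add_zero, ← h1 ϖ hϖ]; rfl
  · have hs : √γ ≠ 0 := (Real.sqrt_pos.2 hγ).ne'
    obtain ⟨p, hp, h1⟩ := exists_riesz (S := H10sub hG) (S₀ := H2H10sub hG) inf_le_right
      (T := hjet √γ) (fun x hx y hy => hjet_add hG _ hx.1 hy.1)
      (fun c x hx => hjet_smul hG _ hx.1 c)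
      (fun u hu y hy => by
        obtain ⟨h1, h2⟩ := tendsto_wjet_mem_H10 hG hu (tendsto_wjet_of_hjet hs hy)
        exact ⟨_, h1, hjet_eq hs h2⟩) ladd lsmul
      (K := K) (fun x hx => (hK x hx).trans_eq (by
        rw [← Real.sqrt_sq (norm_nonneg (hjet √γ x)), norm_hjet_sq, Real.sq_sqrt hγ.le, normSqγ]))
    refine ⟨p, by rw [H10γ, if_pos hγ]; exact hp, fun ϖ hϖ => ?_⟩
    rw [← h1 ϖ hϖ, inner_hjet, Real.sq_sqrt hγ.le]

lemma IsC2Domain.mem_H2H10_of_isTest {φ : E 2 → ℂ} (hφ : IsTest G φ) : rL2 G φ ∈ H2H10 G :=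
  ⟨⟨hφ.isCc.mem_H1, fun i => by
    rw [hφ.isCc.weakPartial_eq h.isOpen]
    exact (hφ.pd i).isCc.mem_H1⟩, hφ.mem_H10 h.isOpen⟩

lemma IsC2Domain.laplacian_test {φ : E 2 → ℂ} (hφ : IsTest G φ) :
    laplacian (rL2 G φ) = rL2 G fun x => ∑ i, pd i (pd i φ) x := by
  have h1 : (rL2 G fun x => ∑ i, pd i (pd i φ) x) = ∑ i, rL2 G (pd i (pd i φ)) :=
    toL2_sum _ fun i => ((hφ.isCc.pd i).pd i).memLp _
  rw [laplacian_of_mem_H2 h.isOpen (h.mem_H2H10_of_isTest hφ).1, h1]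
  refine Finset.sum_congr rfl fun i _ => ?_
  rw [hφ.isCc.weakPartial_eq h.isOpen, (hφ.isCc.pd i).weakPartial_eq h.isOpen]

/-- The Dirichlet extension is harmonic in the distributional sense. -/
lemma IsC2Domain.hasLaplacian_opD (t : L2Bdry G) : HasLaplacian (opD t) (0 : L2 G) := by
  have hG := h.isOpen
  intro φ hφ
  have h0 : ∫ x in G, φ x • (0 : L2 G) x = 0 := by
    rw [← ip_rL2_ofReal _ hφ.1 hφ.2.1, ip_zero_left]
  rw [h0]
  have hs : ContDiff ℝ ∞ fun x => ∑ i, pd i (pd i φ) x :=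
    ContDiff.sum fun i _ => ((hφ.pd i).pd i).1
  have hc : HasCompactSupport fun x => ∑ i, pd i (pd i φ) x := by
    simp only [Fin.sum_univ_two]
    exact ((hφ.pd 0).pd 0).2.1.add ((hφ.pd 1).pd 1).2.1
  have h1 : (fun x => ((∑ i, pd i (pd i φ) x : ℝ) : ℂ)) =
      fun x => ∑ i, pd i (pd i fun x => (φ x : ℂ)) x := by
    ext x
    push_cast
    refine Finset.sum_congr rfl fun i _ => ?_
    rw [pd_ofReal (hφ.1.differentiable (by simp)), pd_ofReal ((hφ.pd i).1.differentiable (by simp))]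
  rw [← ip_rL2_ofReal _ hs hc, h1, ← h.laplacian_test hφ.ofReal]
  -- Existence of the transposition solution need not be proved: without one, `opD t` is the default
  -- `0`, which is harmonic too.
  by_cases hex : ∃ v : L2 G, IsDirichletExt t v
  · rw [opD, theObj_spec hex _ (h.mem_H2H10_of_isTest hφ.ofReal), ← h.inner_normalL2,
      h.normalL2_test hφ.ofReal, inner_zero_left]
  · rw [opD, theObj, dif_neg hex, ip_zero_left]

/-- Subtracting the distributionally harmonic function `opD (trace θ)` does not change the
Laplacian, so no information about its boundary values is required. -/
lemma IsC2Domain.opADD_eq {θ : L2 G} (hθ : θ ∈ H2 G) : opADD θ = -laplacian θ := by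
  rw [opADD, opAD]
  congr 1
  refine laplacian_eq h.isOpen fun φ hφ => ?_
  have hs : ContDiff ℝ ∞ fun x => ∑ i, pd i (pd i φ) x :=
    ContDiff.sum fun i _ => ((hφ.pd i).pd i).1
  have hc : HasCompactSupport fun x => ∑ i, pd i (pd i φ) x := by
    simp only [Fin.sum_univ_two]
    exact ((hφ.pd 0).pd 0).2.1.add ((hφ.pd 1).pd 1).2.1
  have h1 := laplacian_of_mem_H2 h.isOpen hθ ▸ hasLaplacian_of_mem_H2 hθ φ hφ
  have h2 := h.hasLaplacian_opD (trace θ) φ hφ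
  rw [← ip_rL2_ofReal _ hs hc, ← ip_rL2_ofReal _ hφ.1 hφ.2.1] at *
  rw [ip_sub_left, h1, h2, ip_zero_left, sub_zero]

end Plate

/-! ### The chamber -/

namespace Chamber

variable (C : Chamber)

lemma isC2Domain_Ω : IsC2Domain C.Ω := ⟨C.isOpen_Ω, C.isBounded_Ω, C.c2_Ω⟩

lemma image_subset_frontier : C.ι '' C.G ⊆ frontier C.Ω := by
  rw [C.frontier_Ω]
  exact subset_closure.trans subset_union_left

/-- Boundedness of the wall is inherited from the compact boundary of `Ω` through the isometry `ι`.
-/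
lemma isC2Domain_G : IsC2Domain C.G := by
  refine ⟨C.isOpen_G, ?_, C.c2_G⟩
  have h1 : Bornology.IsBounded (C.ι '' C.G) :=
    (isCompact_frontier C.isBounded_Ω).isBounded.subset C.image_subset_frontier
  have h2 := C.ι.isometry.antilipschitz.isBounded_preimage h1
  exact h2.subset (subset_preimage_image _ _)

/-- An isometry preserves two-dimensional Hausdorff measure, and the wall is part of the boundary.
The inequality is enough to carry square integrability and almost everywhere statements from `∂Ω` to
the wall. -/
lemma map_ι_le : (volume.restrict C.G).map C.ι ≤ surfaceMeasure C.Ω := by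
  have hι := C.ι.isometry
  have hm : MeasurableEmbedding C.ι := hι.isClosedEmbedding.measurableEmbedding
  refine Measure.le_iff.2 fun s hs => ?_
  rw [Measure.map_apply hm.measurable hs, Measure.restrict_apply (hm.measurable hs), surfaceMeasure,
    Measure.restrict_apply hs, ← EuclideanSpace.euclideanHausdorffMeasure_eq_volume,
    ← hι.euclideanHausdorffMeasure_image]
  refine measure_mono ?_
  rintro _ ⟨x, ⟨hx, hxG⟩, rfl⟩
  exact ⟨hx, C.image_subset_frontier ⟨x, hxG, rfl⟩⟩

lemma memLp_comp {t : E 3 → ℂ} (ht : MemLp t 2 (surfaceMeasure C.Ω)) :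
    MemLp (fun y => t (C.ι y)) 2 (volume.restrict C.G) :=
  (memLp_map_measure_iff (ht.mono_measure C.map_ι_le).1
    C.ι.isometry.continuous.aemeasurable).1 (ht.mono_measure C.map_ι_le)

lemma ae_comp {p : E 3 → Prop} (h : ∀ᵐ x ∂surfaceMeasure C.Ω, p x) :
    ∀ᵐ y ∂volume.restrict C.G, p (C.ι y) :=
  ae_of_ae_map C.ι.isometry.continuous.aemeasurable (C.map_ι_le.absolutelyContinuous.ae_le h)

lemma memLp_traceΓ₀ (f : L2 C.Ω) : MemLp (C.traceΓ₀ f) 2 (volume.restrict C.G) :=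
  C.memLp_comp (Lp.memLp (trace f))

/-- The restriction of the trace to `Γ₀` as an element of `L²(Γ₀)`. -/
def wallTrace (f : L2 C.Ω) : L2 C.G := rL2 C.G (C.traceΓ₀ f)

lemma coeFn_wallTrace (f : L2 C.Ω) : C.wallTrace f =ᵐ[volume.restrict C.G] C.traceΓ₀ f :=
  coeFn_toL2 (C.memLp_traceΓ₀ f)

lemma norm_wallTrace_le (f : L2 C.Ω) : ‖C.wallTrace f‖ ≤ ‖trace f‖ := by
  have hm := C.memLp_traceΓ₀ f
  rw [wallTrace, rL2, toL2, dif_pos hm, Lp.norm_toLp, Lp.norm_def]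
  refine ENNReal.toReal_mono (Lp.eLpNorm_ne_top _) ?_
  have h1 := eLpNorm_map_measure (p := 2) ((Lp.memLp (trace f)).mono_measure C.map_ι_le).1
    C.ι.isometry.continuous.aemeasurable
  exact h1.symm.trans_le (eLpNorm_mono_measure _ C.map_ι_le)

lemma wallTrace_add {f g : L2 C.Ω} (hf : f ∈ H1 C.Ω) (hg : g ∈ H1 C.Ω) :
    C.wallTrace (f + g) = C.wallTrace f + C.wallTrace g := by
  rw [wallTrace, wallTrace, wallTrace, rL2, rL2, rL2,
    ← toL2_add (C.memLp_traceΓ₀ f) (C.memLp_traceΓ₀ g)]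
  refine toL2_congr ?_
  have h1 := Lp.coeFn_add (trace f) (trace g)
  rw [← C.isC2Domain_Ω.trace_add hf hg] at h1
  exact C.ae_comp h1

lemma wallTrace_smul {f : L2 C.Ω} (hf : f ∈ H1 C.Ω) (c : ℂ) :
    C.wallTrace (c • f) = c • C.wallTrace f := by
  rw [wallTrace, wallTrace, rL2, rL2, ← toL2_smul (C.memLp_traceΓ₀ f)]
  refine toL2_congr ?_
  have h1 := Lp.coeFn_smul c (trace f)
  rw [← C.isC2Domain_Ω.trace_smul hf] at h1
  exact C.ae_comp h1

lemma ip_wallTrace_right (g : L2 C.G) (f : L2 C.Ω) :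
    ip g (C.wallTrace f) = ∫ y in C.G, g y * conj (C.traceΓ₀ f y) := by
  rw [ip_eq_integral]
  exact integral_congr_ae ((C.coeFn_wallTrace f).mono fun x hx => by simp only [hx])

lemma ip_wallTrace_left (g : L2 C.G) (f : L2 C.Ω) :
    ip (C.wallTrace f) g = ∫ y in C.G, C.traceΓ₀ f y * conj (g y) := by
  rw [ip_eq_integral]
  exact integral_congr_ae ((C.coeFn_wallTrace f).mono fun x hx => by simp only [hx])

/-- Riesz representation in `H¹(Ω)`; the trace inequality bounds the pairing of `g` with the wall
trace. -/
lemma isNeumannExt_opN (g : L2 C.G) : C.IsNeumannExt g (C.opN g) := by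
  have hU := C.isOpen_Ω
  refine theObj_spec ?_
  obtain ⟨K, hK, hb⟩ := C.isC2Domain_Ω.exists_bound_trace
  obtain ⟨p, hp, h1⟩ := exists_riesz (le_refl (H1sub C.Ω)) (T := hjet 1)
    (fun x hx y hy => hjet_add hU 1 hx hy) (fun c x hx => hjet_smul hU 1 hx c)
    (fun u hu y hy => by
      obtain ⟨h1, h2⟩ := tendsto_wjet_mem_H1 hU hu (tendsto_wjet_of_hjet one_ne_zero hy)
      exact ⟨_, h1, hjet_eq one_ne_zero h2⟩)
    (ℓ := fun ψ => ip g (C.wallTrace ψ))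
    (fun x hx y hy => by rw [C.wallTrace_add hx hy, ip_add_right])
    (fun c x hx => by rw [C.wallTrace_smul hx, ip_smul_right])
    (K := ‖g‖ * K) (fun x hx => by
      refine (norm_ip_le _ _).trans ?_
      rw [mul_assoc]
      refine mul_le_mul_of_nonneg_left ?_ (norm_nonneg g)
      exact (C.norm_wallTrace_le x).trans ((hb x hx).trans
        (mul_le_mul_of_nonneg_left (norm_wjet_le x) hK)))
  refine ⟨p, hp, fun ψ hψ => ?_⟩
  rw [← C.ip_wallTrace_right, ← h1 ψ hψ, inner_hjet]
  simp [add_comm]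

end Chamber

/-! ### Energy balance of the coupled system -/

section Dissipation

variable {C : Chamber} {γ α μ lam : ℝ}

lemma conj_gradIp {d : ℕ} {U : Set (E d)} (f g : L2 U) : conj (gradIp f g) = gradIp g f := by
  simp only [gradIp, map_sum, conj_ip]

lemma conj_plateForm {G : Set (E 2)} (hμ₀ : 0 < μ) (hμ₁ : μ < 1) (f g : L2 G) :
    conj (plateForm μ f g) = plateForm μ g f := by
  rw [← inner_plateJet hμ₀ hμ₁, inner_conj_symm, inner_plateJet hμ₀ hμ₁]

lemma plateForm_add_right {G : Set (E 2)} (hG : IsOpen G) (hμ₀ : 0 < μ) (hμ₁ : μ < 1) (f : L2 G)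
    {g g' : L2 G} (hg : g ∈ H2 G) (hg' : g' ∈ H2 G) :
    plateForm μ f (g + g') = plateForm μ f g + plateForm μ f g' := by
  simp only [← inner_plateJet hμ₀ hμ₁, plateJet_add hG hg hg', inner_add_left]

lemma plateForm_smul_right {G : Set (E 2)} (hG : IsOpen G) (hμ₀ : 0 < μ) (hμ₁ : μ < 1) (f : L2 G)
    {g : L2 G} (hg : g ∈ H2 G) (c : ℂ) : plateForm μ f (c • g) = conj c * plateForm μ f g := by
  simp only [← inner_plateJet hμ₀ hμ₁, plateJet_smul hG hg, inner_smul_left]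

lemma norm_le_sqrt_normSqγ {G : Set (E 2)} (hγ : 0 ≤ γ) (f : L2 G) : ‖f‖ ≤ √(normSqγ γ f) := by
  refine Real.le_sqrt_of_sq_le ?_
  have : 0 ≤ gradNormSq f := Finset.sum_nonneg fun i _ => by positivity
  exact le_add_of_nonneg_right (by positivity)

/-- The functional in the equation for the plate velocity. -/
lemma opA_w₂_spec (hγ₀ : 0 ≤ γ) (hμ₀ : 0 < μ) (hμ₁ : μ < 1) {Φ : State C}
    (hΦ : MemDualγ γ (plateFunctional α μ Φ.w₁ Φ.θ)) :
    (opA γ α μ Φ).w₂ ∈ H10γ C.G γ ∧ ∀ ϖ ∈ H2H10 C.G,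
      ip (opA γ α μ Φ).w₂ ϖ + (γ : ℂ) * gradIp (opA γ α μ Φ).w₂ ϖ =
        -ip (C.wallTrace Φ.z₂) ϖ - plateFunctional α μ Φ.w₁ Φ.θ ϖ + (α : ℂ) * ip (opADD Φ.θ) ϖ := by
  have hG := C.isOpen_G
  have h1 : (opA γ α μ Φ).w₂ = opPinv γ fun ϖ => -ip (C.wallTrace Φ.z₂) ϖ -
      plateFunctional α μ Φ.w₁ Φ.θ ϖ + (α : ℂ) * ip (opADD Φ.θ) ϖ := by
    simp only [opA, C.ip_wallTrace_left]
  rw [h1]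
  refine C.isC2Domain_G.opPinv_spec hγ₀ (fun x hx y hy => ?_) (fun c x hx => ?_) ?_
  · simp only [plateFunctional, ip_add_right, plateForm_add_right hG hμ₀ hμ₁ _ hx.1 hy.1]
    ring
  · simp only [plateFunctional, ip_smul_right, plateForm_smul_right hG hμ₀ hμ₁ _ hx.1]
    ring
  · obtain ⟨K, hK⟩ := hΦ
    -- Only the plate functional draws on the domain condition; the other two terms are `L²`
    -- pairings, and the `L²` norm is dominated by that of `H¹_{0,γ}`.
    refine ⟨‖C.wallTrace Φ.z₂‖ + K + |α| * ‖opADD Φ.θ‖, fun ϖ hϖ => ?_⟩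
    have h2 := norm_le_sqrt_normSqγ hγ₀ ϖ
    refine (norm_add_le _ _).trans ?_
    rw [add_mul]
    refine add_le_add ((norm_sub_le _ _).trans ?_) ?_
    · rw [add_mul, norm_neg]
      exact add_le_add ((norm_ip_le _ _).trans (by gcongr)) (hK ϖ hϖ)
    · rw [norm_mul, Complex.norm_real, Real.norm_eq_abs, mul_assoc]
      gcongr
      exact (norm_ip_le _ _).trans (by gcongr)

/-- The acoustic part of the energy balance. -/
lemma Chamber.ip_opAN {z₁ z₂ : L2 C.Ω} {g : L2 C.G} (hz₁ : z₁ ∈ H1 C.Ω) (hz₂ : z₂ ∈ H1 C.Ω)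
    (hy : z₁ - C.opN g ∈ C.domAN) : ip (C.opAN (z₁ - C.opN g)) z₂ =
      gradIp z₁ z₂ + ip z₁ z₂ - ip g (C.wallTrace z₂) := by
  obtain ⟨hN, hN'⟩ := C.isNeumannExt_opN g
  have h1 := C.isC2Domain_Ω.ip_laplacian_add hy.1 hz₂
  -- Green's formula is applied to the `H²` function `z₁ - N g`, not to `z₁`. It has no boundary
  -- term, and the wall contribution comes solely from the weak equation of `N g`.
  have h2 : normalL2 (z₁ - C.opN g) = 0 := by
    refine Lp.ext ((C.isC2Domain_Ω.coeFn_normalL2 _).trans (EventuallyEq.trans ?_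
      (Lp.coeFn_zero ℂ 2 _).symm))
    exact hy.2
  have h3 : gradIp (z₁ - C.opN g) z₂ = gradIp z₁ z₂ - gradIp (C.opN g) z₂ := by
    simp only [gradIp, weakPartial_sub C.isOpen_Ω hz₁ hN, ip_sub_left, Finset.sum_sub_distrib]
  have h4 := hN' z₂ hz₂
  rw [← C.ip_wallTrace_right] at h4
  rw [h2, inner_zero_right, h3] at h1
  rw [Chamber.opAN, ip_sub_left, ip_sub_left]
  linear_combination -h1 - h4

end Dissipation

end StructuralAcoustics

end

theorem proposition6 (C : StructuralAcoustics.Chamber) (γ α μ lam : ℝ)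
    (hγ₀ : 0 ≤ γ) (hγ₁ : γ ≤ 1) (hα : 0 < α) (hμ₀ : 0 < μ) (hμ₁ : μ < 1) (hlam : 0 ≤ lam)
    (Φ : StructuralAcoustics.State C) (hΦ : Φ ∈ StructuralAcoustics.domA C γ α μ lam) :
    StructuralAcoustics.opA γ α μ Φ ∈ StructuralAcoustics.energySpace C γ ∧
    (StructuralAcoustics.energyIp γ μ (StructuralAcoustics.opA γ α μ Φ) Φ).re =
      -StructuralAcoustics.gradNormSq Φ.θ - ‖Φ.θ‖ ^ 2
        - lam * ‖StructuralAcoustics.trace Φ.θ‖ ^ 2 := by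
  open StructuralAcoustics in
  obtain ⟨hz₁, hz₂, hw₁, hw₂, hθ, hy, hdual, hbc⟩ := hΦ
  have hD := C.isC2Domain_G
  obtain ⟨hp, hp'⟩ := opA_w₂_spec (C := C) (α := α) hγ₀ hμ₀ hμ₁ hdual
  -- The second and fifth components are only required to be in `L²`, which their type provides.
  refine ⟨⟨hz₂, hw₂, hp⟩, ?_⟩
  have hac := C.ip_opAN hz₁ hz₂ hy
  have hplate := hp' Φ.w₂ hw₂
  -- This turns `a(Gγ₀θ, w₂)` into `(γ₀θ, ∂w₂/∂ν)`, the partner of the boundary term that Green's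
  -- formula produces for `Δw₂` against `θ`.
  have hgreen := (hD.isGreenExt_opG hμ₀ hμ₁ (trace Φ.θ)).2 Φ.w₂ hw₂
  rw [← hD.inner_normalL2] at hgreen
  have hθw := hD.ip_laplacian_add hθ hw₂.1.1
  rw [hD.trace_eq_zero hw₂.2, inner_zero_left] at hθw
  have hwθ := hD.ip_laplacian_add hw₂.1 hθ.1
  have hθθ := hD.ip_laplacian_add hθ hθ.1
  have hrobin : normalL2 Φ.θ = -((lam : ℂ) • trace Φ.θ) := by
    refine Lp.ext ?_
    filter_upwards [hD.coeFn_normalL2 Φ.θ, hbc, Lp.coeFn_neg ((lam : ℂ) • trace Φ.θ),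
      Lp.coeFn_smul (lam : ℂ) (trace Φ.θ)] with x h1 h2 h3 h4
    rw [h1, h3, Pi.neg_apply, h4, Pi.smul_apply, smul_eq_mul]
    exact eq_neg_of_add_eq_zero_left h2
  rw [hrobin, inner_neg_right, inner_smul_right, inner_self_eq_norm_sq_to_K, gradIp_self] at hθθ
  rw [plateFunctional, hgreen, hD.opADD_eq hθ, ip_neg_left] at hplate
  have hrow₂ : ip (opA γ α μ Φ).z₂ Φ.z₂ = -(gradIp Φ.z₁ Φ.z₂ + ip Φ.z₁ Φ.z₂ -
      ip Φ.w₂ (C.wallTrace Φ.z₂)) := by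
    rw [← hac, ← ip_neg_left]; rfl
  have hrow₅ : ip (opA γ α μ Φ).θ Φ.θ =
      α * ip (laplacian Φ.w₂) Φ.θ + ip (laplacian Φ.θ) Φ.θ - ip Φ.θ Φ.θ := by
    simp only [opA, hD.opADD_eq hθ, opAD, ip_sub_left, ip_neg_left, ip_smul_left]
    ring
  -- Each coupling is displayed as a number minus its conjugate, hence purely imaginary; the last
  -- line is the dissipation.
  have key : energyIp γ μ (opA γ α μ Φ) Φ =
      (gradIp Φ.z₂ Φ.z₁ - conj (gradIp Φ.z₂ Φ.z₁)) + (ip Φ.z₂ Φ.z₁ - conj (ip Φ.z₂ Φ.z₁)) +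
      (ip Φ.w₂ (C.wallTrace Φ.z₂) - conj (ip Φ.w₂ (C.wallTrace Φ.z₂))) +
      (plateForm μ Φ.w₂ Φ.w₁ - conj (plateForm μ Φ.w₂ Φ.w₁)) +
      α * (gradIp Φ.θ Φ.w₂ - conj (gradIp Φ.θ Φ.w₂)) +
      α * (inner ℂ (trace Φ.θ) (normalL2 Φ.w₂) - conj (inner ℂ (trace Φ.θ) (normalL2 Φ.w₂))) +
      ((-gradNormSq Φ.θ - ‖Φ.θ‖ ^ 2 - lam * ‖trace Φ.θ‖ ^ 2 : ℝ) : ℂ) := by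
    have e1 : energyIp γ μ (opA γ α μ Φ) Φ = gradIp Φ.z₂ Φ.z₁ + ip Φ.z₂ Φ.z₁ +
        ip (opA γ α μ Φ).z₂ Φ.z₂ + plateForm μ Φ.w₂ Φ.w₁ + ip (opA γ α μ Φ).w₂ Φ.w₂ +
        (γ : ℂ) * gradIp (opA γ α μ Φ).w₂ Φ.w₂ + ip (opA γ α μ Φ).θ Φ.θ := rfl
    rw [e1, hrow₂, hrow₅, ip_self, conj_gradIp, conj_gradIp, conj_ip, conj_ip,
      conj_plateForm hμ₀ hμ₁, inner_conj_symm]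
    push_cast
    simp only [Complex.coe_algebraMap] at hθθ
    linear_combination hplate - α * hθw + α * hwθ + hθθ
  have him : ∀ z : ℂ, (z - conj z).re = 0 := fun z => by simp
  have him' : ∀ z : ℂ, ((α : ℂ) * (z - conj z)).re = 0 := fun z => by simp
  rw [key]
  simp only [Complex.add_re, him, him', Complex.ofReal_re, zero_add]
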